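/- Let $X$ be a compact connected Riemann surface, $W\subset X$ open, $f:W\to X$ holomorphic, and let $M$ be a connected (finite-dimensional) complex manifold. Let $\{f_\lambda:W_\lambda\to X\}_{\lambda\in M}$ be a natural family: $W_\lambda=\psi_\lambda(W)$, and $f_\lambda=\varphi_\lambda\circ f\circ\psi_\lambda^{-1}$ is holomorphic on $W_\lambda$, where $\varphi_\lambda,\psi_\lambda:X\to X$ are quasiconformal homeomorphisms depending holomorphically on $\lambda$, i.e. $\lambda\mapsto\varphi_\lambda(z)$ and $\lambda\mapsto\psi_\lambda(z)$ are holomorphic for every $z\in X$. Assume that every $f_\lambda$ is an Ahlfors island map: $W_\lambda\neq\emptyset$ and there is $N\ge1$ (which may depend on $\lambda$) such that, for any $N$ Jordan domains $D_1,\dots,D_N\subset X$ with pairwise disjoint closures and any open set $U$ meeting $\partial W_\lambda$, there are an index $i$ and an open set $\Omega\Subset U\cap W_\lambda$ such that $f_\lambda:\Omega\to D_i$ is a conformal isomorphism. Let $S(f)$ be the closure of the set of critical and asymptotic values of $f$, let $v\in S(f)$, and let $v_\lambda:=\varphi_\lambda(v)$ be the corresponding singular value of $f_\lambda$. It is called passive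 at $\lambda_0\in M$ if $\lambda_0$ has an open neighborhood $V$ such that either (1) for some $n\ge0$ and all $\lambda\in V$, $f_\lambda^n(v_\lambda)$ is defined and lies in $X\setminus W_\lambda$, or (2) the maps $\lambda\mapsto f_\lambda^n(v_\lambda)$, $n\ge0$, are all defined on $V$ and form a normal family there; it is called active at $\lambda_0$ if it is not passive at $\lambda_0$. Assume that $v_\lambda$ is active at $\lambda_0$. Let $x_{\lambda_0}$ be a repelling periodic point of $f_{\lambda_0}$ of (exact) period $p\ge3$ which is not a Picard exceptional value of $f_{\lambda_0}$, where $y\in X$ is called Picard exceptional for $f_{\lambda_0}$ if $\partial W_{\lambda_0}\neq\emptyset$ and $f_{\lambda_0}^{-1}(y)$ is finite (possibly empty). Let $\lambda\mapsto x_\lambda$ be its analytic continuation as a periodic point, that is, a holomorphic map from an open neighborhood $U$ of $\lambda_0$ to $X$, with the given value $x_{\lambda_0}$ at $\lambda_0$, such that $f_\lambda^p(x_\lambda)=x_\lambda$ for all $\lambda\in U$. Then there are integers $n_k\to+\infty$ and parameters $\lambda_k\in U$ with $\lambda_k\to\lambda_0$ such that, for every $k$, $f_{\lambda_k}^{n_k}(v_{\lambda_k})$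 is defined and $$f_{\lambda_k}^{n_k}(v_{\lambda_k})=x_{\lambda_k}.$$ -/

import Mathlib

open Set Filter Topology MeasureTheory
open scoped Manifold ContDiff

noncomputable section

namespace IslandMaps

/-! ### Quasiconformal homeomorphisms -/

/-- The Wirtinger derivative `∂η/∂z`. -/
def dz (η : ℂ → ℂ) (z : ℂ) : ℂ :=
  (fderiv ℝ η z 1 - Complex.I * fderiv ℝ η z Complex.I) / 2

/-- The Wirtinger derivative `∂η/∂z̄`. -/
def dzbar (η : ℂ → ℂ) (z : ℂ) : ℂ :=
  (fderiv ℝ η z 1 + Complex.I * fderiv ℝ η z Complex.I) / 2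

/-- On the open set `Ω` of the plane, `F` has weak Wirtinger derivatives `F_z = p` and
`F_z̄ = q` in `L²_loc(Ω)`, and `|q| ≤ k |p|` almost everywhere on `Ω`. -/
structure HasBeltramiBoundOn (F p q : ℂ → ℂ) (k : ℝ) (Ω : Set ℂ) : Prop where
  memLp_dz : ∀ K ⊆ Ω, IsCompact K → MemLp p 2 (volume.restrict K)
  memLp_dzbar : ∀ K ⊆ Ω, IsCompact K → MemLp q 2 (volume.restrict K)
  weak_dz : ∀ η : ℂ → ℂ, ContDiff ℝ ∞ η → HasCompactSupport η → tsupport η ⊆ Ω →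
    ∫ z, F z * dz η z = -∫ z, p z * η z
  weak_dzbar : ∀ η : ℂ → ℂ, ContDiff ℝ ∞ η → HasCompactSupport η → tsupport η ⊆ Ω →
    ∫ z, F z * dzbar η z = -∫ z, q z * η z
  bound : ∀ᵐ z ∂(volume.restrict Ω), ‖q z‖ ≤ k * ‖p z‖

variable {X : Type*} [TopologicalSpace X] [ChartedSpace ℂ X]

/-- A homeomorphism `h` of a Riemann surface is quasiconformal (analytic definition) if, read in
holomorphic charts, it is in `W^{1,2}_loc` and satisfies `|h_z̄| ≤ k |h_z|` almost everywhere,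
with one constant `k < 1` for all charts. -/
def IsQuasiconformal (h : X ≃ₜ X) : Prop :=
  ∃ k : ℝ, 0 ≤ k ∧ k < 1 ∧ ∀ e ∈ atlas ℂ X, ∀ e' ∈ atlas ℂ X,
    ∃ p q : ℂ → ℂ, HasBeltramiBoundOn (fun z => e' (h (e.symm z))) p q k
      (e.target ∩ e.symm ⁻¹' (h ⁻¹' e'.source))

/-! ### Partially defined maps

A map `f : W → X` with `W ⊆ X` is represented by a total function `f : X → X` together with `W`;
the values of `f` outside `W` never matter. -/

/-- The `n`-th iterate of `f : W → X` is defined at `z`. -/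
def IterDefined (W : Set X) (f : X → X) (n : ℕ) (z : X) : Prop :=
  ∀ j < n, f^[j] z ∈ W

/-- The critical values of `f : W → X`. -/
def criticalValues (W : Set X) (f : X → X) : Set X :=
  {v | ∃ c ∈ W, mfderiv 𝓘(ℂ) 𝓘(ℂ) f c = 0 ∧ f c = v}

/-- The asymptotic values of `f : W → X`: limits of `f` along curves in `W` that tend to the
boundary of `W`, i.e. that eventually leave each compact subset of `W`. -/
def asymptoticValues (W : Set X) (f : X → X) : Set X :=
  {v | ∃ γ : ℝ → X, ContinuousOn γ (Ici 0) ∧ (∀ t ∈ Ici (0 : ℝ), γ t ∈ W) ∧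
    (∀ K ⊆ W, IsCompact K → ∀ᶠ t in atTop, γ t ∉ K) ∧
    Tendsto (fun t => f (γ t)) atTop (𝓝 v)}

/-- The set `S(f)` of singular values of `f : W → X`. -/
def singularValues (W : Set X) (f : X → X) : Set X :=
  closure (criticalValues W f ∪ asymptoticValues W f)

/-- A Jordan domain: an open set whose closure is an embedded closed disc of which it is the
interior part. -/
def IsJordanDomain (D : Set X) : Prop :=
  IsOpen D ∧ ∃ h : ℂ → X, ContinuousOn h (Metric.closedBall 0 1) ∧
    InjOn h (Metric.closedBall 0 1) ∧ h '' Metric.ball 0 1 = D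

/-- The `N`-island property of `f : W → X`, where `X` is compact. As `f` is holomorphic on `W`,
a bijection `f : Ω → D i` is a conformal isomorphism. -/
def HasIslandProperty (W : Set X) (f : X → X) (N : ℕ) : Prop :=
  ∀ D : Fin N → Set X, (∀ i, IsJordanDomain (D i)) →
    (∀ i j, i ≠ j → Disjoint (closure (D i)) (closure (D j))) →
    ∀ U : Set X, IsOpen U → (U ∩ frontier W).Nonempty →
      ∃ i, ∃ Ω : Set X, IsOpen Ω ∧ closure Ω ⊆ U ∩ W ∧ BijOn f Ω (D i)

/-- `f : W → X` is an Ahlfors island map. -/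
structure IsAhlforsIslandMap (W : Set X) (f : X → X) : Prop where
  isOpen : IsOpen W
  nonempty : W.Nonempty
  holomorphic : MDifferentiableOn 𝓘(ℂ) 𝓘(ℂ) f W
  island : ∃ N, 1 ≤ N ∧ HasIslandProperty W f N

/-- `v` is a Picard exceptional value of `f : W → X`; the notion only concerns maps with
`∂W ≠ ∅`. -/
def IsPicardExceptional (W : Set X) (f : X → X) (v : X) : Prop :=
  (frontier W).Nonempty ∧ {z | z ∈ W ∧ f z = v}.Finite

/-- The derivative of `g` at `x` in the preferred chart at `x`. If `g x = x`, this is the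
multiplier of `g` at its fixed point `x`. -/
def multiplier (g : X → X) (x : X) : ℂ :=
  deriv (fun z => chartAt ℂ x (g ((chartAt ℂ x).symm z))) (chartAt ℂ x x)

/-- `x` is a repelling periodic point of `f : W → X` of (exact) period `p`. -/
structure IsRepellingPeriodicPt (W : Set X) (f : X → X) (p : ℕ) (x : X) : Prop where
  pos : 0 < p
  defined : IterDefined W f p x
  period : Function.minimalPeriod f x = p
  repelling : 1 < ‖multiplier f^[p] x‖

/-! ### Natural families -/

/-- A natural family `f_λ = φ_λ ∘ f ∘ ψ_λ⁻¹ : ψ_λ(W) → X` of holomorphic maps, parametrized by a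
complex manifold `M` modelled on `E`. -/
structure NaturalFamily (E M X : Type*) [NormedAddCommGroup E] [NormedSpace ℂ E]
    [TopologicalSpace M] [ChartedSpace E M] [TopologicalSpace X] [ChartedSpace ℂ X] where
  /-- The domain of the model map. -/
  W : Set X
  /-- The model map. -/
  f : X → X
  /-- The homeomorphisms acting on values. -/
  φ : M → X ≃ₜ X
  /-- The homeomorphisms acting on the domain. -/
  ψ : M → X ≃ₜ X
  isOpen_W : IsOpen W
  holomorphic_f : MDifferentiableOn 𝓘(ℂ) 𝓘(ℂ) f W
  quasiconformal_φ : ∀ lam, IsQuasiconformal (φ lam)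
  quasiconformal_ψ : ∀ lam, IsQuasiconformal (ψ lam)
  holomorphic_φ : ∀ z, MDifferentiable 𝓘(ℂ, E) 𝓘(ℂ) (fun lam => φ lam z)
  holomorphic_ψ : ∀ z, MDifferentiable 𝓘(ℂ, E) 𝓘(ℂ) (fun lam => ψ lam z)
  holomorphic_map : ∀ lam, MDifferentiableOn 𝓘(ℂ) 𝓘(ℂ)
    (fun z => φ lam (f ((ψ lam).symm z))) (ψ lam '' W)

namespace NaturalFamily

variable {E M : Type*} [NormedAddCommGroup E] [NormedSpace ℂ E]
  [TopologicalSpace M] [ChartedSpace E M]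

/-- The domain `W_λ = ψ_λ(W)`. -/
def dom (F : NaturalFamily E M X) (lam : M) : Set X := F.ψ lam '' F.W

/-- The map `f_λ = φ_λ ∘ f ∘ ψ_λ⁻¹`. -/
def map (F : NaturalFamily E M X) (lam : M) : X → X :=
  fun z => F.φ lam (F.f ((F.ψ lam).symm z))

/-- `f_λ^n(φ_λ(v))`, meaningful where this iterate is defined. For `v ∈ S(f)`, the function
`λ ↦ φ_λ(v)` is the marked singular value `v_λ` of `f_λ`. -/
def orbit (F : NaturalFamily E M X) (v : X) (n : ℕ) (lam : M) : X :=
  (F.map lam)^[n] (F.φ lam v)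

end NaturalFamily

/-- A family `g_i : V → X` of maps to a compact Hausdorff space is normal on `V`: each sequence in
it has a subsequence converging locally uniformly on `V`, with respect to the unique uniform
structure of `X`. -/
def IsNormalOn {M X ι : Type*} [TopologicalSpace M] [TopologicalSpace X] [CompactSpace X]
    [T2Space X] (g : ι → M → X) (V : Set M) : Prop :=
  letI : UniformSpace X := uniformSpaceOfCompactR1
  ∀ u : ℕ → ι, ∃ (s : ℕ → ℕ) (G : M → X), StrictMono s ∧
    TendstoLocallyUniformlyOn (fun k => g (u (s k))) G atTop V

namespace NaturalFamily

variable {E M : Type*} [NormedAddCommGroup E] [NormedSpace ℂ E]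
  [TopologicalSpace M] [ChartedSpace E M]

/-- The singular value `v_λ = φ_λ(v)` is passive at `lam0`: on a neighbourhood `V` of `lam0`,
either some fixed iterate leaves `W_λ` for all parameters, or all iterates are defined and form a
normal family. -/
def IsPassiveAt [CompactSpace X] [T2Space X] (F : NaturalFamily E M X) (v : X) (lam0 : M) :
    Prop :=
  ∃ V : Set M, IsOpen V ∧ lam0 ∈ V ∧
    ((∃ n, ∀ lam ∈ V, IterDefined (F.dom lam) (F.map lam) n (F.φ lam v) ∧
        F.orbit v n lam ∉ F.dom lam) ∨
      ((∀ n, ∀ lam ∈ V, IterDefined (F.dom lam) (F.map lam) n (F.φ lam v)) ∧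
        IsNormalOn (F.orbit v) V))

/-- The singular value `v_λ = φ_λ(v)` is active at `lam0`. -/
def IsActiveAt [CompactSpace X] [T2Space X] (F : NaturalFamily E M X) (v : X) (lam0 : M) : Prop :=
  ¬ F.IsPassiveAt v lam0

end NaturalFamily

end IslandMaps

end

/-! It suffices to find, in every ball about `lam0` in a chart of `M`, one parameter at which some
iterate of the marked singular value lands on the marked periodic point. Once it has landed there it
returns every `p` steps, so the iteration number can be made as large as desired. Activity leaves
two situations in a small ball.

Non-normal case: all iterates are defined on the ball. They cannot be normal on any smaller ball, so
Zalcman's rescaling (`exists_rescaling`) yields a nonconstant holomorphic `h : ℂ → X`, a limit of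
iterates of the marked point over shrinking parameter discs that converge to the centre. By Hurwitz,
`h` omits the complement of the domain, because the orbit never leaves it. If the periodic point is
never hit, `h` also omits the backward orbit of the repelling point. Together these omitted values
are infinite in number (`infinite_compl_union_backwardOrbit`), whereas a holomorphic map from the
plane to `X` which omits infinitely many values is constant (`eq_of_infinite_omitted`).

Crossing case: some iterate leaves the domain at some parameters but not at all of them. On a
suitable complex line of parameters the iterate then passes through a moving boundary point of the
domain (`LocalFamily.exists_isCrossing`). Islands accumulate at that boundary point. Each is mapped
bijectively onto a small disc, and the marked point sweeps over it as the parameter turns around the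
crossing. A Rouché argument (`IsCrossing.exists_hit`) gives a parameter at which the image of the
marked point is a preimage of the periodic point. This needs infinitely many isolated preimages as
targets. Only finitely many values fail to have them, and if the periodic point corresponds to such
a value, the map is constant on some open set. In that case one either aims at this open set or
passes through a second crossing at a nearby parameter (`IsCrossing.exists_iterate_eq`).

The Picard-type theorem is proved by Ahlfors' method, independently of the genus of `X`. Finitely
many omitted points near an accumulation point serve as logarithmic poles of a weight `v` with `Δv ≥
K + ε exp (2v)` in charts, where `K` is prescribed. The maximum principle applied to `exp v · |h'| ·
(R² - |z|²)`, with a cutoff for each chart, forces `h' = 0` as `R → ∞`. Since `v` need not be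
smooth, Laplacians are replaced by one-sided second-order expansions (`LowerJet`).

The same theorem gives the joint continuity of `φ` and `ψ`. A rescaling limit of the maps `λ ↦
φ_λ(z_k)` would omit all but at most one of the values `φ_a(w)`, since distinct points never
collide. Joint continuity and the conjugacy along `ψ_λ(w)` then show that `f_λ(g(λ))` is holomorphic
in `λ` whenever `g` is. -/

set_option linter.unusedSectionVars false

namespace IslandMaps

variable {X : Type*} [TopologicalSpace X] [ChartedSpace ℂ X]
variable {E : Type*} [NormedAddCommGroup E] [NormedSpace ℂ E]

/-! ### Holomorphic charts -/

/-- A holomorphic chart at `p`, normalized so that `p` is sent to `0` and the image contains the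
closed disc of radius `4`. -/
structure IsDiscChart (e : OpenPartialHomeomorph X ℂ) (p : X) : Prop where
  mdiff : e.MDifferentiable 𝓘(ℂ) 𝓘(ℂ)
  mem : p ∈ e.source
  map_eq : e p = 0
  subset : Metric.closedBall 0 4 ⊆ e.target

theorem exists_isDiscChart [IsManifold 𝓘(ℂ) 1 X] (p : X) :
    ∃ e : OpenPartialHomeomorph X ℂ, IsDiscChart e p := by
  set c := chartAt ℂ p
  have hc : c p ∈ c.target := c.map_source (mem_chart_source ℂ p)
  obtain ⟨r, hr, hball⟩ := Metric.isOpen_iff.1 c.open_target _ hc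
  -- With this scale the closed disc of radius `4` corresponds to one of radius `r / 2`, well inside
  -- the ball of radius `r`.
  set s : ℝ := r / 8
  have hs : 0 < s := by positivity
  have hs' : (s : ℂ) ≠ 0 := by exact_mod_cast hs.ne'
  let A : ℂ ≃ₜ ℂ := (Homeomorph.addRight (-(c p))).trans (Homeomorph.mulLeft₀ (s : ℂ)⁻¹ (inv_ne_zero hs'))
  have hA : ∀ z, A z = (s : ℂ)⁻¹ * (z - c p) := fun z => by
    simp [A, Homeomorph.trans_apply, sub_eq_add_neg]
  have hAs : ∀ z, A.symm z = s * z + c p := fun z => by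
    rw [Homeomorph.symm_apply_eq, hA]; field_simp; ring
  have hAm : A.toOpenPartialHomeomorph.MDifferentiable 𝓘(ℂ) 𝓘(ℂ) := by
    constructor
    · apply MDifferentiable.mdifferentiableOn
      rw [mdifferentiable_iff_differentiable]
      have : (A.toOpenPartialHomeomorph : ℂ → ℂ) = fun z => (s : ℂ)⁻¹ * (z - c p) := funext hA
      rw [this]; fun_prop
    · apply MDifferentiable.mdifferentiableOn
      rw [mdifferentiable_iff_differentiable]
      have : (A.toOpenPartialHomeomorph.symm : ℂ → ℂ) = fun z => s * z + c p := funext hAs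
      rw [this]; fun_prop
  refine ⟨c.trans A.toOpenPartialHomeomorph, ?_, ?_, ?_, ?_⟩
  · exact (mdifferentiable_chart p).trans hAm
  · simp [c]
  · simp [hA]
  · intro z hz
    have : A.symm z ∈ c.target := by
      apply hball
      rw [hAs, Metric.mem_ball, dist_eq_norm, add_sub_cancel_right, norm_mul]
      have : ‖z‖ ≤ 4 := by simpa using hz
      have h3 : ‖(s : ℂ)‖ = s := by simp [abs_of_pos hs]
      rw [h3]; simp only [s]; nlinarith
    simpa using this

/-- A choice of a normalized holomorphic chart at each point. -/
noncomputable def discChart [IsManifold 𝓘(ℂ) 1 X] (p : X) : OpenPartialHomeomorph X ℂ :=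
  (exists_isDiscChart p).choose

theorem isDiscChart_discChart [IsManifold 𝓘(ℂ) 1 X] (p : X) : IsDiscChart (discChart p) p :=
  (exists_isDiscChart p).choose_spec

theorem differentiableAt_chart_comp {e : OpenPartialHomeomorph X ℂ}
    (he : e.MDifferentiable 𝓘(ℂ) 𝓘(ℂ)) {g : E → X} {a : E}
    (hg : MDifferentiableAt 𝓘(ℂ, E) 𝓘(ℂ) g a) (ha : g a ∈ e.source) :
    DifferentiableAt ℂ (fun y => e (g y)) a := by
  rw [← mdifferentiableAt_iff_differentiableAt]
  exact (he.mdifferentiableAt ha).comp a hg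

theorem mdifferentiableAt_symm_comp {e : OpenPartialHomeomorph X ℂ}
    (he : e.MDifferentiable 𝓘(ℂ) 𝓘(ℂ)) {u : E → ℂ} {a : E}
    (hu : DifferentiableAt ℂ u a) (ha : u a ∈ e.target) :
    MDifferentiableAt 𝓘(ℂ, E) 𝓘(ℂ) (fun y => e.symm (u y)) a :=
  (he.mdifferentiableAt_symm ha).comp a hu.mdifferentiableAt

theorem mdifferentiableAt_of_chart_comp {e : OpenPartialHomeomorph X ℂ}
    (he : e.MDifferentiable 𝓘(ℂ) 𝓘(ℂ)) {g : E → X} {a : E} (hc : ContinuousAt g a)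
    (ha : g a ∈ e.source) (hg : DifferentiableAt ℂ (fun y => e (g y)) a) :
    MDifferentiableAt 𝓘(ℂ, E) 𝓘(ℂ) g a := by
  have h1 := mdifferentiableAt_symm_comp he hg (e.map_source ha)
  refine h1.congr_of_eventuallyEq ?_
  filter_upwards [hc.eventually (e.open_source.mem_nhds ha)] with y hy
  exact (e.left_inv hy).symm

theorem differentiableAt_transition {e e' : OpenPartialHomeomorph X ℂ}
    (he : e.MDifferentiable 𝓘(ℂ) 𝓘(ℂ)) (he' : e'.MDifferentiable 𝓘(ℂ) 𝓘(ℂ)) {z : ℂ}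
    (hz : z ∈ e.target) (hz' : e.symm z ∈ e'.source) :
    DifferentiableAt ℂ (fun y => e' (e.symm y)) z :=
  differentiableAt_chart_comp he' (he.mdifferentiableAt_symm hz) hz'

/-! ### A version of Rouché's theorem -/

/-- If `w` had no zero, the maximum principle for `(u - w) / w`, which is at most `1/3` on the
frontier, would contradict its value `-1` at a zero of `u`. No regularity of the frontier is needed,
which matters because `L` will be a preimage of an island. The second conclusion, that some zero is
isolated, is what makes a new crossing a genuine one. -/
theorem exists_zero_of_close {L : Set ℂ} (hL : IsOpen L) (hLb : Bornology.IsBounded L)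
    {u w : ℂ → ℂ} (hu : DiffContOnCl ℂ u L) (hw : DiffContOnCl ℂ w L) {δ : ℝ} (hδ : 0 < δ)
    (hfr : ∀ z ∈ frontier L, δ ≤ ‖u z‖) (hclose : ∀ z ∈ closure L, ‖u z - w z‖ ≤ δ / 4)
    (hz : ∃ z ∈ L, u z = 0) :
    ∃ z ∈ L, w z = 0 ∧ ¬ ∀ᶠ y in 𝓝 z, w y = 0 := by
  have hfrw : ∀ z ∈ frontier L, 3 * δ / 4 ≤ ‖w z‖ := fun z hz => by
    have h1 := hfr z hz
    have h2 := hclose z (frontier_subset_closure hz)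
    have h3 := norm_sub_norm_le (u z) (w z)
    linarith
  by_cases hw0 : ∃ z ∈ L, w z = 0
  · by_contra! hcon
    -- If `w` vanished identically near each of its zeros, the zero set would be open. It also has
    -- empty frontier, as `w` is bounded away from zero on `frontier L`. A nonempty bounded subset
    -- of the plane cannot be clopen.
    set Z := {z ∈ L | w z = 0} with hZ
    have hZo : IsOpen Z := by
      rw [isOpen_iff_mem_nhds]
      rintro z ⟨hzL, hz0⟩
      filter_upwards [hL.mem_nhds hzL, hcon z hzL hz0] with y h1 h2 using ⟨h1, h2⟩
    have hZL : Z ⊆ L := fun z hz => hz.1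
    have hZfr : frontier Z = ∅ := by
      rw [eq_empty_iff_forall_notMem]
      intro z hz
      have hzcl : z ∈ closure Z := frontier_subset_closure hz
      have hzL : z ∈ closure L := closure_mono hZL hzcl
      have hwz : w z = 0 := by
        have : MapsTo w Z {0} := fun y hy => hy.2
        have h2 := this.closure_of_continuousOn (hw.continuousOn.mono (closure_mono hZL)) hzcl
        simpa using h2
      have hznL : z ∉ L := fun h => by
        have : z ∈ Z := ⟨h, hwz⟩
        rw [hZo.frontier_eq] at hz
        exact hz.2 this
      have := hfrw z (by rw [hL.frontier_eq]; exact ⟨hzL, hznL⟩)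
      rw [hwz, norm_zero] at this
      linarith
    obtain ⟨z, hzL, hz0⟩ := hw0
    rcases isClopen_iff.1 (isClopen_iff_frontier_eq_empty.2 hZfr) with h | h
    · exact absurd (show z ∈ Z from ⟨hzL, hz0⟩) (by rw [h]; exact notMem_empty z)
    · exact NormedSpace.unbounded_univ ℂ ℂ (h ▸ hLb.subset hZL)
  · exfalso
    push Not at hw0
    have hwne : ∀ z ∈ closure L, w z ≠ 0 := fun z hz h0 => by
      by_cases h : z ∈ L
      · exact hw0 z h h0
      · have := hfrw z (by rw [hL.frontier_eq]; exact ⟨hz, h⟩)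
        rw [h0, norm_zero] at this
        linarith
    have hq : DiffContOnCl ℂ (fun z => (w z)⁻¹ • (u z - w z)) L :=
      (hw.inv hwne).smul (hu.sub hw)
    obtain ⟨z, hzL, hz0⟩ := hz
    have key := Complex.norm_le_of_forall_mem_frontier_norm_le hLb hq (C := 1 / 3) (fun y hy => by
      have h1 := hfrw y hy
      have h2 := hclose y (frontier_subset_closure hy)
      rw [norm_smul, norm_inv, inv_mul_le_iff₀ (by linarith)]
      linarith) (subset_closure hzL)
    rw [hz0, zero_sub, norm_smul, norm_neg, norm_inv,
      inv_mul_cancel₀ (norm_ne_zero_iff.2 (hw0 z hzL))] at key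
    norm_num at key

/-! ### Continuous convergence -/

/-- Continuous convergence at `a` of the functions `H i` to `H₀`, along `l`. -/
def ContConvAt {ι A Y : Type*} [TopologicalSpace A] [TopologicalSpace Y] (H : ι → A → Y)
    (H₀ : A → Y) (l : Filter ι) (a : A) : Prop :=
  Tendsto (fun q : ι × A => H q.1 q.2) (l ×ˢ 𝓝 a) (𝓝 (H₀ a))

section ContConv

variable {ι A Y Y' : Type*} [TopologicalSpace A] [TopologicalSpace Y] [TopologicalSpace Y']
  {H : ι → A → Y} {H₀ : A → Y} {l : Filter ι} {a : A}

theorem ContConvAt.tendsto (h : ContConvAt H H₀ l a) : Tendsto (fun i => H i a) l (𝓝 (H₀ a)) := by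
  have : Tendsto (fun i : ι => (i, a)) l (l ×ˢ 𝓝 a) :=
    tendsto_id.prodMk (tendsto_const_nhds.mono_right le_rfl)
  exact Tendsto.comp h this

theorem ContConvAt.comp_left {f : Y → Y'} (hf : ContinuousAt f (H₀ a)) (h : ContConvAt H H₀ l a) :
    ContConvAt (fun i x => f (H i x)) (fun x => f (H₀ x)) l a :=
  Tendsto.comp hf h

/-- Continuous convergence at nearby points makes the limit continuous with no assumption on the
approximating maps: values near `a` stay in a closed neighbourhood of `H₀ a`, and so do their
limits. -/
theorem continuousAt_of_contConvAt [RegularSpace Y] [l.NeBot]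
    (h : ∀ᶠ x in 𝓝 a, ContConvAt H H₀ l x) : ContinuousAt H₀ a := by
  rw [ContinuousAt, (closed_nhds_basis (H₀ a)).tendsto_right_iff]
  rintro N ⟨hN, hNc⟩
  have h1 : ∀ᶠ q : ι × A in l ×ˢ 𝓝 a, H q.1 q.2 ∈ N := h.self_of_nhds.eventually hN
  obtain ⟨pa, hpa, pb, hpb, hab⟩ := eventually_prod_iff.1 h1
  filter_upwards [hpb, h] with x hx hxc
  exact hNc.mem_of_tendsto hxc.tendsto (hpa.mono fun i hi => hab hi hx)

theorem eventually_forall_of_isCompact {K : Set A} (hK : IsCompact K)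
    {P : ι → A → Prop} (h : ∀ a ∈ K, ∀ᶠ q : ι × A in l ×ˢ 𝓝 a, P q.1 q.2) :
    ∀ᶠ i in l, ∀ x ∈ K, P i x := by
  refine hK.induction_on (p := fun s => ∀ᶠ i in l, ∀ x ∈ s, P i x) ?_ ?_ ?_ ?_
  · simp
  · exact fun s t hst ht => ht.mono fun i hi x hx => hi x (hst hx)
  · intro s t hs ht
    filter_upwards [hs, ht] with i h1 h2 x hx
    exact hx.elim (h1 x) (h2 x)
  · intro x hx
    obtain ⟨pa, hpa, pb, hpb, hab⟩ := eventually_prod_iff.1 (h x hx)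
    exact ⟨{y | pb y}, mem_nhdsWithin_of_mem_nhds hpb, hpa.mono fun i hi y hy => hab hi hy⟩

theorem tendstoUniformlyOn_of_contConvAt {Y : Type*} [PseudoMetricSpace Y] {H : ι → A → Y}
    {H₀ : A → Y} [l.NeBot] {K O : Set A} (hK : IsCompact K) (hO : IsOpen O) (hKO : K ⊆ O)
    (h : ∀ x ∈ O, ContConvAt H H₀ l x) : TendstoUniformlyOn H H₀ l K := by
  rw [Metric.tendstoUniformlyOn_iff]
  intro ε hε
  refine eventually_forall_of_isCompact (P := fun i x => dist (H₀ x) (H i x) < ε) hK fun x hx => ?_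
  have h1 : ContinuousAt H₀ x :=
    continuousAt_of_contConvAt (l := l) (by filter_upwards [hO.mem_nhds (hKO hx)] with y hy using h y hy)
  have h2 : Tendsto (fun q : ι × A => dist (H₀ q.2) (H q.1 q.2)) (l ×ˢ 𝓝 x) (𝓝 (dist (H₀ x) (H₀ x))) :=
    (h1.tendsto.comp tendsto_snd).dist (h x (hKO hx))
  rw [dist_self] at h2
  exact h2.eventually (gt_mem_nhds hε)

end ContConv

theorem differentiableOn_of_contConvAt {ι : Type*} {l : Filter ι} [l.NeBot] {c : ι → ℂ → ℂ}
    {c₀ : ℂ → ℂ} {O : Set ℂ} (hO : IsOpen O) (h : ∀ x ∈ O, ContConvAt c c₀ l x)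
    (hd : ∀ x ∈ O, ∀ᶠ q : ι × ℂ in l ×ˢ 𝓝 x, DifferentiableAt ℂ (c q.1) q.2) :
    DifferentiableOn ℂ c₀ O := by
  intro z hz
  obtain ⟨r, hr, hrO⟩ := Metric.nhds_basis_closedBall.mem_iff.1 (hO.mem_nhds hz)
  have hU := tendstoUniformlyOn_of_contConvAt (isCompact_closedBall z r) hO hrO h
  have hD := eventually_forall_of_isCompact (P := fun i x => DifferentiableAt ℂ (c i) x)
    (isCompact_closedBall z r) fun x hx => hd x (hrO hx)
  have := (hU.mono Metric.ball_subset_closedBall).tendstoLocallyUniformlyOn.differentiableOn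
    (hD.mono fun i hi x hx => (hi x (Metric.ball_subset_closedBall hx)).differentiableWithinAt)
    Metric.isOpen_ball
  exact (this.differentiableAt (Metric.ball_mem_nhds z hr)).differentiableWithinAt

/-- Hurwitz's theorem for scalar functions. -/
theorem eventually_eq_zero_of_contConvAt {ι : Type*} {l : Filter ι} [l.NeBot] {c : ι → ℂ → ℂ}
    {c₀ : ℂ → ℂ} {z : ℂ} (h : ∀ᶠ x in 𝓝 z, ContConvAt c c₀ l x)
    (hd : ∀ᶠ q : ι × ℂ in l ×ˢ 𝓝 z, DifferentiableAt ℂ (c q.1) q.2)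
    (hne : ∀ᶠ q : ι × ℂ in l ×ˢ 𝓝 z, c q.1 q.2 ≠ 0) (h0 : c₀ z = 0) :
    ∀ᶠ x in 𝓝 z, c₀ x = 0 := by
  obtain ⟨pa, hpa, pb, hpb, hab⟩ := eventually_prod_iff.1 (hd.and hne)
  obtain ⟨R, hR, hball⟩ := Metric.eventually_nhds_iff_ball.1 (h.and hpb)
  have hdiff : DifferentiableOn ℂ c₀ (Metric.ball z R) := by
    refine differentiableOn_of_contConvAt (l := l) (c := c) Metric.isOpen_ball (fun x hx => (hball x hx).1) fun x hx => ?_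
    exact eventually_prod_iff.2 ⟨pa, hpa, _, Metric.isOpen_ball.mem_nhds hx,
      fun hi y hy => (hab hi (hball y hy).2).1⟩
  have hana : AnalyticAt ℂ c₀ z := hdiff.analyticAt (Metric.ball_mem_nhds z hR)
  refine hana.eventually_eq_zero_or_eventually_ne_zero.resolve_right fun hiso => ?_
  obtain ⟨r, hr, hrball⟩ := Metric.eventually_nhds_iff_ball.1 (eventually_nhdsWithin_iff.1 hiso)
  set s := min r R / 2
  have hs : 0 < s := by positivity
  have hsr : s < r := by have := min_le_left r R; simp only [s]; linarith
  have hsR : s < R := by have := min_le_right r R; simp only [s]; linarith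
  have hsub : Metric.closedBall z s ⊆ Metric.ball z R := Metric.closedBall_subset_ball hsR
  obtain ⟨δ, hδ, hδs⟩ : ∃ δ > 0, ∀ x ∈ Metric.sphere z s, δ ≤ ‖c₀ x‖ := by
    have hcont : ContinuousOn (fun x => ‖c₀ x‖) (Metric.sphere z s) :=
      (hdiff.continuousOn.mono (Metric.sphere_subset_closedBall.trans hsub)).norm
    obtain ⟨x, hx, hmin⟩ := (isCompact_sphere z s).exists_isMinOn
      (NormedSpace.sphere_nonempty.2 hs.le) hcont
    refine ⟨‖c₀ x‖, norm_pos_iff.2 (hrball x ?_ ?_), fun y hy => hmin hy⟩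
    · exact Metric.sphere_subset_ball hsr hx
    · rintro rfl
      simp at hx
      exact hs.ne hx
  have hU := tendstoUniformlyOn_of_contConvAt (l := l) (isCompact_closedBall z s) Metric.isOpen_ball hsub
    fun x hx => (hball x hx).1
  obtain ⟨i, hi1, hi2⟩ := ((Metric.tendstoUniformlyOn_iff.1 hU (δ / 4) (by positivity)).and hpa).exists
  have hcl : closure (Metric.ball z s) = Metric.closedBall z s := closure_ball z hs.ne'
  obtain ⟨y, hy, hy0, -⟩ := exists_zero_of_close (u := c₀) (w := c i) Metric.isOpen_ball Metric.isBounded_ball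
    (by
      refine DifferentiableOn.diffContOnCl ?_
      rw [hcl]; exact hdiff.mono hsub)
    (by
      refine DifferentiableOn.diffContOnCl ?_
      rw [hcl]; exact fun y hy => (hab hi2 (hball y (hsub hy)).2).1.differentiableWithinAt) hδ
    (by rw [frontier_ball z hs.ne']; exact hδs)
    (by
      rw [hcl]; intro y hy
      rw [← dist_eq_norm]; exact (hi1 y hy).le) ⟨z, Metric.mem_ball_self hs, h0⟩
  exact (hab hi2 (hball y (hsub (Metric.ball_subset_closedBall hy))).2).2 hy0

/-- Hurwitz's theorem for maps to a Riemann surface. -/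
theorem eventuallyEq_of_contConvAt [IsManifold 𝓘(ℂ) 1 X] {ι : Type*} {l : Filter ι} [l.NeBot]
    {a b : ι → ℂ → X} {a₀ b₀ : ℂ → X} {z : ℂ} [RegularSpace X]
    (ha : ∀ᶠ x in 𝓝 z, ContConvAt a a₀ l x) (hb : ∀ᶠ x in 𝓝 z, ContConvAt b b₀ l x)
    (hda : ∀ᶠ q : ι × ℂ in l ×ˢ 𝓝 z, MDifferentiableAt 𝓘(ℂ) 𝓘(ℂ) (a q.1) q.2)
    (hdb : ∀ᶠ q : ι × ℂ in l ×ˢ 𝓝 z, MDifferentiableAt 𝓘(ℂ) 𝓘(ℂ) (b q.1) q.2)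
    (hne : ∀ᶠ q : ι × ℂ in l ×ˢ 𝓝 z, a q.1 q.2 ≠ b q.1 q.2) (h0 : a₀ z = b₀ z) :
    ∀ᶠ x in 𝓝 z, a₀ x = b₀ x := by
  set e := discChart (a₀ z)
  have he := isDiscChart_discChart (a₀ z)
  have hca : ContinuousAt a₀ z := continuousAt_of_contConvAt (l := l) ha
  have hcb : ContinuousAt b₀ z := continuousAt_of_contConvAt (l := l) hb
  have hsa : e.source ∈ 𝓝 (a₀ z) := e.open_source.mem_nhds he.mem
  have hsb : e.source ∈ 𝓝 (b₀ z) := h0 ▸ hsa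
  have hea : ∀ᶠ x in 𝓝 z, a₀ x ∈ e.source := hca.eventually hsa
  have heb : ∀ᶠ x in 𝓝 z, b₀ x ∈ e.source := hcb.eventually hsb
  have hqa := ha.self_of_nhds.eventually hsa
  have hqb := hb.self_of_nhds.eventually hsb
  have key := eventually_eq_zero_of_contConvAt (l := l) (c := fun i x => e (a i x) - e (b i x))
    (c₀ := fun x => e (a₀ x) - e (b₀ x)) (z := z) ?_ ?_ ?_ (by simp [h0])
  · filter_upwards [key, hea, heb] with x h1 h2 h3
    exact e.injOn h2 h3 (sub_eq_zero.1 h1)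
  · filter_upwards [ha, hb, hea, heb] with x h1 h2 h3 h4
    have h5 := h1.comp_left (e.continuousAt h3)
    have h6 := h2.comp_left (e.continuousAt h4)
    exact Tendsto.sub h5 h6
  · filter_upwards [hda, hdb, hqa, hqb] with q h1 h2 h3 h4
    exact (differentiableAt_chart_comp he.mdiff h1 h3).sub (differentiableAt_chart_comp he.mdiff h2 h4)
  · filter_upwards [hne, hqa, hqb] with q h1 h2 h3
    exact sub_ne_zero.2 fun h => h1 (e.injOn h2 h3 h)

/-! ### Identity theorem -/

theorem eventually_eq_or_eventually_ne_of_mdifferentiable [IsManifold 𝓘(ℂ) 1 X] {a b : ℂ → X} {z : ℂ}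
    [T2Space X]
    (ha : ∀ᶠ x in 𝓝 z, MDifferentiableAt 𝓘(ℂ) 𝓘(ℂ) a x)
    (hb : ∀ᶠ x in 𝓝 z, MDifferentiableAt 𝓘(ℂ) 𝓘(ℂ) b x) :
    (∀ᶠ x in 𝓝 z, a x = b x) ∨ ∀ᶠ x in 𝓝[≠] z, a x ≠ b x := by
  by_cases h0 : a z = b z
  · set e := discChart (a z)
    have he := isDiscChart_discChart (a z)
    have hsa : e.source ∈ 𝓝 (a z) := e.open_source.mem_nhds he.mem
    have hea := ha.self_of_nhds.continuousAt.eventually hsa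
    have heb := hb.self_of_nhds.continuousAt.eventually (h0 ▸ hsa)
    have hd : ∀ᶠ x in 𝓝 z, DifferentiableAt ℂ (fun y => e (a y)) x := by
      filter_upwards [ha, hea] with x h1 h2 using differentiableAt_chart_comp he.mdiff h1 h2
    have hd' : ∀ᶠ x in 𝓝 z, DifferentiableAt ℂ (fun y => e (b y)) x := by
      filter_upwards [hb, heb] with x h1 h2 using differentiableAt_chart_comp he.mdiff h1 h2
    rcases (Complex.analyticAt_iff_eventually_differentiableAt.2 hd).eventually_eq_or_eventually_ne
      (Complex.analyticAt_iff_eventually_differentiableAt.2 hd') with h | h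
    · left
      filter_upwards [h, hea, heb] with x h1 h2 h3 using e.injOn h2 h3 h1
    · right
      filter_upwards [h] with x h1 h2 using h1 (by rw [h2])
  · right
    have h1 : Tendsto (fun x => (a x, b x)) (𝓝 z) (𝓝 (a z, b z)) :=
      ha.self_of_nhds.continuousAt.prodMk_nhds hb.self_of_nhds.continuousAt
    have h2 := h1.eventually ((isOpen_ne_fun continuous_fst continuous_snd).mem_nhds h0)
    exact h2.filter_mono nhdsWithin_le_nhds

theorem eqOn_of_mdifferentiable [IsManifold 𝓘(ℂ) 1 X] [T2Space X] {a b : ℂ → X} {O : Set ℂ}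
    (hO : IsOpen O) (hOc : IsPreconnected O)
    (ha : ∀ x ∈ O, MDifferentiableAt 𝓘(ℂ) 𝓘(ℂ) a x)
    (hb : ∀ x ∈ O, MDifferentiableAt 𝓘(ℂ) 𝓘(ℂ) b x) {z : ℂ} (hz : z ∈ O)
    (h : ∀ᶠ x in 𝓝 z, a x = b x) : ∀ x ∈ O, a x = b x := by
  have hsub : O ⊆ {x | ∀ᶠ y in 𝓝 x, a y = b y} := by
    refine hOc.subset_of_closure_inter_subset isOpen_setOfPred_eventually_nhds ⟨z, hz, h⟩ ?_
    rintro x ⟨hxc, hxO⟩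
    refine (eventually_eq_or_eventually_ne_of_mdifferentiable (z := x) ?_ ?_).resolve_right fun hne => ?_
    · filter_upwards [hO.mem_nhds hxO] with y hy using ha y hy
    · filter_upwards [hO.mem_nhds hxO] with y hy using hb y hy
    · rw [eventually_nhdsWithin_iff] at hne
      -- The point `y` of agreement may be `x` itself, where punctured information says nothing. In
      -- that case, since points of `ℂ` are not isolated, agreement near `y` already contradicts
      -- disagreement on a punctured neighbourhood.
      obtain ⟨y, hy1, hy2⟩ := (mem_closure_iff_frequently.1 hxc).and_eventually hne |>.exists
      rcases eq_or_ne y x with rfl | hyx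
      · obtain ⟨w, hw1, hw2⟩ := ((hy1.filter_mono (nhdsWithin_le_nhds (s := {y}ᶜ))).and
          (eventually_nhdsWithin_iff.2 hne)).exists
        exact hw2 hw1
      · exact hy2 hyx hy1.self_of_nhds
  exact fun x hx => (hsub hx).self_of_nhds

end IslandMaps

namespace IslandMaps

/-! ### Lower second-order jets -/

/-- `u` has at `z` a lower second-order jet whose Laplacian is `τ`, a weak form of `τ ≤ Δ u z`. -/
def LowerJet (u : ℂ → ℝ) (z : ℂ) (τ : ℝ) : Prop :=
  ∃ a b : ℂ, ∀ ε > 0, ∀ᶠ y in 𝓝 z,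
    u z + (a * (y - z) + b * (y - z) ^ 2).re + (τ / 4 - ε) * ‖y - z‖ ^ 2 ≤ u y

namespace LowerJet

variable {u w : ℂ → ℝ} {z : ℂ} {τ σ : ℝ}

theorem mono (h : LowerJet u z τ) (hσ : σ ≤ τ) : LowerJet u z σ := by
  obtain ⟨a, b, h⟩ := h
  refine ⟨a, b, fun ε hε => (h ε hε).mono fun y hy => le_trans ?_ hy⟩
  gcongr

theorem of_le (h : LowerJet w z τ) (hz : w z = u z) (hle : ∀ᶠ y in 𝓝 z, w y ≤ u y) :
    LowerJet u z τ := by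
  obtain ⟨a, b, h⟩ := h
  refine ⟨a, b, fun ε hε => ?_⟩
  filter_upwards [h ε hε, hle] with y h1 h2
  rw [← hz]; exact h1.trans h2

theorem congr (h : LowerJet w z τ) (he : w =ᶠ[𝓝 z] u) : LowerJet u z τ :=
  h.of_le he.self_of_nhds (he.mono fun _ hy => hy.le)

theorem of_nonneg (hz : u z = 0) (h : ∀ y, 0 ≤ u y) : LowerJet u z 0 := by
  refine ⟨0, 0, fun ε hε => Eventually.of_forall fun y => ?_⟩
  have := h y
  have h2 : 0 ≤ ε * ‖y - z‖ ^ 2 := by positivity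
  simp [hz]; linarith

theorem add (h : LowerJet u z τ) (h' : LowerJet w z σ) :
    LowerJet (fun y => u y + w y) z (τ + σ) := by
  obtain ⟨a, b, h⟩ := h
  obtain ⟨a', b', h'⟩ := h'
  refine ⟨a + a', b + b', fun ε hε => ?_⟩
  filter_upwards [h (ε / 2) (by positivity), h' (ε / 2) (by positivity)] with y h1 h2
  have : ((a + a') * (y - z) + (b + b') * (y - z) ^ 2).re
      = (a * (y - z) + b * (y - z) ^ 2).re + (a' * (y - z) + b' * (y - z) ^ 2).re := by
    rw [← Complex.add_re]; congr 1; ring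
  rw [this]; nlinarith

theorem const_mul (h : LowerJet u z τ) {c : ℝ} (hc : 0 < c) :
    LowerJet (fun y => c * u y) z (c * τ) := by
  obtain ⟨a, b, h⟩ := h
  refine ⟨c * a, c * b, fun ε hε => ?_⟩
  filter_upwards [h (ε / c) (by positivity)] with y h1
  have : (c * a * (y - z) + c * b * (y - z) ^ 2).re = c * (a * (y - z) + b * (y - z) ^ 2).re := by
    rw [← Complex.re_ofReal_mul]; congr 1; ring
  rw [this]
  calc _ = c * (u z + (a * (y - z) + b * (y - z) ^ 2).re + (τ / 4 - ε / c) * ‖y - z‖ ^ 2) := by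
        field_simp
    _ ≤ _ := by gcongr

theorem sum {ι : Type*} {s : Finset ι} {f : ι → ℂ → ℝ} {t : ι → ℝ}
    (h : ∀ i ∈ s, LowerJet (f i) z (t i)) :
    LowerJet (fun y => ∑ i ∈ s, f i y) z (∑ i ∈ s, t i) := by
  classical
  induction s using Finset.induction_on with
  | empty => simpa using of_nonneg (u := fun _ => 0) (z := z) rfl fun _ => le_rfl
  | insert i s hi ih =>
    simp only [Finset.sum_insert hi]
    exact (h i (Finset.mem_insert_self i s)).add (ih fun j hj => h j (Finset.mem_insert_of_mem hj))

end LowerJet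

theorem exists_quadratic_expansion {T : ℂ → ℂ} {z : ℂ} (hT : AnalyticAt ℂ T z) :
    ∃ D : ℂ → ℂ, ContinuousAt D z ∧
      ∀ y, T y = T z + deriv T z * (y - z) + D y * (y - z) ^ 2 := by
  have h1 : AnalyticAt ℂ (dslope T z) z := by
    obtain ⟨p, hp⟩ := hT
    exact hp.has_fpower_series_dslope_fslope.analyticAt
  refine ⟨dslope (dslope T z) z, continuousAt_dslope_same.2 h1.differentiableAt, fun y => ?_⟩
  have h2 := sub_smul_dslope T z y
  have h3 := sub_smul_dslope (dslope T z) z y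
  rw [dslope_same] at h3
  simp only [smul_eq_mul] at h2 h3
  linear_combination -h2 - (y - z) * h3

/-- The holomorphic part of the expansion stays holomorphic after substituting `T`, and `‖T y - T z‖
^ 2` contributes the factor `‖deriv T z‖ ^ 2`. Errors in the second-order coefficients are
continuous and vanish at `z`, so they fit into `ε`. -/
theorem LowerJet.comp {u : ℂ → ℝ} {T : ℂ → ℂ} {z : ℂ} {τ : ℝ} (h : LowerJet u (T z) τ)
    (hT : AnalyticAt ℂ T z) : LowerJet (fun y => u (T y)) z (τ * ‖deriv T z‖ ^ 2) := by
  obtain ⟨D, hD, hexp⟩ := exists_quadratic_expansion hT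
  obtain ⟨a, b, h⟩ := h
  set d := deriv T z
  refine ⟨a * d, a * D z + b * d ^ 2, fun ε hε => ?_⟩
  set ε' := ε / (2 * (‖d‖ ^ 2 + 1))
  have hε' : 0 < ε' := by positivity
  set m : ℂ → ℂ := fun y => d + D y * (y - z)
  have hm : ContinuousAt m z := by fun_prop
  have hmz : m z = d := by simp [m]
  have hlim : ContinuousAt (fun y => -(‖a‖ * ‖D y - D z‖) - ‖b‖ * ‖m y ^ 2 - d ^ 2‖
      + (τ / 4 - ε') * ‖m y‖ ^ 2) z := by fun_prop
  have hval : τ * ‖d‖ ^ 2 / 4 - ε < -(‖a‖ * ‖D z - D z‖) - ‖b‖ * ‖m z ^ 2 - d ^ 2‖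
      + (τ / 4 - ε') * ‖m z‖ ^ 2 := by
    rw [hmz]; simp only [sub_self, norm_zero, mul_zero, neg_zero, zero_add]
    have : ε' * ‖d‖ ^ 2 < ε := by
      simp only [ε']
      rw [div_mul_eq_mul_div, div_lt_iff₀ (by positivity)]
      nlinarith [sq_nonneg ‖d‖]
    linarith
  filter_upwards [hT.continuousAt.eventually (h ε' hε'), hlim.eventually (lt_mem_nhds hval)] with y h1 h2
  refine le_trans ?_ h1
  have hΔ : T y - T z = m y * (y - z) := by rw [hexp y]; simp only [m]; ring
  rw [hΔ]
  have e1 : a * (m y * (y - z)) + b * (m y * (y - z)) ^ 2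
      = (a * d * (y - z) + (a * D z + b * d ^ 2) * (y - z) ^ 2)
        + (a * (D y - D z) + b * (m y ^ 2 - d ^ 2)) * (y - z) ^ 2 := by
    simp only [m]; ring
  rw [e1, Complex.add_re (_ + _) (_ * (y - z) ^ 2), norm_mul, mul_pow ‖m y‖]
  have e2 : -((‖a‖ * ‖D y - D z‖ + ‖b‖ * ‖m y ^ 2 - d ^ 2‖) * ‖y - z‖ ^ 2)
      ≤ ((a * (D y - D z) + b * (m y ^ 2 - d ^ 2)) * (y - z) ^ 2).re := by
    have h3 := (abs_le.1 (Complex.abs_re_le_norm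
      ((a * (D y - D z) + b * (m y ^ 2 - d ^ 2)) * (y - z) ^ 2))).1
    refine le_trans (neg_le_neg ?_) h3
    rw [norm_mul, norm_pow, ← norm_mul, ← norm_mul]
    gcongr
    exact norm_add_le _ _
  nlinarith [mul_le_mul_of_nonneg_right h2.le (sq_nonneg ‖y - z‖)]

/-- The weak maximum principle: averaging the expansion over four points of a small circle removes
its harmonic part. -/
theorem LowerJet.nonpos_of_isLocalMax {u : ℂ → ℝ} {z : ℂ} {τ : ℝ} (h : LowerJet u z τ)
    (hm : IsLocalMax u z) : τ ≤ 0 := by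
  obtain ⟨a, b, h⟩ := h
  suffices ∀ ε > 0, τ / 4 ≤ ε by
    have := le_of_forall_pos_le_add (a := τ / 4) (b := 0) (by simpa using this)
    linarith
  intro ε hε
  obtain ⟨r, hr, hball⟩ := Metric.eventually_nhds_iff_ball.1 ((h ε hε).and hm)
  set t : ℝ := r / 2
  have ht : 0 < t := by positivity
  -- Adding the inequalities for `s = 1, -1, I, -I` cancels both the linear and the quadratic
  -- holomorphic terms.
  have key : ∀ s : ℂ, ‖s‖ = 1 → (a * (t * s) + b * (t * s) ^ 2).re + (τ / 4 - ε) * t ^ 2 ≤ 0 := by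
    intro s hs
    have hn : ‖(t * s : ℂ)‖ = t := by simp [hs, abs_of_pos ht]
    obtain ⟨h1, h2⟩ := hball (z + t * s) (by
      rw [Metric.mem_ball, dist_eq_norm, add_sub_cancel_left, hn]; simp only [t]; linarith)
    rw [add_sub_cancel_left, hn] at h1
    have h3 : u (z + t * s) ≤ u z := h2
    linarith
  have k1 := key 1 (by simp)
  have k2 := key (-1) (by simp)
  have k3 := key Complex.I (by simp)
  have k4 := key (-Complex.I) (by simp)
  simp [pow_two] at k1 k2 k3 k4
  nlinarith [pow_pos ht 2]

theorem lowerJet_re {g : ℂ → ℂ} {z : ℂ} (hg : AnalyticAt ℂ g z) :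
    LowerJet (fun y => (g y).re) z 0 := by
  obtain ⟨D, hD, hexp⟩ := exists_quadratic_expansion hg
  refine ⟨deriv g z, D z, fun ε hε => ?_⟩
  have h1 : ContinuousAt (fun y => ‖D y - D z‖) z := by fun_prop
  filter_upwards [h1.eventually (gt_mem_nhds (show ‖D z - D z‖ < ε by simpa using hε))] with y hy
  have h2 : g y = g z + (deriv g z * (y - z) + D z * (y - z) ^ 2) + (D y - D z) * (y - z) ^ 2 := by
    rw [hexp y]; ring
  rw [h2]
  have h3 := (abs_le.1 (Complex.abs_re_le_norm ((D y - D z) * (y - z) ^ 2))).1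
  rw [norm_mul, norm_pow] at h3
  simp only [Complex.add_re] at h3 ⊢
  nlinarith [mul_le_mul_of_nonneg_right hy.le (sq_nonneg ‖y - z‖)]

theorem lowerJet_log_norm {g : ℂ → ℂ} {z : ℂ} (hg : AnalyticAt ℂ g z) (h0 : g z ≠ 0) :
    LowerJet (fun y => Real.log ‖g y‖) z 0 := by
  have h1 : AnalyticAt ℂ (fun y => Complex.log (g y / g z) + (Real.log ‖g z‖ : ℂ)) z := by
    refine AnalyticAt.add (AnalyticAt.clog (hg.div analyticAt_const h0) ?_) analyticAt_const
    simp [div_self h0]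
  refine (lowerJet_re h1).congr ?_
  filter_upwards [hg.continuousAt.eventually_ne h0] with y hy
  rw [Complex.add_re, Complex.log_re, Complex.ofReal_re, norm_div,
    Real.log_div (norm_ne_zero_iff.2 hy) (norm_ne_zero_iff.2 h0)]
  ring

theorem eventually_le_taylor_two {f f' : ℝ → ℝ} {s f₂ : ℝ}
    (hf : ∀ᶠ x in 𝓝 s, HasDerivAt f (f' x) x) (hf' : HasDerivAt f' f₂ s) {ε : ℝ} (hε : 0 < ε) :
    ∀ᶠ x in 𝓝 s, f s + f' s * (x - s) + (f₂ / 2) * (x - s) ^ 2 - ε * (x - s) ^ 2 ≤ f x := by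
  have h1 := hf'.isLittleO.def hε
  obtain ⟨r, hr, hball⟩ := Metric.eventually_nhds_iff_ball.1 (hf.and h1)
  filter_upwards [Metric.ball_mem_nhds s hr] with x hx
  set g : ℝ → ℝ := fun y => f y - f' s * (y - s) - (f₂ / 2) * (y - s) ^ 2
  have hg : ∀ y ∈ Metric.closedBall s |x - s|,
      HasDerivWithinAt g (f' y - f' s - f₂ * (y - s)) (Metric.closedBall s |x - s|) y := by
    intro y hy
    have hy' : y ∈ Metric.ball s r := by
      rw [Metric.mem_ball, Real.dist_eq] at hx
      exact Metric.closedBall_subset_ball hx hy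
    have h2 := (hball y hy').1
    have h3 : HasDerivAt (fun y => f' s * (y - s)) (f' s) y := by
      simpa using ((hasDerivAt_id y).sub_const s).const_mul (f' s)
    have h4 : HasDerivAt (fun y => (f₂ / 2) * (y - s) ^ 2) (f₂ * (y - s)) y := by
      refine ((((hasDerivAt_id' y).sub_const s).fun_pow 2).const_mul (f₂ / 2)).congr_deriv ?_
      simp; ring
    exact ((h2.sub h3).sub h4).hasDerivWithinAt
  have hb : ∀ y ∈ Metric.closedBall s |x - s|, ‖f' y - f' s - f₂ * (y - s)‖ ≤ ε * |x - s| := by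
    intro y hy
    have hy' : y ∈ Metric.ball s r := by
      rw [Metric.mem_ball, Real.dist_eq] at hx
      exact Metric.closedBall_subset_ball hx hy
    have h2 := (hball y hy').2
    rw [Metric.mem_closedBall, Real.dist_eq] at hy
    simp only [smul_eq_mul, Real.norm_eq_abs] at h2 ⊢
    rw [mul_comm f₂]
    exact h2.trans (by gcongr)
  have := (convex_closedBall s |x - s|).norm_image_sub_le_of_norm_hasDerivWithin_le hg hb
    (Metric.mem_closedBall_self (abs_nonneg _)) (show x ∈ _ by simp [Real.dist_eq])
  have h5 := (abs_le.1 this).1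
  simp only [g, sub_self, Real.norm_eq_abs] at h5
  have : ε * |x - s| * |x - s| = ε * (x - s) ^ 2 := by rw [mul_assoc, abs_mul_abs_self]; ring
  rw [this] at h5
  simp at h5
  linarith

theorem lowerJet_radial {f f' : ℝ → ℝ} {z : ℂ} {f₂ : ℝ}
    (hf : ∀ᶠ x in 𝓝 (‖z‖ ^ 2), HasDerivAt f (f' x) x) (hf' : HasDerivAt f' f₂ (‖z‖ ^ 2)) :
    LowerJet (fun y => f (‖y‖ ^ 2)) z (4 * (f' (‖z‖ ^ 2) + f₂ * ‖z‖ ^ 2)) := by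
  set c := (starRingEnd ℂ) z
  -- With `q = Re (c (y - z))`, one has `‖y‖² - ‖z‖² = 2q + ‖y - z‖²` and `2q² = ‖z‖² ‖y - z‖² + Re
  -- ((c (y - z))²)`. The second identity splits the quadratic Taylor term into a harmonic part,
  -- with coefficient `f₂ c²`, and a radial part which contributes to the Laplacian.
  refine ⟨2 * f' (‖z‖ ^ 2) * c, f₂ * c ^ 2, fun ε hε => ?_⟩
  have hid : ∀ y, ‖y‖ ^ 2 - ‖z‖ ^ 2 = 2 * (c * (y - z)).re + ‖y - z‖ ^ 2 := by
    intro y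
    simp only [c, ← Complex.normSq_eq_norm_sq, Complex.normSq_apply]
    simp; ring
  have hsq : ∀ w : ℂ, 2 * (w.re) ^ 2 = ‖w‖ ^ 2 + (w ^ 2).re := by
    intro w
    rw [← Complex.normSq_eq_norm_sq, Complex.normSq_apply, pow_two w, Complex.mul_re]; ring
  set n := ‖z‖
  have hc : ‖c‖ = n := by simp [c, n]
  set η := ε / (2 * (2 * n + 1) ^ 2)
  have hη : 0 < η := by positivity
  have hcont : ContinuousAt (fun y : ℂ => ‖y‖ ^ 2) z := by fun_prop
  have h1 := hcont.eventually (eventually_le_taylor_two hf hf' hη)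
  have h2 : ContinuousAt (fun y : ℂ => |f₂| / 2 * (4 * n * ‖y - z‖ + ‖y - z‖ ^ 2)) z := by fun_prop
  filter_upwards [h1, Metric.ball_mem_nhds z one_pos,
    h2.eventually (gt_mem_nhds (show _ < ε / 2 by simpa using hε))] with y hy hy1 hy2
  rw [Metric.mem_ball, dist_eq_norm] at hy1
  refine le_trans ?_ hy
  rw [hid y]
  set d := ‖y - z‖
  have hd : 0 ≤ d := norm_nonneg _
  set q := (c * (y - z)).re
  have hq : |q| ≤ n * d := by
    have := Complex.abs_re_le_norm (c * (y - z))
    rwa [norm_mul, hc] at this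
  have hre : (2 * (f' (n ^ 2) : ℂ) * c * (y - z) + f₂ * c ^ 2 * (y - z) ^ 2).re
      = 2 * f' (n ^ 2) * q + f₂ * ((c * (y - z)) ^ 2).re := by
    have : 2 * (f' (n ^ 2) : ℂ) * c * (y - z) + f₂ * c ^ 2 * (y - z) ^ 2
        = ((2 * f' (n ^ 2) : ℝ) : ℂ) * (c * (y - z)) + (f₂ : ℂ) * (c * (y - z)) ^ 2 := by
      push_cast; ring
    rw [this, Complex.add_re, Complex.re_ofReal_mul, Complex.re_ofReal_mul]
  rw [hre]
  have hq2 : ((c * (y - z)) ^ 2).re = 2 * q ^ 2 - (n * d) ^ 2 := by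
    have := hsq (c * (y - z))
    rw [norm_mul, hc] at this
    simp only [q, d]; linarith
  rw [hq2]
  have e1 : (2 * q + d ^ 2) ^ 2 ≤ ((2 * n + 1) * d) ^ 2 := by
    apply sq_le_sq'
    · nlinarith [neg_abs_le q]
    · nlinarith [le_abs_self q]
  have e2 : η * (2 * q + d ^ 2) ^ 2 ≤ ε / 2 * d ^ 2 := by
    calc η * (2 * q + d ^ 2) ^ 2 ≤ η * ((2 * n + 1) * d) ^ 2 := by gcongr
      _ = ε / 2 * d ^ 2 := by
        have hn1 : 2 * n + 1 ≠ 0 := by positivity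
        simp only [η]; field_simp
  have e3 : -(ε / 2 * d ^ 2) ≤ f₂ / 2 * (4 * q * d ^ 2 + d ^ 4) := by
    have h3 : |f₂ / 2 * (4 * q * d ^ 2 + d ^ 4)| ≤ |f₂| / 2 * (4 * n * d + d ^ 2) * d ^ 2 := by
      have h5 : |4 * q * d ^ 2 + d ^ 4| ≤ (4 * n * d + d ^ 2) * d ^ 2 := by
        calc |4 * q * d ^ 2 + d ^ 4| ≤ |4 * q * d ^ 2| + |d ^ 4| := abs_add_le _ _
          _ = 4 * |q| * d ^ 2 + d ^ 4 := by
            rw [abs_mul, abs_mul, abs_of_nonneg (by positivity : (0 : ℝ) ≤ d ^ 2),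
              abs_of_nonneg (by positivity : (0 : ℝ) ≤ d ^ 4), abs_of_nonneg (by norm_num : (0:ℝ) ≤ 4)]
          _ ≤ 4 * (n * d) * d ^ 2 + d ^ 4 := by gcongr
          _ = (4 * n * d + d ^ 2) * d ^ 2 := by ring
      rw [abs_mul, abs_div, abs_two, mul_assoc (|f₂| / 2)]
      exact mul_le_mul_of_nonneg_left h5 (by positivity)
    have h4 : |f₂| / 2 * (4 * n * d + d ^ 2) * d ^ 2 ≤ ε / 2 * d ^ 2 := by gcongr
    exact (neg_le_neg (h3.trans h4)).trans (neg_abs_le _)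
  have e4 : f₂ / 2 * (2 * q + d ^ 2) ^ 2 = f₂ * (2 * q ^ 2) + f₂ / 2 * (4 * q * d ^ 2 + d ^ 4) := by ring
  nlinarith

end IslandMaps

namespace IslandMaps

/-! ### Two functions on the plane -/

/-- A radial bump function supported in the disc of radius `R` about `c`; it is subharmonic outside
a small concentric disc. -/
noncomputable def bump (c : ℂ) (R : ℝ) (k : ℕ) (z : ℂ) : ℝ := (max 0 (1 - ‖z - c‖ ^ 2 / R ^ 2)) ^ k

theorem bump_nonneg (c : ℂ) (R : ℝ) (k : ℕ) (z : ℂ) : 0 ≤ bump c R k z :=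
  pow_nonneg (le_max_left _ _) _

theorem bump_eq_zero {c : ℂ} {R : ℝ} (hR : 0 < R) {k : ℕ} (hk : k ≠ 0) {z : ℂ} (hz : R ≤ ‖z - c‖) :
    bump c R k z = 0 := by
  have : 1 - ‖z - c‖ ^ 2 / R ^ 2 ≤ 0 := by
    rw [sub_nonpos, one_le_div (by positivity)]; gcongr
  rw [bump, max_eq_left this, zero_pow hk]

theorem continuous_bump (c : ℂ) (R : ℝ) (k : ℕ) : Continuous (bump c R k) := by
  unfold bump; fun_prop

theorem LowerJet.comp_sub {u : ℂ → ℝ} {z c : ℂ} {τ : ℝ} (h : LowerJet u (z - c) τ) :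
    LowerJet (fun y => u (y - c)) z τ := by
  have h1 : AnalyticAt ℂ (fun y : ℂ => y - c) z := by fun_prop
  have := h.comp (T := fun y => y - c) h1
  simpa using this

/-- The sign of the last factor is what counts: a large exponent makes the bump subharmonic outside
an arbitrarily small disc about its centre, at the price of a bounded negative Laplacian inside. -/
theorem lowerJet_bump {c : ℂ} {R : ℝ} (hR : 0 < R) (k : ℕ) {z : ℂ} (hz : ‖z - c‖ < R) :
    LowerJet (bump c R (k + 2)) z (4 * (k + 2) / R ^ 2 * (1 - ‖z - c‖ ^ 2 / R ^ 2) ^ k *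
      ((k + 2) * (‖z - c‖ ^ 2 / R ^ 2) - 1)) := by
  set f : ℝ → ℝ := fun x => (1 - x / R ^ 2) ^ (k + 2)
  set f' : ℝ → ℝ := fun x => (k + 2 : ℕ) * (1 - x / R ^ 2) ^ (k + 1) * (-(1 / R ^ 2))
  have h0 : ∀ x, HasDerivAt (fun x : ℝ => 1 - x / R ^ 2) (-(1 / R ^ 2)) x := fun x =>
    ((hasDerivAt_id' x).div_const _).const_sub 1
  have hf : ∀ x, HasDerivAt f (f' x) x := fun x => (h0 x).fun_pow (k + 2)
  have hf' : ∀ x, HasDerivAt f' ((k + 2 : ℕ) * (((k + 1 : ℕ) * (1 - x / R ^ 2) ^ k * (-(1 / R ^ 2))))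
      * (-(1 / R ^ 2))) x := fun x =>
    (((h0 x).fun_pow (k + 1)).const_mul _).mul_const _
  have h1 := lowerJet_radial (z := z - c) (Eventually.of_forall hf) (hf' _)
  have h2 := h1.comp_sub
  refine (h2.congr ?_).mono (le_of_eq ?_)
  · have : ∀ᶠ y in 𝓝 z, ‖y - c‖ < R := (by fun_prop : Continuous fun y => ‖y - c‖).continuousAt.eventually (gt_mem_nhds hz)
    filter_upwards [this] with y hy
    have h3 : 0 ≤ 1 - ‖y - c‖ ^ 2 / R ^ 2 := by
      rw [sub_nonneg, div_le_one (by positivity)]; gcongr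
    simp only [bump, f, max_eq_right h3]
  · simp only [f']
    set s := ‖z - c‖ ^ 2 / R ^ 2 with hs
    have hs' : ‖z - c‖ ^ 2 = s * R ^ 2 := by rw [hs]; field_simp
    rw [hs', pow_succ (1 - s) k]
    generalize (1 - s) ^ k = t
    push_cast
    field_simp
    ring

/-- A function with a logarithmic pole at `a`, which vanishes outside the disc of radius `2`. -/
noncomputable def poleFun (a z : ℂ) : ℝ :=
  if ‖z - a‖ < 2 then max 0 ((-Real.log (‖z - a‖ / 2) - 1 + ‖z - a‖ / 2) / 2) else 0

theorem poleFun_nonneg (a z : ℂ) : 0 ≤ poleFun a z := by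
  unfold poleFun; split_ifs
  · exact le_max_left _ _
  · exact le_rfl

theorem poleFun_of_lt {a z : ℂ} (h : ‖z - a‖ < 2) (h0 : z ≠ a) :
    poleFun a z = (-Real.log (‖z - a‖ / 2) - 1 + ‖z - a‖ / 2) / 2 := by
  have h1 : 0 < ‖z - a‖ := norm_pos_iff.2 (sub_ne_zero.2 h0)
  rw [poleFun, if_pos h, max_eq_right]
  have := Real.log_le_sub_one_of_pos (show 0 < ‖z - a‖ / 2 by positivity)
  linarith

theorem poleFun_of_ge {a z : ℂ} (h : 2 ≤ ‖z - a‖) : poleFun a z = 0 := by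
  rw [poleFun, if_neg h.not_gt]

/-- The factor `1/2` in front of the logarithm gives `exp (2 v)` a pole of order only one. This
matches the growth `1 / ‖z - a‖` of the Laplacian of the pole function, so that the latter can
dominate a multiple of `exp (2 v)`. -/
theorem exp_two_mul_poleFun_le {a z : ℂ} (h : ‖z - a‖ < 2) (h0 : z ≠ a) :
    Real.exp (2 * poleFun a z) ≤ 2 / ‖z - a‖ := by
  have h1 : 0 < ‖z - a‖ := norm_pos_iff.2 (sub_ne_zero.2 h0)
  rw [poleFun_of_lt h h0, show 2 / ‖z - a‖ = Real.exp (-Real.log (‖z - a‖ / 2)) by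
    rw [Real.exp_neg, Real.exp_log (by positivity), inv_div]]
  rw [Real.exp_le_exp]
  linarith

theorem continuousAt_poleFun {a z : ℂ} (h0 : z ≠ a) : ContinuousAt (poleFun a) z := by
  have h1 : 0 < ‖z - a‖ := norm_pos_iff.2 (sub_ne_zero.2 h0)
  have hA : ContinuousOn (fun z => (-Real.log (‖z - a‖ / 2) - 1 + ‖z - a‖ / 2) / 2) {a}ᶜ := by
    intro y hy
    have : ‖y - a‖ / 2 ≠ 0 := by
      have : 0 < ‖y - a‖ := norm_pos_iff.2 (sub_ne_zero.2 hy)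
      positivity
    refine ContinuousAt.continuousWithinAt ?_
    fun_prop (disch := assumption)
  have hB : ContinuousOn (poleFun a) {a}ᶜ := by
    have : EqOn (poleFun a) (fun z => (-Real.log (min ‖z - a‖ 2 / 2) - 1 + min ‖z - a‖ 2 / 2) / 2) {a}ᶜ := by
      intro y hy
      rcases lt_or_ge ‖y - a‖ 2 with h | h
      · simp only [poleFun_of_lt h hy, min_eq_left h.le]
      · simp [poleFun_of_ge h, min_eq_right h]
    refine ContinuousOn.congr (fun y hy => ?_) this
    have h2 : min ‖y - a‖ 2 / 2 ≠ 0 := by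
      have : 0 < ‖y - a‖ := norm_pos_iff.2 (sub_ne_zero.2 hy)
      positivity
    refine ContinuousAt.continuousWithinAt ?_
    fun_prop (disch := assumption)
  exact hB.continuousAt (isOpen_compl_singleton.mem_nhds h0)

/-- The logarithm is harmonic off `a`, so the whole Laplacian comes from the term `‖z - a‖ / 4`. -/
theorem lowerJet_poleFun {a z : ℂ} (h : ‖z - a‖ < 2) (h0 : z ≠ a) :
    LowerJet (poleFun a) z (1 / (4 * ‖z - a‖)) := by
  have hpos : 0 < ‖z - a‖ := norm_pos_iff.2 (sub_ne_zero.2 h0)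
  set f : ℝ → ℝ := fun x => (-(Real.log x / 2 - Real.log 2) - 1 + √x / 2) / 2
  set f' : ℝ → ℝ := fun x => (-(x⁻¹ / 2) + (1 / (2 * √x)) / 2) / 2
  have hf : ∀ x, 0 < x → HasDerivAt f (f' x) x := fun x hx =>
    ((((((Real.hasDerivAt_log hx.ne').div_const 2).sub_const _).neg.sub_const 1).add
      ((Real.hasDerivAt_sqrt hx.ne').div_const 2))).div_const 2
  have hs : 0 < ‖z - a‖ ^ 2 := by positivity
  have hsq : √(‖z - a‖ ^ 2) = ‖z - a‖ := Real.sqrt_sq hpos.le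
  have hf' : HasDerivAt f' ((-(-(‖z - a‖ ^ 2 ^ 2)⁻¹ / 2) + (-(1 / (2 * ‖z - a‖)) / ‖z - a‖ ^ 2 / 2) / 2) / 2)
      (‖z - a‖ ^ 2) := by
    have h2 : HasDerivAt (fun x => 1 / (2 * √x)) (-(1 / (2 * ‖z - a‖)) / ‖z - a‖ ^ 2 / 2) (‖z - a‖ ^ 2) := by
      have h3 := ((Real.hasDerivAt_sqrt hs.ne').fun_inv (by rw [hsq]; exact hpos.ne')).div_const 2
      rw [hsq] at h3
      refine h3.congr_of_eventuallyEq ?_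
      exact Eventually.of_forall fun x => by
        simp only []
        rw [one_div, mul_inv, mul_comm]; rfl
    refine ((((hasDerivAt_inv hs.ne').div_const 2).neg).add (h2.div_const 2)).div_const 2 |>.congr_deriv ?_
    ring
  have h1 := lowerJet_radial (z := z - a) ((lt_mem_nhds hs).mono hf) hf'
  have h2 := h1.comp_sub
  refine (h2.congr ?_).mono (le_of_eq ?_)
  · have : ∀ᶠ y in 𝓝 z, ‖y - a‖ < 2 := (by fun_prop : Continuous fun y => ‖y - a‖).continuousAt.eventually (gt_mem_nhds h)
    filter_upwards [this, isOpen_compl_singleton.mem_nhds h0] with y hy hya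
    have h3 : 0 < ‖y - a‖ := norm_pos_iff.2 (sub_ne_zero.2 hya)
    rw [poleFun_of_lt hy hya]
    simp only [f]
    rw [Real.sqrt_sq h3.le, Real.log_pow, Real.log_div h3.ne' two_ne_zero]
    push_cast; ring
  · simp only [f', hsq]
    field_simp
    ring

end IslandMaps

namespace IslandMaps

variable {X : Type*} [TopologicalSpace X] [ChartedSpace ℂ X]

/-! ### Functions on a compact Riemann surface -/

open Classical in
/-- The function `g`, read in the chart `e`, extended by zero. -/
noncomputable def chartExt (e : OpenPartialHomeomorph X ℂ) (g : ℂ → ℝ) (p : X) : ℝ :=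
  if p ∈ e.source then g (e p) else 0

theorem chartExt_of_mem {e : OpenPartialHomeomorph X ℂ} {g : ℂ → ℝ} {p : X} (hp : p ∈ e.source) :
    chartExt e g p = g (e p) := if_pos hp

theorem chartExt_of_notMem {e : OpenPartialHomeomorph X ℂ} {g : ℂ → ℝ} {p : X} (hp : p ∉ e.source) :
    chartExt e g p = 0 := if_neg hp

theorem chartExt_nonneg {e : OpenPartialHomeomorph X ℂ} {g : ℂ → ℝ} (hg : ∀ z, 0 ≤ g z) (p : X) :
    0 ≤ chartExt e g p := by
  unfold chartExt; split_ifs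
  exacts [hg _, le_rfl]

/-- The preimage under a chart of a closed disc about `0`. -/
def chartDisc (e : OpenPartialHomeomorph X ℂ) (r : ℝ) : Set X := {p | p ∈ e.source ∧ ‖e p‖ ≤ r}

theorem chartDisc_eq {e : OpenPartialHomeomorph X ℂ} {r : ℝ} (h : Metric.closedBall 0 r ⊆ e.target) :
    chartDisc e r = e.symm '' Metric.closedBall 0 r := by
  ext p
  constructor
  · rintro ⟨h1, h2⟩
    exact ⟨e p, by simpa using h2, e.left_inv h1⟩
  · rintro ⟨z, hz, rfl⟩
    refine ⟨e.map_target (h hz), ?_⟩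
    rw [e.right_inv (h hz)]; simpa using hz

theorem isCompact_chartDisc {e : OpenPartialHomeomorph X ℂ} {r : ℝ}
    (h : Metric.closedBall 0 r ⊆ e.target) : IsCompact (chartDisc e r) := by
  rw [chartDisc_eq h]
  exact (isCompact_closedBall 0 r).image_of_continuousOn (e.continuousOn_symm.mono h)

theorem IsDiscChart.closedBall_subset {e : OpenPartialHomeomorph X ℂ} {p : X} (he : IsDiscChart e p)
    {r : ℝ} (hr : r ≤ 4) : Metric.closedBall 0 r ⊆ e.target :=
  (Metric.closedBall_subset_closedBall hr).trans he.subset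

theorem IsDiscChart.isClosed_chartDisc [T2Space X] {e : OpenPartialHomeomorph X ℂ} {p : X}
    (he : IsDiscChart e p) {r : ℝ} (hr : r ≤ 4) : IsClosed (chartDisc e r) :=
  (isCompact_chartDisc (he.closedBall_subset hr)).isClosed

theorem continuousAt_chartExt [T2Space X] {e : OpenPartialHomeomorph X ℂ} {g : ℂ → ℝ} {q : X}
    (he : IsDiscChart e q) (hg : ∀ z, 4 ≤ ‖z‖ → g z = 0) {p : X}
    (hp : p ∈ e.source → ContinuousAt g (e p)) : ContinuousAt (chartExt e g) p := by
  by_cases h : p ∈ e.source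
  · refine ((hp h).comp (e.continuousAt h)).congr ?_
    filter_upwards [e.open_source.mem_nhds h] with y hy
    exact (chartExt_of_mem hy).symm
  · have h1 : p ∈ (chartDisc e 4)ᶜ := fun h' => h h'.1
    refine (continuousAt_const (y := (0 : ℝ))).congr ?_
    filter_upwards [(he.isClosed_chartDisc le_rfl).isOpen_compl.mem_nhds h1] with y hy
    by_cases hys : y ∈ e.source
    · rw [chartExt_of_mem hys, hg]
      by_contra! hcon
      exact hy ⟨hys, hcon.le⟩
    · rw [chartExt_of_notMem hys]

theorem deriv_transition_mul {e e' : OpenPartialHomeomorph X ℂ}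
    (he : e.MDifferentiable 𝓘(ℂ) 𝓘(ℂ)) (he' : e'.MDifferentiable 𝓘(ℂ) 𝓘(ℂ)) {p : X}
    (hp : p ∈ e.source) (hp' : p ∈ e'.source) :
    deriv (fun z => e' (e.symm z)) (e p) * deriv (fun z => e (e'.symm z)) (e' p) = 1 := by
  have h1 := (differentiableAt_transition he he' (e.map_source hp) (by rwa [e.left_inv hp])).hasDerivAt
  have h2 := (differentiableAt_transition he' he (e'.map_source hp') (by rwa [e'.left_inv hp'])).hasDerivAt
  have h3 : (fun z => e (e'.symm z)) (e' p) = e p := by simp [e'.left_inv hp']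
  rw [← h3] at h1
  have h4 := h1.comp (e' p) h2
  rw [h3] at h4
  have h5 : HasDerivAt (fun z => e' (e.symm (e (e'.symm z)))) 1 (e' p) := by
    refine (hasDerivAt_id (e' p)).congr_of_eventuallyEq ?_
    have h6 : ∀ᶠ z in 𝓝 (e' p), e'.symm z ∈ e.source :=
      (e'.continuousAt_symm (e'.map_source hp')).eventually
        (e.open_source.mem_nhds (by rwa [e'.left_inv hp']))
    filter_upwards [h6, e'.open_target.mem_nhds (e'.map_source hp')] with z hz hz'
    simp [e.left_inv hz, e'.right_inv hz']
  exact h4.unique h5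

theorem deriv_chart_comp {e e' : OpenPartialHomeomorph X ℂ}
    (he : e.MDifferentiable 𝓘(ℂ) 𝓘(ℂ)) (he' : e'.MDifferentiable 𝓘(ℂ) 𝓘(ℂ)) {h : ℂ → X} {z : ℂ}
    (hh : MDifferentiableAt 𝓘(ℂ) 𝓘(ℂ) h z) (hz : h z ∈ e.source) (hz' : h z ∈ e'.source) :
    deriv (fun y => e' (h y)) z
      = deriv (fun y => e' (e.symm y)) (e (h z)) * deriv (fun y => e (h y)) z := by
  have h1 := (differentiableAt_transition he he' (e.map_source hz) (by rwa [e.left_inv hz])).hasDerivAt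
  have h2 := (differentiableAt_chart_comp he hh hz).hasDerivAt
  refine ((h1.comp z h2).congr_of_eventuallyEq ?_).deriv
  filter_upwards [hh.continuousAt.eventually (e.open_source.mem_nhds hz)] with y hy
  simp [e.left_inv hy]

section Cover

variable [IsManifold 𝓘(ℂ) 1 X]

theorem exists_finset_discChart [CompactSpace X] (b : X) :
    ∃ J : Finset X, b ∈ J ∧ ∀ p : X, ∃ j ∈ J, p ∈ (discChart j).source ∧ ‖discChart j p‖ < 1 / 2 := by
  classical
  let N : X → Set X := fun j => {p | p ∈ (discChart j).source ∧ ‖discChart j p‖ < 1 / 2}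
  have hN : ∀ j, N j ∈ 𝓝 j := fun j => by
    have hj := isDiscChart_discChart j
    have h1 : ContinuousAt (fun p => ‖discChart j p‖) j :=
      ((discChart j).continuousAt hj.mem).norm
    filter_upwards [(discChart j).open_source.mem_nhds hj.mem,
      h1.eventually (gt_mem_nhds (show ‖discChart j j‖ < 1 / 2 by rw [hj.map_eq]; norm_num))] with p h2 h3
    exact ⟨h2, h3⟩
  obtain ⟨t, -, ht⟩ := isCompact_univ.elim_nhds_subcover N fun j _ => hN j
  refine ⟨insert b t, Finset.mem_insert_self b t, fun p => ?_⟩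
  obtain ⟨j, hj, hp⟩ := mem_iUnion₂.1 (ht (mem_univ p))
  exact ⟨j, Finset.mem_insert_of_mem hj, hp⟩

theorem exists_bound_transition [T2Space X] (J : Finset X) :
    ∃ C : ℝ, 1 ≤ C ∧ ∀ j ∈ J, ∀ k ∈ J, ∀ p ∈ chartDisc (discChart j) 3, p ∈ chartDisc (discChart k) 3 →
      ‖deriv (fun z => discChart k ((discChart j).symm z)) (discChart j p)‖ ≤ C := by
  have h1 : ∀ q : X × X, ∃ C : ℝ, ∀ p ∈ chartDisc (discChart q.1) 3, p ∈ chartDisc (discChart q.2) 3 →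
      ‖deriv (fun z => discChart q.2 ((discChart q.1).symm z)) (discChart q.1 p)‖ ≤ C := by
    rintro ⟨j, k⟩
    set e := discChart j
    set e' := discChart k
    have he : IsDiscChart e j := isDiscChart_discChart j
    have he' : IsDiscChart e' k := isDiscChart_discChart k
    have hK : IsCompact (chartDisc e 3 ∩ chartDisc e' 3) :=
      (isCompact_chartDisc (he.closedBall_subset (by norm_num))).inter_right
        (he'.isClosed_chartDisc (by norm_num))
    have hcont : ContinuousOn (fun p => deriv (fun z => e' (e.symm z)) (e p))
        (chartDisc e 3 ∩ chartDisc e' 3) := by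
      rintro p ⟨hp, hp'⟩
      have ho : IsOpen (e.target ∩ e.symm ⁻¹' e'.source) :=
        e.isOpen_inter_preimage_symm e'.open_source
      have hd : DifferentiableOn ℂ (fun z => e' (e.symm z)) (e.target ∩ e.symm ⁻¹' e'.source) :=
        fun z hz => (differentiableAt_transition he.mdiff he'.mdiff hz.1 hz.2).differentiableWithinAt
      have hm : e p ∈ e.target ∩ e.symm ⁻¹' e'.source :=
        ⟨e.map_source hp.1, by simpa [e.left_inv hp.1] using hp'.1⟩
      have h2 := (hd.deriv ho).continuousOn.continuousAt (ho.mem_nhds hm)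
      exact (ContinuousAt.comp (f := e) h2 (e.continuousAt hp.1)).continuousWithinAt
    obtain ⟨C, hC⟩ := hK.exists_bound_of_continuousOn hcont
    exact ⟨C, fun p hp hp' => hC p ⟨hp, hp'⟩⟩
  choose C hC using h1
  obtain ⟨M, hM⟩ := ((J ×ˢ J).image C).exists_le
  refine ⟨max 1 M, le_max_left _ _, fun j hj k hk p hp hp' => ?_⟩
  refine (hC (j, k) p hp hp').trans (le_trans ?_ (le_max_right _ _))
  exact hM _ (Finset.mem_image_of_mem C (Finset.mk_mem_product hj hk))

/-- In each of the charts centred in `J`, on the closed unit disc, `V` has a lower jet with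
Laplacian `τ` at `p`. -/
def JetGE (J : Finset X) (V : X → ℝ) (p : X) (τ : ℝ) : Prop :=
  ∀ j ∈ J, p ∈ chartDisc (discChart j) 1 → LowerJet (fun z => V ((discChart j).symm z)) (discChart j p) τ

theorem JetGE.mono {J : Finset X} {V : X → ℝ} {p : X} {τ σ : ℝ} (h : JetGE J V p τ) (hσ : σ ≤ τ) :
    JetGE J V p σ := fun j hj hp => (h j hj hp).mono hσ

theorem JetGE.add {J : Finset X} {V V' : X → ℝ} {p : X} {τ σ : ℝ} (h : JetGE J V p τ)
    (h' : JetGE J V' p σ) : JetGE J (fun p => V p + V' p) p (τ + σ) :=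
  fun j hj hp => (h j hj hp).add (h' j hj hp)

theorem JetGE.const_mul {J : Finset X} {V : X → ℝ} {p : X} {τ c : ℝ} (h : JetGE J V p τ)
    (hc : 0 < c) : JetGE J (fun p => c * V p) p (c * τ) :=
  fun j hj hp => (h j hj hp).const_mul hc

theorem JetGE.sum {J : Finset X} {ι : Type*} {s : Finset ι} {V : ι → X → ℝ} {t : ι → ℝ} {p : X}
    (h : ∀ i ∈ s, JetGE J (V i) p (t i)) : JetGE J (fun p => ∑ i ∈ s, V i p) p (∑ i ∈ s, t i) :=
  fun j hj hp => LowerJet.sum fun i hi => h i hi j hj hp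

theorem jetGE_chartExt_of_eq_zero {J : Finset X} {e : OpenPartialHomeomorph X ℂ} {g : ℂ → ℝ}
    (hg : ∀ z, 0 ≤ g z) {p : X} (hp : chartExt e g p = 0) : JetGE J (chartExt e g) p 0 := by
  intro j hj hpj
  refine LowerJet.of_nonneg ?_ fun z => chartExt_nonneg hg _
  rw [(discChart j).left_inv hpj.1, hp]

theorem lowerJet_chartExt {e e' : OpenPartialHomeomorph X ℂ} (he : e.MDifferentiable 𝓘(ℂ) 𝓘(ℂ))
    (he' : e'.MDifferentiable 𝓘(ℂ) 𝓘(ℂ)) {g : ℂ → ℝ} {p : X} (hp : p ∈ e.source)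
    (hp' : p ∈ e'.source) {τ : ℝ} (h : LowerJet g (e p) τ) :
    LowerJet (fun z => chartExt e g (e'.symm z)) (e' p)
      (τ * ‖deriv (fun z => e (e'.symm z)) (e' p)‖ ^ 2) := by
  have h6 : ∀ᶠ z in 𝓝 (e' p), e'.symm z ∈ e.source :=
    (e'.continuousAt_symm (e'.map_source hp')).eventually
      (e.open_source.mem_nhds (by rwa [e'.left_inv hp']))
  have h1 : AnalyticAt ℂ (fun z => e (e'.symm z)) (e' p) := by
    rw [Complex.analyticAt_iff_eventually_differentiableAt]
    filter_upwards [h6, e'.open_target.mem_nhds (e'.map_source hp')] with z hz hz'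
    exact differentiableAt_transition he' he hz' hz
  have h2 : LowerJet g ((fun z => e (e'.symm z)) (e' p)) τ := by simpa [e'.left_inv hp'] using h
  refine (h2.comp (T := fun z => e (e'.symm z)) h1).congr ?_
  filter_upwards [h6] with z hz
  exact (chartExt_of_mem hz).symm

/-- The derivatives of chart changes lie between `1 / C` and `C` in modulus, the lower bound coming
from the inverse change. Hence passing to another chart multiplies a Laplacian by a factor between
`1 / C ^ 2` and `C ^ 2`. The worse end depends on the sign of `τ`. -/
theorem jetGE_chartExt {J : Finset X} {C : ℝ} (hC1 : 1 ≤ C)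
    (hC : ∀ j ∈ J, ∀ k ∈ J, ∀ p ∈ chartDisc (discChart j) 3, p ∈ chartDisc (discChart k) 3 →
      ‖deriv (fun z => discChart k ((discChart j).symm z)) (discChart j p)‖ ≤ C)
    {i : X} (hi : i ∈ J) {g : ℂ → ℝ} {p : X} (hp : p ∈ chartDisc (discChart i) 3) {τ : ℝ}
    (h : LowerJet g (discChart i p) τ) :
    (0 ≤ τ → JetGE J (chartExt (discChart i) g) p (τ / C ^ 2)) ∧
    (τ ≤ 0 → JetGE J (chartExt (discChart i) g) p (τ * C ^ 2)) := by
  have key : ∀ j ∈ J, p ∈ chartDisc (discChart j) 1 →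
      ∃ d : ℝ, 1 / C ≤ d ∧ d ≤ C ∧
        LowerJet (fun z => chartExt (discChart i) g ((discChart j).symm z)) (discChart j p) (τ * d ^ 2) := by
    intro j hj hpj
    have hpj3 : p ∈ chartDisc (discChart j) 3 := ⟨hpj.1, hpj.2.trans (by norm_num)⟩
    refine ⟨_, ?_, hC j hj i hi p hpj3 hp, lowerJet_chartExt (isDiscChart_discChart i).mdiff
      (isDiscChart_discChart j).mdiff hp.1 hpj.1 h⟩
    have h1 := congrArg norm (deriv_transition_mul (isDiscChart_discChart j).mdiff
      (isDiscChart_discChart i).mdiff hpj.1 hp.1)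
    rw [norm_mul, norm_one] at h1
    have h2 := hC i hi j hj p hp hpj3
    rw [div_le_iff₀ (by positivity), ← h1]
    gcongr
  constructor
  · intro hτ j hj hpj
    obtain ⟨d, hd1, hd2, hd⟩ := key j hj hpj
    refine hd.mono ?_
    rw [div_eq_mul_one_div]
    have : 1 / C ^ 2 ≤ d ^ 2 := by
      rw [← one_div_pow]; gcongr
    gcongr
  · intro hτ j hj hpj
    obtain ⟨d, hd1, hd2, hd⟩ := key j hj hpj
    refine hd.mono ?_
    have hd0 : 0 ≤ d := le_trans (by positivity) hd1
    exact mul_le_mul_of_nonpos_left (by gcongr) hτ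

end Cover

end IslandMaps

/-! ### A function on the surface which is strictly subharmonic off a coordinate disc -/

namespace IslandMaps

variable {X : Type*} [TopologicalSpace X] [ChartedSpace ℂ X] [IsManifold 𝓘(ℂ) 1 X] [T2Space X]

/-- `C` bounds the derivatives of the changes of charts between the charts centred in `J`. -/
structure TransitionBound (J : Finset X) (C : ℝ) : Prop where
  one_le : 1 ≤ C
  bound : ∀ j ∈ J, ∀ k ∈ J, ∀ p ∈ chartDisc (discChart j) 3, p ∈ chartDisc (discChart k) 3 →
    ‖deriv (fun z => discChart k ((discChart j).symm z)) (discChart j p)‖ ≤ C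

section Bump

variable {J : Finset X} {C : ℝ} {i : X} {c : ℂ} {R : ℝ} {k : ℕ}

theorem continuous_chartExt_bump (hR : 0 < R) (hcR : ‖c‖ + R ≤ 3) (hk : k ≠ 0) :
    Continuous (chartExt (discChart i) (bump c R k)) := by
  refine continuous_iff_continuousAt.2 fun p => ?_
  refine continuousAt_chartExt (isDiscChart_discChart i) (fun z hz => ?_)
    fun _ => (continuous_bump c R k).continuousAt
  refine bump_eq_zero hR hk ?_
  have := norm_sub_norm_le z c
  linarith

theorem chartExt_bump_eq_zero (hR : 0 < R) (hk : k ≠ 0) {p : X}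
    (hp : p ∈ (discChart i).source → R ≤ ‖discChart i p - c‖) :
    chartExt (discChart i) (bump c R k) p = 0 := by
  by_cases h : p ∈ (discChart i).source
  · rw [chartExt_of_mem h, bump_eq_zero hR hk (hp h)]
  · exact chartExt_of_notMem h

theorem mem_chartDisc_of_lt (hcR : ‖c‖ + R ≤ 3) {p : X}
    (hp : p ∈ (discChart i).source) (h : ‖discChart i p - c‖ < R) : p ∈ chartDisc (discChart i) 3 := by
  refine ⟨hp, ?_⟩
  have := norm_sub_norm_le (discChart i p) c
  linarith

theorem jetGE_bump_lower (hC : TransitionBound J C) (hi : i ∈ J) (hR : 0 < R) (hcR : ‖c‖ + R ≤ 3)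
    (k : ℕ) : ∃ D : ℝ, 0 ≤ D ∧ ∀ p, JetGE J (chartExt (discChart i) (bump c R (k + 2))) p (-D) := by
  refine ⟨4 * (k + 2) / R ^ 2 * C ^ 2, by positivity, fun p => ?_⟩
  by_cases h : p ∈ (discChart i).source ∧ ‖discChart i p - c‖ < R
  · have h1 := (lowerJet_bump hR k h.2).mono (σ := -(4 * (k + 2) / R ^ 2)) (by
      set s := ‖discChart i p - c‖ ^ 2 / R ^ 2
      have hs0 : 0 ≤ s := by positivity
      have hs1 : s ≤ 1 := by
        simp only [s]; rw [div_le_one (by positivity)]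
        exact pow_le_pow_left₀ (norm_nonneg _) h.2.le 2
      have h3 : (1 - s) ^ k ≤ 1 := pow_le_one₀ (by linarith) (by linarith)
      have h4 : 0 ≤ (1 - s) ^ k := pow_nonneg (by linarith) k
      have h5 : -1 ≤ (1 - s) ^ k * ((k + 2) * s - 1) := by
        have : 0 ≤ (1 - s) ^ k * ((k + 2) * s) := by positivity
        linarith
      rw [mul_assoc]
      have h6 : 0 ≤ 4 * ((k : ℝ) + 2) / R ^ 2 := by positivity
      nlinarith)
    have h2 := (jetGE_chartExt hC.one_le hC.bound hi (mem_chartDisc_of_lt hcR h.1 h.2) h1).2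
      (neg_nonpos.2 (by positivity))
    exact h2.mono (by rw [neg_mul])
  · refine (jetGE_chartExt_of_eq_zero (bump_nonneg _ _ _) ?_).mono (neg_nonpos.2 (by positivity))
    exact chartExt_bump_eq_zero hR (by omega) fun hp => le_of_not_gt fun h' => h ⟨hp, h'⟩

theorem jetGE_bump_nonneg (hC : TransitionBound J C) (hi : i ∈ J) (hR : 0 < R) (hcR : ‖c‖ + R ≤ 3)
    (k : ℕ) {p : X} (hp : p ∈ (discChart i).source → 1 ≤ (k + 2) * (‖discChart i p - c‖ ^ 2 / R ^ 2)) :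
    JetGE J (chartExt (discChart i) (bump c R (k + 2))) p 0 := by
  by_cases h : p ∈ (discChart i).source ∧ ‖discChart i p - c‖ < R
  · have h1 := (lowerJet_bump hR k h.2).mono (σ := 0) (by
      have hs1 : ‖discChart i p - c‖ ^ 2 / R ^ 2 ≤ 1 := by
        rw [div_le_one (by positivity)]
        exact pow_le_pow_left₀ (norm_nonneg _) h.2.le 2
      have h4 : 0 ≤ (1 - ‖discChart i p - c‖ ^ 2 / R ^ 2) ^ k := pow_nonneg (by linarith) k
      have h5 := hp h.1
      exact mul_nonneg (mul_nonneg (by positivity) h4) (by linarith))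
    have h2 := (jetGE_chartExt hC.one_le hC.bound hi (mem_chartDisc_of_lt hcR h.1 h.2) h1).1 le_rfl
    simpa using h2
  · refine (jetGE_chartExt_of_eq_zero (bump_nonneg _ _ _) ?_)
    exact chartExt_bump_eq_zero hR (by omega) fun hp => le_of_not_gt fun h' => h ⟨hp, h'⟩

theorem jetGE_bump_pos (hC : TransitionBound J C) (hi : i ∈ J) (hR : 0 < R) (hcR : ‖c‖ + R ≤ 3)
    (k : ℕ) {s₀ s₁ : ℝ} (hs₀ : 1 < (k + 2) * s₀) (hs₁ : s₁ < 1) :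
    ∃ τ > 0, ∀ p ∈ (discChart i).source, s₀ ≤ ‖discChart i p - c‖ ^ 2 / R ^ 2 →
      ‖discChart i p - c‖ ^ 2 / R ^ 2 ≤ s₁ →
      JetGE J (chartExt (discChart i) (bump c R (k + 2))) p τ := by
  have hC0 : 0 < C := zero_lt_one.trans_le hC.one_le
  have hτ : 0 < 4 * ((k : ℝ) + 2) / R ^ 2 * (1 - s₁) ^ k * ((k + 2) * s₀ - 1) :=
    mul_pos (mul_pos (by positivity) (pow_pos (by linarith) k)) (by linarith)
  refine ⟨4 * (k + 2) / R ^ 2 * (1 - s₁) ^ k * ((k + 2) * s₀ - 1) / C ^ 2, by positivity,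
    fun p hp h0 h1 => ?_⟩
  have hlt : ‖discChart i p - c‖ < R := by
    have := h1.trans_lt hs₁
    rw [div_lt_one (by positivity)] at this
    exact lt_of_pow_lt_pow_left₀ 2 hR.le this
  have h2 := (lowerJet_bump hR k hlt).mono (σ := 4 * (k + 2) / R ^ 2 * (1 - s₁) ^ k * ((k + 2) * s₀ - 1)) (by
    have h3 : 0 ≤ 1 - s₁ := by linarith
    gcongr
    exact mul_nonneg (by positivity) (pow_nonneg (by linarith) k))
  exact (jetGE_chartExt hC.one_le hC.bound hi (mem_chartDisc_of_lt hcR hp hlt) h2).1 hτ.le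

end Bump

/-- Continuous functions on `X`, with Laplacian bounded below, and subharmonic off the closed unit
disc about `b`. -/
structure SubharmonicOff (J : Finset X) (b : X) (V : X → ℝ) : Prop where
  cont : Continuous V
  lower : ∃ D : ℝ, 0 ≤ D ∧ ∀ p, JetGE J V p (-D)
  nonneg : ∀ p ∉ chartDisc (discChart b) 1, JetGE J V p 0

theorem SubharmonicOff.add {J : Finset X} {b : X} {V V' : X → ℝ} (h : SubharmonicOff J b V)
    (h' : SubharmonicOff J b V') : SubharmonicOff J b (fun p => V p + V' p) := by
  obtain ⟨D, hD, hDV⟩ := h.lower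
  obtain ⟨D', hD', hDV'⟩ := h'.lower
  exact ⟨h.cont.add h'.cont, ⟨D + D', by positivity, fun p => ((hDV p).add (hDV' p)).mono (by linarith)⟩,
    fun p hp => ((h.nonneg p hp).add (h'.nonneg p hp)).mono (by simp)⟩

theorem SubharmonicOff.const_mul {J : Finset X} {b : X} {V : X → ℝ} (h : SubharmonicOff J b V)
    {c : ℝ} (hc : 0 < c) : SubharmonicOff J b (fun p => c * V p) := by
  obtain ⟨D, hD, hDV⟩ := h.lower
  exact ⟨continuous_const.mul h.cont, ⟨c * D, by positivity, fun p => ((hDV p).const_mul hc).mono (by linarith)⟩,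
    fun p hp => ((h.nonneg p hp).const_mul hc).mono (by simp)⟩

/-- Near `p`, some function in the class `SubharmonicOff J b` is strictly subharmonic. -/
def IsStrictPt (J : Finset X) (b p : X) : Prop :=
  ∃ V, SubharmonicOff J b V ∧ ∃ τ > 0, ∀ᶠ q in 𝓝 p, JetGE J V q τ

theorem isStrictPt_sphere {J : Finset X} {C : ℝ} (hC : TransitionBound J C) {b : X} (hb : b ∈ J)
    {p : X} (hp : p ∈ (discChart b).source) (hp1 : ‖discChart b p‖ = 1) : IsStrictPt J b p := by
  have h2 : ‖(0 : ℂ)‖ + 2 ≤ 3 := by norm_num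
  -- With radius `2` and exponent `8` the bump is subharmonic as soon as `8 ‖z‖² / 4 ≥ 1`. This
  -- covers the outside of the unit disc and, strictly, a neighbourhood of the unit circle.
  refine ⟨chartExt (discChart b) (bump 0 2 (6 + 2)), ⟨continuous_chartExt_bump two_pos h2 (by norm_num),
    jetGE_bump_lower hC hb two_pos h2 6, fun q hq => jetGE_bump_nonneg hC hb two_pos h2 6 fun hqs => ?_⟩, ?_⟩
  · have : 1 < ‖discChart b q‖ := lt_of_not_ge fun h => hq ⟨hqs, h⟩
    rw [sub_zero]
    push_cast
    nlinarith
  · obtain ⟨τ, hτ, h⟩ := jetGE_bump_pos hC hb two_pos h2 6 (s₀ := 3 / 16) (s₁ := 1 / 2) (by norm_num) (by norm_num)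
    refine ⟨τ, hτ, ?_⟩
    have hc : ContinuousAt (fun q => ‖discChart b q - 0‖ ^ 2 / 2 ^ 2) p :=
      ((((discChart b).continuousAt hp).sub_const 0).norm.pow 2).div_const _
    have hv : ‖discChart b p - 0‖ ^ 2 / 2 ^ 2 = 1 / 4 := by rw [sub_zero, hp1]; norm_num
    filter_upwards [(discChart b).open_source.mem_nhds hp,
      hc.eventually (lt_mem_nhds (show 3 / 16 < ‖discChart b p - 0‖ ^ 2 / 2 ^ 2 by rw [hv]; norm_num)),
      hc.eventually (gt_mem_nhds (show ‖discChart b p - 0‖ ^ 2 / 2 ^ 2 < 1 / 2 by rw [hv]; norm_num))]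
      with q h1 h2 h3
    exact h q h1 h2.le h3.le

/-- Strictness is pushed from a nearby point `q` to `p` by a bump centred at `q`. Its Laplacian is
positive near `p` and negative only close to `q`, where a large multiple of the function belonging
to `q` compensates. -/
theorem isStrictPt_of_mem_closure {J : Finset X} {C : ℝ} (hC : TransitionBound J C) {b : X}
    (hcov : ∀ p : X, ∃ j ∈ J, p ∈ (discChart j).source ∧ ‖discChart j p‖ < 1 / 2)
    {p : X} (hp : p ∈ closure {q | IsStrictPt J b q}) (hpb : p ∉ chartDisc (discChart b) 1) :
    IsStrictPt J b p := by
  obtain ⟨j, hj, hps, hp2⟩ := hcov p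
  set e := discChart j
  have hN : {q | q ∈ e.source ∧ ‖e q - e p‖ < 1 / 2} ∈ 𝓝 p := by
    have hc : ContinuousAt (fun q => ‖e q - e p‖) p := ((e.continuousAt hps).sub_const _).norm
    filter_upwards [e.open_source.mem_nhds hps, hc.eventually (gt_mem_nhds (show ‖e p - e p‖ < 1 / 2 by simp))]
      with q h1 h2 using ⟨h1, h2⟩
  obtain ⟨q, ⟨hqs, hq2⟩, V, hV, τ, hτ, hVq⟩ := mem_closure_iff_nhds.1 hp _ hN
  set c := e q
  have hcR : ‖c‖ + 1 ≤ 3 := by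
    have := norm_le_norm_add_norm_sub (e p) c
    have h3 : ‖e p - c‖ = ‖c - e p‖ := norm_sub_rev _ _
    linarith
  by_cases hpV : ∀ᶠ y in 𝓝 p, JetGE J V y τ
  · exact ⟨V, hV, τ, hτ, hpV⟩
  -- the set where `V` is strictly subharmonic contains a disc about `q`
  obtain ⟨r, hr, hrV⟩ : ∃ r > 0, ∀ y ∈ e.source, ‖e y - c‖ < r → JetGE J V y τ := by
    have h1 : Tendsto e.symm (𝓝 c) (𝓝 q) := by
      have := e.continuousAt_symm (e.map_source hqs)
      rwa [ContinuousAt, e.left_inv hqs] at this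
    obtain ⟨r, hr, hball⟩ := Metric.eventually_nhds_iff_ball.1 (h1.eventually hVq)
    refine ⟨r, hr, fun y hy hyr => ?_⟩
    have := hball (e y) (by rwa [Metric.mem_ball, dist_eq_norm])
    rwa [e.left_inv hy] at this
  have hpr : r ≤ ‖e p - c‖ := by
    by_contra! hlt
    refine hpV ?_
    have hc : ContinuousAt (fun q => ‖e q - c‖) p := ((e.continuousAt hps).sub_const _).norm
    filter_upwards [e.open_source.mem_nhds hps, hc.eventually (gt_mem_nhds hlt)] with y h1 h2
      using hrV y h1 h2
  -- The exponent is large enough for the bump to be strictly subharmonic wherever the squared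
  -- distance to `c` is at least `r ^ 2 / 2` and at most `1 / 2`. The point `p` is such a point,
  -- since `r ≤ ‖e p - c‖ < 1 / 2`.
  obtain ⟨k, hk⟩ := exists_nat_gt (2 / r ^ 2)
  have hk' : 2 < (k + 2) * r ^ 2 := by
    rw [div_lt_iff₀ (by positivity)] at hk
    nlinarith [sq_nonneg r]
  obtain ⟨D, hD, hlow⟩ := jetGE_bump_lower hC hj one_pos hcR k
  obtain ⟨σ, hσ, hpos⟩ := jetGE_bump_pos hC hj one_pos hcR k (s₀ := r ^ 2 / 2) (s₁ := 1 / 2) (by linarith) (by norm_num)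
  set W := chartExt e (bump c 1 (k + 2))
  set K := D / τ + 1
  have hK : 0 < K := by positivity
  have hKτ : D ≤ K * τ := by simp only [K]; rw [add_mul, div_mul_cancel₀ _ hτ.ne']; linarith
  refine ⟨fun y => W y + K * V y, ⟨(continuous_chartExt_bump one_pos hcR (by omega)).add
    (hV.const_mul hK).cont, ?_, fun y hy => ?_⟩, σ, hσ, ?_⟩
  · obtain ⟨D', hD', hlow'⟩ := (hV.const_mul hK).lower
    exact ⟨D + D', by positivity, fun y => ((hlow y).add (hlow' y)).mono (by linarith)⟩
  · by_cases hy1 : y ∈ e.source ∧ ‖e y - c‖ < r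
    · exact ((hlow y).add ((hrV y hy1.1 hy1.2).const_mul hK)).mono (by linarith)
    · refine ((jetGE_bump_nonneg hC hj one_pos hcR k fun hys => ?_).add
        ((hV.const_mul hK).nonneg y hy)).mono (by simp)
      have h3 : r ≤ ‖e y - c‖ := le_of_not_gt fun h => hy1 ⟨hys, h⟩
      have h4 : r ^ 2 ≤ ‖e y - c‖ ^ 2 := by gcongr
      rw [one_pow, div_one]
      have h5 : ((k : ℝ) + 2) * r ^ 2 ≤ (k + 2) * ‖e y - c‖ ^ 2 := by gcongr
      linarith
  · have hc : ContinuousAt (fun q => ‖e q - c‖ ^ 2 / 1 ^ 2) p :=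
      ((((e.continuousAt hps).sub_const c).norm.pow 2).div_const _)
    have hpb' : ∀ᶠ y in 𝓝 p, y ∉ chartDisc (discChart b) 1 :=
      ((isDiscChart_discChart b).isClosed_chartDisc (by norm_num)).isOpen_compl.mem_nhds hpb
    have hpc : ‖e p - c‖ < 1 / 2 := by rwa [norm_sub_rev]
    filter_upwards [hpb', e.open_source.mem_nhds hps,
      hc.eventually (lt_mem_nhds (show r ^ 2 / 2 < ‖e p - c‖ ^ 2 / 1 ^ 2 by
        rw [one_pow, div_one]; nlinarith)),
      hc.eventually (gt_mem_nhds (show ‖e p - c‖ ^ 2 / 1 ^ 2 < 1 / 2 by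
        rw [one_pow, div_one]; nlinarith [norm_nonneg (e p - c)]))] with y h1 h2 h3 h4
    exact ((hpos y h2 h3.le h4.le).add ((hV.const_mul hK).nonneg y h1)).mono (by simp)

/-- Strict points together with the disc form an open and closed set, hence everything. By
compactness a finite sum of the local functions is uniformly strict off the disc: every summand is
subharmonic there, so none spoils the gain of another. A globally subharmonic function on a compact
surface is constant, which is why a disc has to be excluded. -/
theorem exists_subharmonicOff [CompactSpace X] [ConnectedSpace X] {J : Finset X} {C : ℝ}
    (hC : TransitionBound J C) {b : X} (hb : b ∈ J)
    (hcov : ∀ p : X, ∃ j ∈ J, p ∈ (discChart j).source ∧ ‖discChart j p‖ < 1 / 2) :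
    ∃ V, SubharmonicOff J b V ∧ ∀ p ∉ chartDisc (discChart b) 1, JetGE J V p 1 := by
  have hB := isDiscChart_discChart b
  set B := chartDisc (discChart b) 1
  have hBc : IsClosed B := hB.isClosed_chartDisc (by norm_num)
  set G := {q | IsStrictPt J b q}
  have hGo : IsOpen G := by
    rw [isOpen_iff_mem_nhds]
    rintro p ⟨V, hV, τ, hτ, h⟩
    filter_upwards [eventually_eventually_nhds.2 h] with q hq using ⟨V, hV, τ, hτ, hq⟩
  have hclopen : IsClopen (G ∪ B) := by
    constructor
    · refine isClosed_of_closure_subset ?_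
      rw [closure_union, hBc.closure_eq]
      rintro p (hp | hp)
      · by_cases hpB : p ∈ B
        · exact Or.inr hpB
        · exact Or.inl (isStrictPt_of_mem_closure hC hcov hp hpB)
      · exact Or.inr hp
    · rw [isOpen_iff_mem_nhds]
      rintro p (hp | hp)
      · exact mem_of_superset (hGo.mem_nhds hp) subset_union_left
      · rcases hp.2.lt_or_eq with h | h
        · have hc : ContinuousAt (fun q => ‖discChart b q‖) p := ((discChart b).continuousAt hp.1).norm
          filter_upwards [(discChart b).open_source.mem_nhds hp.1, hc.eventually (gt_mem_nhds h)]
            with q h1 h2 using Or.inr ⟨h1, h2.le⟩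
        · exact mem_of_superset (hGo.mem_nhds (isStrictPt_sphere hC hb hp.1 h)) subset_union_left
  have huniv : G ∪ B = univ := (isClopen_iff.1 hclopen).resolve_left fun h => by
    have : b ∈ G ∪ B := Or.inr ⟨hB.mem, by rw [hB.map_eq]; simp⟩
    rw [h] at this; exact this
  set B' := {p | p ∈ (discChart b).source ∧ ‖discChart b p‖ < 1}
  have hB'o : IsOpen B' := by
    rw [isOpen_iff_mem_nhds]
    rintro p ⟨hp, h⟩
    have hc : ContinuousAt (fun q => ‖discChart b q‖) p := ((discChart b).continuousAt hp).norm
    filter_upwards [(discChart b).open_source.mem_nhds hp, hc.eventually (gt_mem_nhds h)]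
      with q h1 h2 using ⟨h1, h2⟩
  have hK : IsCompact B'ᶜ := hB'o.isClosed_compl.isCompact
  have hKG : B'ᶜ ⊆ G := by
    intro p hp
    rcases (huniv ▸ mem_univ p : p ∈ G ∪ B) with h | h
    · exact h
    · rcases h.2.lt_or_eq with h' | h'
      · exact absurd ⟨h.1, h'⟩ hp
      · exact isStrictPt_sphere hC hb h.1 h'
  obtain ⟨V, hV, τ, hτ, h⟩ : ∃ V, SubharmonicOff J b V ∧ ∃ τ > 0, ∀ p ∈ B'ᶜ, p ∉ B → JetGE J V p τ := by
    refine hK.induction_on (p := fun s => ∃ V, SubharmonicOff J b V ∧ ∃ τ > 0, ∀ p ∈ s, p ∉ B → JetGE J V p τ) ?_ ?_ ?_ ?_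
    · have h2 : ‖(0 : ℂ)‖ + 2 ≤ 3 := by norm_num
      obtain ⟨V, hV⟩ : ∃ V, SubharmonicOff J b V := by
        refine ⟨fun _ => 0, continuous_const, ⟨0, le_rfl, fun p j _ _ => ?_⟩, fun p _ j _ _ => ?_⟩
        · simpa using LowerJet.of_nonneg (u := fun _ => 0) rfl fun _ => le_rfl
        · exact LowerJet.of_nonneg (u := fun _ => 0) rfl fun _ => le_rfl
      exact ⟨V, hV, 1, one_pos, by simp⟩
    · rintro s t hst ⟨V, hV, τ, hτ, h⟩
      exact ⟨V, hV, τ, hτ, fun p hp => h p (hst hp)⟩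
    · rintro s t ⟨V, hV, τ, hτ, h⟩ ⟨V', hV', τ', hτ', h'⟩
      refine ⟨_, hV.add hV', min τ τ', lt_min hτ hτ', fun p hp hpB => ?_⟩
      rcases hp with hp | hp
      · exact ((h p hp hpB).add (hV'.nonneg p hpB)).mono (by simp)
      · exact ((hV.nonneg p hpB).add (h' p hp hpB)).mono (by simp)
    · intro p hp
      obtain ⟨V, hV, τ, hτ, h⟩ := hKG hp
      exact ⟨_, mem_nhdsWithin_of_mem_nhds h, V, hV, τ, hτ, fun q hq _ => hq⟩
  -- Rescaling normalizes the lower bound of the Laplacian to `1`.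
  refine ⟨_, hV.const_mul (inv_pos.2 hτ), fun p hp => ?_⟩
  have := (h p (fun h' => hp ⟨h'.1, h'.2.le⟩) hp).const_mul (inv_pos.2 hτ)
  rwa [inv_mul_cancel₀ hτ.ne'] at this

end IslandMaps

/-! ### Ahlfors' lemma and a Picard-type theorem -/

namespace IslandMaps

variable {X : Type*} [TopologicalSpace X] [ChartedSpace ℂ X] [IsManifold 𝓘(ℂ) 1 X] [T2Space X]

open Classical in
/-- The reciprocal distance to `a` in the chart `e`, cut off at distance `2`. -/
noncomputable def poleWeight (e : OpenPartialHomeomorph X ℂ) (a : ℂ) (p : X) : ℝ :=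
  if p ∈ e.source ∧ ‖e p - a‖ < 2 then 1 / ‖e p - a‖ else 0

theorem poleWeight_nonneg (e : OpenPartialHomeomorph X ℂ) (a : ℂ) (p : X) : 0 ≤ poleWeight e a p := by
  unfold poleWeight; split_ifs
  exacts [by positivity, le_rfl]

theorem chartExt_poleFun_eq_zero {e : OpenPartialHomeomorph X ℂ} {a : ℂ} {p : X}
    (h : ¬ (p ∈ e.source ∧ ‖e p - a‖ < 2)) : chartExt e (poleFun a) p = 0 := by
  by_cases hp : p ∈ e.source
  · rw [chartExt_of_mem hp, poleFun_of_ge]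
    exact le_of_not_gt fun h' => h ⟨hp, h'⟩
  · exact chartExt_of_notMem hp

/-- The points of `A` are separated, so at most one factor of the product is large at a given point.
That factor is bounded by twice the weight of its pole and the others are bounded uniformly. Thus
the product has only first-order poles and is dominated by a sum. -/
theorem exists_prod_exp_poleFun_le (e : OpenPartialHomeomorph X ℂ) (A : Finset ℂ) :
    ∃ Q : ℝ, 0 < Q ∧ ∀ p : X, (∀ a ∈ A, p ∈ e.source → e p ≠ a) →
      Real.exp (2 * ∑ a ∈ A, chartExt e (poleFun a) p) ≤ Q * (1 + ∑ a ∈ A, poleWeight e a p) := by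
  classical
  obtain ⟨M, hM⟩ := (A.offDiag.image fun q => 1 / ‖q.1 - q.2‖).exists_le
  set M' := max M 1
  have hM' : 1 ≤ M' := le_max_right _ _
  have hsep : ∀ a ∈ A, ∀ a' ∈ A, a ≠ a' → 1 / M' ≤ ‖a - a'‖ := by
    intro a ha a' ha' hne
    have h1 := hM _ (Finset.mem_image_of_mem _ (Finset.mem_offDiag.2 ⟨ha, ha', hne⟩ : (a, a') ∈ A.offDiag))
    have h2 : 0 < ‖a - a'‖ := norm_pos_iff.2 (sub_ne_zero.2 hne)
    rw [one_div_le (by positivity) h2]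
    exact h1.trans (le_max_left _ _)
  set Q := 4 * M'
  have hQ1 : 1 ≤ Q := by simp only [Q]; linarith
  have hQ0 : 0 < Q := by linarith
  refine ⟨2 * Q ^ A.card, by positivity, fun p hp => ?_⟩
  have hfar : ∀ a ∈ A, (p ∈ e.source → 1 / (2 * M') ≤ ‖e p - a‖) →
      Real.exp (2 * chartExt e (poleFun a) p) ≤ Q := by
    intro a ha h
    by_cases hin : p ∈ e.source ∧ ‖e p - a‖ < 2
    · rw [chartExt_of_mem hin.1]
      refine (exp_two_mul_poleFun_le hin.2 (hp a ha hin.1)).trans ?_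
      have h1 := h hin.1
      have h2 : 0 < ‖e p - a‖ := lt_of_lt_of_le (by positivity) h1
      rw [div_le_iff₀ h2]
      rw [div_le_iff₀ (by positivity)] at h1
      simp only [Q]; linarith
    · rw [chartExt_poleFun_eq_zero hin]; simpa using hQ1
  have hS : 0 ≤ ∑ a ∈ A, poleWeight e a p := Finset.sum_nonneg fun a _ => poleWeight_nonneg e a p
  rw [Finset.mul_sum, Real.exp_sum]
  by_cases hnear : ∃ a ∈ A, p ∈ e.source ∧ ‖e p - a‖ < 1 / (2 * M')
  · obtain ⟨a, ha, hps, hpa⟩ := hnear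
    have hlt : ‖e p - a‖ < 2 := hpa.trans_le (by
      rw [div_le_iff₀ (by positivity)]; linarith)
    rw [← Finset.mul_prod_erase A _ ha]
    have h1 : ∏ x ∈ A.erase a, Real.exp (2 * chartExt e (poleFun x) p) ≤ Q ^ A.card := by
      calc ∏ x ∈ A.erase a, Real.exp (2 * chartExt e (poleFun x) p) ≤ ∏ x ∈ A.erase a, Q := by
            refine Finset.prod_le_prod (fun _ _ => (Real.exp_pos _).le) fun x hx => ?_
            obtain ⟨hxa, hxA⟩ := Finset.mem_erase.1 hx
            refine hfar x hxA fun _ => ?_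
            have h2 := hsep x hxA a ha hxa
            have h3 : ‖x - a‖ ≤ ‖e p - x‖ + ‖e p - a‖ := by
              rw [← norm_neg (e p - x)]
              exact le_trans (le_of_eq (by congr 1; ring)) (norm_add_le _ _)
            have h4 : 1 / M' = 1 / (2 * M') + 1 / (2 * M') := by field_simp; norm_num
            linarith
        _ = Q ^ (A.erase a).card := by rw [Finset.prod_const]
        _ ≤ Q ^ A.card := pow_le_pow_right₀ hQ1 (Finset.card_le_card (Finset.erase_subset a A))
    have h2 : Real.exp (2 * chartExt e (poleFun a) p) ≤ 2 * poleWeight e a p := by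
      rw [chartExt_of_mem hps, poleWeight, if_pos ⟨hps, hlt⟩, mul_one_div]
      exact exp_two_mul_poleFun_le hlt (hp a ha hps)
    have h3 : poleWeight e a p ≤ ∑ a ∈ A, poleWeight e a p :=
      Finset.single_le_sum (fun a _ => poleWeight_nonneg e a p) ha
    calc _ ≤ (2 * poleWeight e a p) * Q ^ A.card := by
          gcongr
          exact mul_nonneg two_pos.le (poleWeight_nonneg e a p)
      _ ≤ (2 * (1 + ∑ a ∈ A, poleWeight e a p)) * Q ^ A.card := by gcongr; linarith
      _ = _ := by ring
  · push Not at hnear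
    calc ∏ x ∈ A, Real.exp (2 * chartExt e (poleFun x) p) ≤ ∏ x ∈ A, Q :=
          Finset.prod_le_prod (fun _ _ => (Real.exp_pos _).le) fun x hx => hfar x hx (hnear x hx)
      _ = Q ^ A.card := by rw [Finset.prod_const]
      _ ≤ _ := by
        have : 0 < Q ^ A.card := by positivity
        nlinarith

/-- Off the disc about `b`, the term `L * V` supplies the constant `K` and one unit more. Inside it,
`V` may have negative Laplacian, and there it is the number of poles that pays: each contributes at
least `c / 2`. Half of the contribution of the poles is kept to absorb `ε * exp (2 v)`. -/
theorem exists_weight [CompactSpace X] [ConnectedSpace X] {J : Finset X} {C : ℝ}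
    (hC : TransitionBound J C) {b : X} (hb : b ∈ J)
    (hcov : ∀ p : X, ∃ j ∈ J, p ∈ (discChart j).source ∧ ‖discChart j p‖ < 1 / 2)
    {K : ℝ} (hK : 0 ≤ K) :
    ∃ m : ℕ, ∀ A : Finset ℂ, (∀ a ∈ A, ‖a‖ < 1) → m ≤ A.card →
      ∃ v : X → ℝ, ∃ ε > 0, ∀ p, (∀ a ∈ A, p ∈ (discChart b).source → discChart b p ≠ a) →
        ContinuousAt v p ∧ JetGE J v p (K + ε * Real.exp (2 * v p)) := by
  obtain ⟨V, hV, hV1⟩ := exists_subharmonicOff hC hb hcov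
  obtain ⟨D, hD, hVD⟩ := hV.lower
  have hC0 : 0 < C := zero_lt_one.trans_le hC.one_le
  set e := discChart b
  set L := K + 1
  have hL : 0 < L := by positivity
  set c := 1 / (4 * C ^ 2)
  have hc : 0 < c := by positivity
  -- In the disc the poles contribute in total at least `c * m / 2`. Half of this has to cover the
  -- deficit `L * D`, the constant `K`, and the unit used in bounding `ε * exp (2 v)`.
  obtain ⟨m, hm⟩ := exists_nat_ge (4 * (L * D + K + 1) / c)
  refine ⟨m, fun A hA hmA => ?_⟩
  obtain ⟨Q, hQ, hprod⟩ := exists_prod_exp_poleFun_le e A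
  obtain ⟨N, hN⟩ := isCompact_univ.exists_bound_of_continuousOn hV.cont.continuousOn
  set S : X → ℝ := fun p => ∑ a ∈ A, poleWeight e a p
  have hS : ∀ p, 0 ≤ S p := fun p => Finset.sum_nonneg fun a _ => poleWeight_nonneg e a p
  set ε := min 1 (c / 2) / (Q * Real.exp (2 * (L * N)))
  have hε : 0 < ε := by positivity
  refine ⟨fun p => ∑ a ∈ A, chartExt e (poleFun a) p + L * V p, ε, hε, fun p hp => ⟨?_, ?_⟩⟩
  · refine ContinuousAt.add (tendsto_finsetSum _ fun a ha => ?_)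
      (continuousAt_const.mul hV.cont.continuousAt)
    refine continuousAt_chartExt (isDiscChart_discChart b) (fun z hz => poleFun_of_ge ?_)
      fun hps => continuousAt_poleFun (hp a ha hps)
    have h1 := norm_sub_norm_le z a
    have h2 := hA a ha
    linarith
  · have hpole : JetGE J (fun p => ∑ a ∈ A, chartExt e (poleFun a) p) p (∑ a ∈ A, c * poleWeight e a p) := by
      refine JetGE.sum fun a ha => ?_
      by_cases hin : p ∈ e.source ∧ ‖e p - a‖ < 2
      · have h3 : p ∈ chartDisc e 3 := by
          refine ⟨hin.1, ?_⟩
          have h1 := norm_sub_norm_le (e p) a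
          have h2 := hA a ha
          linarith
        have h4 := (jetGE_chartExt hC.one_le hC.bound hb h3 (lowerJet_poleFun hin.2 (hp a ha hin.1))).1
          (by positivity)
        refine h4.mono (le_of_eq ?_)
        rw [poleWeight, if_pos hin]
        simp only [c]
        field_simp
        rfl
      · refine (jetGE_chartExt_of_eq_zero (poleFun_nonneg a) (chartExt_poleFun_eq_zero hin)).mono ?_
        rw [poleWeight, if_neg hin, mul_zero]
    rw [← Finset.mul_sum] at hpole
    have hexp : ε * Real.exp (2 * (∑ a ∈ A, chartExt e (poleFun a) p + L * V p)) ≤ 1 + c / 2 * S p := by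
      rw [mul_add, Real.exp_add]
      have h1 := hprod p hp
      have h2 : Real.exp (2 * (L * V p)) ≤ Real.exp (2 * (L * N)) := by
        rw [Real.exp_le_exp]
        have := (le_abs_self _).trans (hN p (mem_univ p))
        gcongr
      have h3 : 0 ≤ Q * (1 + S p) := mul_nonneg hQ.le (by linarith [hS p])
      calc _ ≤ ε * ((Q * (1 + S p)) * Real.exp (2 * (L * N))) := by gcongr
        _ = min 1 (c / 2) * (1 + S p) := by simp only [ε]; field_simp
        _ = min 1 (c / 2) + min 1 (c / 2) * S p := by ring
        _ ≤ 1 + c / 2 * S p := by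
          have := hS p
          gcongr
          exacts [min_le_left _ _, min_le_right _ _]
    by_cases hpB : p ∈ chartDisc e 1
    · refine (hpole.add ((hVD p).const_mul hL)).mono ?_
      have h5 : (A.card : ℝ) / 2 ≤ S p := by
        have : ∀ a ∈ A, (1 / 2 : ℝ) ≤ poleWeight e a p := by
          intro a ha
          have h1 := hA a ha
          have h2 := norm_sub_le (e p) a
          have h3 := hpB.2
          have h6 : 0 < ‖e p - a‖ := norm_pos_iff.2 (sub_ne_zero.2 (hp a ha hpB.1))
          rw [poleWeight, if_pos ⟨hpB.1, by linarith⟩]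
          exact one_div_le_one_div_of_le h6 (by linarith)
        have := Finset.card_nsmul_le_sum A _ _ this
        rw [nsmul_eq_mul] at this
        simp only [S]; linarith
      have h6 : 4 * (L * D + K + 1) ≤ c * A.card := by
        rw [div_le_iff₀ hc] at hm
        have : (m : ℝ) ≤ A.card := by exact_mod_cast hmA
        nlinarith
      have h7 : c * S p = ∑ a ∈ A, poleWeight e a p * c := by rw [mul_comm, Finset.sum_mul]
      have h8 : c * ∑ a ∈ A, poleWeight e a p = c * S p := rfl
      nlinarith
    · refine (hpole.add ((hV1 p hpB).const_mul hL)).mono ?_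
      have h8 : c * ∑ a ∈ A, poleWeight e a p = c * S p := rfl
      have h9 : 0 ≤ c / 2 * S p := mul_nonneg (by positivity) (hS p)
      have : L = K + 1 := rfl
      linarith

theorem lowerJet_log_bump {R : ℝ} {z : ℂ} (hz : ‖z‖ < R) :
    LowerJet (fun y => Real.log (R ^ 2 - ‖y‖ ^ 2)) z (-(4 * R ^ 2 / (R ^ 2 - ‖z‖ ^ 2) ^ 2)) := by
  have hR : 0 < R := (norm_nonneg z).trans_lt hz
  have hs : ‖z‖ ^ 2 < R ^ 2 := by gcongr
  have h0 : R ^ 2 - ‖z‖ ^ 2 ≠ 0 := by linarith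
  have hd : ∀ x : ℝ, HasDerivAt (fun x : ℝ => R ^ 2 - x) (-1) x := fun x => (hasDerivAt_id' x).const_sub _
  have h1 := lowerJet_radial (z := z) (f := fun x => Real.log (R ^ 2 - x))
    (f' := fun x => (-1) / (R ^ 2 - x)) (f₂ := -(1 / (R ^ 2 - ‖z‖ ^ 2) ^ 2)) ?_ ?_
  · refine h1.mono (le_of_eq ?_)
    field_simp
    ring
  · filter_upwards [gt_mem_nhds hs] with x hx
    exact (hd x).log (by linarith)
  · refine ((hasDerivAt_const (‖z‖ ^ 2) (-1 : ℝ)).fun_div (hd _) h0).congr_deriv ?_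
    ring

section Ahlfors

variable {J : Finset X} {C : ℝ} {h : ℂ → X} {v : X → ℝ} {ε : ℝ}

/-- The function to be maximized in the proof of Ahlfors' lemma. -/
noncomputable def ahlforsFun (h : ℂ → X) (v : X → ℝ) (R : ℝ) (j : X) (z : ℂ) : ℝ :=
  Real.exp (v (h z)) * chartExt (discChart j) (bump 0 1 1) (h z) *
    ‖deriv (fun y => discChart j (h y)) z‖ * (R ^ 2 - ‖z‖ ^ 2)

theorem analyticAt_chart_comp {e : OpenPartialHomeomorph X ℂ} (he : e.MDifferentiable 𝓘(ℂ) 𝓘(ℂ))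
    {h : ℂ → X} {z : ℂ} (hh : ∀ᶠ y in 𝓝 z, MDifferentiableAt 𝓘(ℂ) 𝓘(ℂ) h y) (hz : h z ∈ e.source) :
    AnalyticAt ℂ (fun y => e (h y)) z := by
  rw [Complex.analyticAt_iff_eventually_differentiableAt]
  filter_upwards [hh, hh.self_of_nhds.continuousAt.eventually (e.open_source.mem_nhds hz)] with y h1 h2
  exact differentiableAt_chart_comp he h1 h2

theorem bump_one_eq (z : ℂ) : bump 0 1 1 z = max 0 (1 - ‖z‖ ^ 2) := by simp [bump]

theorem continuous_ahlforsFun (hh : MDifferentiable 𝓘(ℂ) 𝓘(ℂ) h) (hv : ∀ z, ContinuousAt v (h z))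
    (R : ℝ) (j : X) : Continuous (ahlforsFun h v R j) := by
  have hj := isDiscChart_discChart j
  refine continuous_iff_continuousAt.2 fun z => ?_
  have hc : ContinuousAt h z := (hh z).continuousAt
  by_cases hz : h z ∈ (discChart j).source
  · have h1 := (analyticAt_chart_comp hj.mdiff (Eventually.of_forall hh) hz).deriv.continuousAt
    have h2 : ContinuousAt (fun z => v (h z)) z := (hv z).comp hc
    have h3 : ContinuousAt (fun z => chartExt (discChart j) (bump 0 1 1) (h z)) z :=
      (continuous_chartExt_bump one_pos (by norm_num) one_ne_zero).continuousAt.comp hc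
    unfold ahlforsFun
    fun_prop
  · have h1 : h z ∈ (chartDisc (discChart j) 1)ᶜ := fun h' => hz h'.1
    refine (continuousAt_const (y := (0 : ℝ))).congr ?_
    filter_upwards [hc.eventually ((hj.isClosed_chartDisc (by norm_num)).isOpen_compl.mem_nhds h1)] with y hy
    have : chartExt (discChart j) (bump 0 1 1) (h y) = 0 :=
      chartExt_bump_eq_zero one_pos one_ne_zero fun hs => by
        rw [sub_zero]
        exact le_of_not_gt fun h' => hy ⟨hs, h'.le⟩
    simp [ahlforsFun, this]

theorem ahlforsFun_nonneg {R : ℝ} {j : X} {z : ℂ} (hz : ‖z‖ ≤ R) : 0 ≤ ahlforsFun h v R j z := by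
  unfold ahlforsFun
  have h1 : ‖z‖ ^ 2 ≤ R ^ 2 := by gcongr
  have h2 := chartExt_nonneg (e := discChart j) (bump_nonneg 0 1 1) (h z)
  have h3 : 0 ≤ R ^ 2 - ‖z‖ ^ 2 := by linarith
  positivity

/-- At an interior maximum the logarithm of the function has nonpositive Laplacian. The gain `8 C²`
in the weight cancels the loss from the cutoff, `log ‖deriv W‖` is harmonic, and what remains
compares `ε exp (2v) ‖deriv W‖²` with `4 R² / (R² - ‖z‖²)²`. Maximizing over all charts of `J` keeps
the maximum away from the edge of its chart, where the cutoff would be useless. -/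
theorem ahlforsFun_sq_le (hC : TransitionBound J C)
    (hcov : ∀ p : X, ∃ j ∈ J, p ∈ (discChart j).source ∧ ‖discChart j p‖ < 1 / 2)
    (hh : MDifferentiable 𝓘(ℂ) 𝓘(ℂ) h) (hε : 0 < ε) (hv : ∀ z, ContinuousAt v (h z) ∧
      JetGE J v (h z) (8 * C ^ 2 + ε * Real.exp (2 * v (h z)))) {R : ℝ} {j : X} (hj : j ∈ J) {z : ℂ}
    (hzR : ‖z‖ < R) (hmax : ∀ k ∈ J, ∀ y, ‖y‖ ≤ R → ahlforsFun h v R k y ≤ ahlforsFun h v R j z)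
    (hpos : 0 < ahlforsFun h v R j z) : (ahlforsFun h v R j z) ^ 2 ≤ 4 * R ^ 2 / ε := by
  have hC0 : 0 < C := zero_lt_one.trans_le hC.one_le
  have hj' := isDiscChart_discChart j
  set e := discChart j with he
  have hs : ‖z‖ ^ 2 < R ^ 2 := by gcongr
  have hsp : 0 < R ^ 2 - ‖z‖ ^ 2 := by linarith
  have hβ0 : chartExt e (bump 0 1 1) (h z) ≠ 0 := fun h0 => by
    simp [ahlforsFun, ← he, h0] at hpos
  have hsrc : h z ∈ e.source := by
    by_contra hcon; exact hβ0 (chartExt_of_notMem hcon)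
  have hw1 : ‖e (h z)‖ < 1 := by
    by_contra! hcon
    exact hβ0 (chartExt_bump_eq_zero one_pos one_ne_zero fun _ => by simpa using hcon)
  have hβ : chartExt e (bump 0 1 1) (h z) = 1 - ‖e (h z)‖ ^ 2 := by
    rw [chartExt_of_mem hsrc, bump_one_eq, max_eq_right]
    nlinarith [norm_nonneg (e (h z))]
  set W : ℂ → ℂ := fun y => e (h y)
  have hWan : AnalyticAt ℂ W z := analyticAt_chart_comp hj'.mdiff (Eventually.of_forall hh) hsrc
  have hβpos : 0 < 1 - ‖W z‖ ^ 2 := by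
    simp only [W]; nlinarith [norm_nonneg (e (h z))]
  have hd0 : deriv W z ≠ 0 := fun h0 => by
    simp only [ahlforsFun, ← he] at hpos
    change 0 < _ * _ * ‖deriv W z‖ * _ at hpos
    simp [h0] at hpos
  -- the chart realizing the maximum is not close to its boundary
  have hκ : 3 / (4 * C) ≤ 1 - ‖W z‖ ^ 2 := by
    obtain ⟨k, hk, hks, hk2⟩ := hcov (h z)
    have h1 := hmax k hk z hzR.le
    simp only [ahlforsFun, ← he, hβ] at h1
    change _ ≤ Real.exp (v (h z)) * (1 - ‖W z‖ ^ 2) * ‖deriv W z‖ * _ at h1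
    rw [mul_le_mul_iff_left₀ hsp, mul_assoc, mul_assoc, mul_le_mul_iff_right₀ (Real.exp_pos _)] at h1
    have h2 : 3 / 4 ≤ chartExt (discChart k) (bump 0 1 1) (h z) := by
      rw [chartExt_of_mem hks, bump_one_eq]
      refine le_max_of_le_right ?_
      nlinarith [norm_nonneg (discChart k (h z))]
    have h3 := deriv_chart_comp (isDiscChart_discChart k).mdiff hj'.mdiff (hh z) hks hsrc
    have h4 := hC.bound k hk j hj (h z) ⟨hks, hk2.le.trans (by norm_num)⟩ ⟨hsrc, hw1.le.trans (by norm_num)⟩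
    have h5 : ‖deriv W z‖ ≤ C * ‖deriv (fun y => discChart k (h y)) z‖ := by
      change ‖deriv (fun y => e (h y)) z‖ ≤ _
      rw [h3, norm_mul]; gcongr
    have h6 : 0 < ‖deriv W z‖ := norm_pos_iff.2 hd0
    have h7 : 3 / 4 * ‖deriv (fun y => discChart k (h y)) z‖ ≤ (1 - ‖W z‖ ^ 2) * ‖deriv W z‖ :=
      le_trans (by gcongr) h1
    rw [div_le_iff₀ (by positivity)]
    have h8 : 3 / 4 * ‖deriv W z‖ ≤ C * (1 - ‖W z‖ ^ 2) * ‖deriv W z‖ := by nlinarith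
    have h9 := le_of_mul_le_mul_right h8 h6
    linarith
  have hjet1 : LowerJet (fun y => v (h y)) z
      ((8 * C ^ 2 + ε * Real.exp (2 * v (h z))) * ‖deriv W z‖ ^ 2) := by
    have h1 : LowerJet (fun y => v (e.symm y)) (W z) _ := (hv z).2 j hj ⟨hsrc, hw1.le⟩
    refine (h1.comp hWan).congr ?_
    filter_upwards [(hh z).continuousAt.eventually (e.open_source.mem_nhds hsrc)] with y hy
    simp [W, e.left_inv hy]
  -- Since `1 - ‖W z‖² ≥ 3 / (4 C)`, the loss `4 / (1 - ‖W z‖²)²` is at most `64 C² / 9`, which is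
  -- below `8 C²`.
  have hjet2 : LowerJet (fun y => Real.log (1 ^ 2 - ‖W y‖ ^ 2)) z (-(8 * C ^ 2) * ‖deriv W z‖ ^ 2) := by
    have h1 : LowerJet (fun y => Real.log (1 ^ 2 - ‖y‖ ^ 2)) (W z) _ := lowerJet_log_bump hw1
    refine (h1.mono ?_).comp hWan
    rw [one_pow, neg_le_neg_iff, div_le_iff₀ (by positivity)]
    have h2 : (3 / (4 * C)) ^ 2 ≤ (1 - ‖W z‖ ^ 2) ^ 2 := by gcongr
    have h3 : C ^ 2 * (3 / (4 * C)) ^ 2 = 9 / 16 := by field_simp; norm_num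
    nlinarith [sq_nonneg C]
  have hjet := ((hjet1.add hjet2).add (lowerJet_log_norm hWan.deriv hd0)).add (lowerJet_log_bump hzR)
  have hloc : IsLocalMax (fun y => v (h y) + Real.log (1 ^ 2 - ‖W y‖ ^ 2) + Real.log ‖deriv W y‖ +
      Real.log (R ^ 2 - ‖y‖ ^ 2)) z := by
    have hcW : ContinuousAt (fun y => 1 - ‖W y‖ ^ 2) z := (hWan.continuousAt.norm.pow 2).const_sub 1
    have hcR : ContinuousAt (fun y : ℂ => ‖y‖) z := continuous_norm.continuousAt
    have hformula : ∀ y, h y ∈ e.source → 0 < 1 - ‖W y‖ ^ 2 → deriv W y ≠ 0 → ‖y‖ < R →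
        Real.log (ahlforsFun h v R j y) = v (h y) + Real.log (1 ^ 2 - ‖W y‖ ^ 2) + Real.log ‖deriv W y‖ +
          Real.log (R ^ 2 - ‖y‖ ^ 2) ∧ 0 < ahlforsFun h v R j y := by
      intro y h1 h2 h3 h4
      have h5 : chartExt e (bump 0 1 1) (h y) = 1 - ‖W y‖ ^ 2 := by
        rw [chartExt_of_mem h1, bump_one_eq, max_eq_right h2.le]
      have h6 : ‖y‖ ^ 2 < R ^ 2 := by gcongr
      have h7 : R ^ 2 - ‖y‖ ^ 2 ≠ 0 := by linarith
      have h8 := norm_pos_iff.2 h3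
      have h9 : ahlforsFun h v R j y = Real.exp (v (h y)) * (1 - ‖W y‖ ^ 2) * ‖deriv W y‖ * (R ^ 2 - ‖y‖ ^ 2) := by
        simp only [ahlforsFun, ← he, h5, W]
      have h10 : 0 < R ^ 2 - ‖y‖ ^ 2 := by linarith
      refine ⟨?_, by rw [h9]; positivity⟩
      rw [h9, Real.log_mul (by positivity) h7, Real.log_mul (by positivity) h8.ne',
        Real.log_mul (Real.exp_pos _).ne' h2.ne', Real.log_exp, one_pow]
    filter_upwards [(hh z).continuousAt.eventually (e.open_source.mem_nhds hsrc),
      hcW.eventually (lt_mem_nhds hβpos), hWan.deriv.continuousAt.eventually_ne hd0,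
      hcR.eventually (gt_mem_nhds hzR)] with y h1 h2 h3 h4
    obtain ⟨h5, h6⟩ := hformula y h1 h2 h3 h4
    rw [← h5, ← (hformula z hsrc hβpos hd0 hzR).1]
    exact Real.log_le_log h6 (hmax j hj y h4.le)
  have hfin := hjet.nonpos_of_isLocalMax hloc
  have hval : ahlforsFun h v R j z = Real.exp (v (h z)) * (1 - ‖W z‖ ^ 2) * ‖deriv W z‖ * (R ^ 2 - ‖z‖ ^ 2) := by
    simp only [ahlforsFun, ← he, hβ, W]
  have hsq : (Real.exp (v (h z))) ^ 2 = Real.exp (2 * v (h z)) := by rw [← Real.exp_nat_mul]; norm_num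
  rw [hval, le_div_iff₀ hε]
  have h1 : ε * Real.exp (2 * v (h z)) * ‖deriv W z‖ ^ 2 * (R ^ 2 - ‖z‖ ^ 2) ^ 2 ≤ 4 * R ^ 2 := by
    rw [← le_div_iff₀ (by positivity)]; linarith
  have h2 : (1 - ‖W z‖ ^ 2) ^ 2 ≤ 1 := pow_le_one₀ hβpos.le (by nlinarith [norm_nonneg (W z)])
  calc (Real.exp (v (h z)) * (1 - ‖W z‖ ^ 2) * ‖deriv W z‖ * (R ^ 2 - ‖z‖ ^ 2)) ^ 2 * ε
      = (ε * Real.exp (2 * v (h z)) * ‖deriv W z‖ ^ 2 * (R ^ 2 - ‖z‖ ^ 2) ^ 2) * (1 - ‖W z‖ ^ 2) ^ 2 := by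
        rw [← hsq]; ring
    _ ≤ (4 * R ^ 2) * 1 := by gcongr
    _ = 4 * R ^ 2 := by ring

/-- At the origin the maximized function equals `a R²`, while its maximum is at most a constant
times `R`. Letting `R → ∞` forces `a = 0`, and the other two factors of `a` are positive. -/
theorem deriv_eq_zero_of_weight (hC : TransitionBound J C)
    (hcov : ∀ p : X, ∃ j ∈ J, p ∈ (discChart j).source ∧ ‖discChart j p‖ < 1 / 2)
    (hh : MDifferentiable 𝓘(ℂ) 𝓘(ℂ) h) (hε : 0 < ε) (hv : ∀ z, ContinuousAt v (h z) ∧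
      JetGE J v (h z) (8 * C ^ 2 + ε * Real.exp (2 * v (h z)))) {j : X} (hj : j ∈ J)
    (hs : h 0 ∈ (discChart j).source) (h1 : ‖discChart j (h 0)‖ < 1) :
    deriv (fun y => discChart j (h y)) 0 = 0 := by
  set a := Real.exp (v (h 0)) * chartExt (discChart j) (bump 0 1 1) (h 0) *
    ‖deriv (fun y => discChart j (h y)) 0‖
  have hβ : 0 < chartExt (discChart j) (bump 0 1 1) (h 0) := by
    rw [chartExt_of_mem hs, bump_one_eq]
    refine lt_max_of_lt_right ?_
    nlinarith [norm_nonneg (discChart j (h 0))]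
  have ha : 0 ≤ a := by positivity
  have hbound : ∀ R : ℝ, 0 < R → (a * R ^ 2) ^ 2 ≤ 4 * R ^ 2 / ε := by
    intro R hR
    have hmx : ∀ k : X, ∃ z, ‖z‖ ≤ R ∧ ∀ y, ‖y‖ ≤ R → ahlforsFun h v R k y ≤ ahlforsFun h v R k z := by
      intro k
      obtain ⟨z, hz, hzm⟩ := (isCompact_closedBall (0 : ℂ) R).exists_isMaxOn
        (Metric.nonempty_closedBall.2 hR.le) (continuous_ahlforsFun hh (fun z => (hv z).1) R k).continuousOn
      exact ⟨z, by simpa using hz, fun y hy => hzm (by simpa using hy)⟩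
    choose z hzR hzm using hmx
    obtain ⟨k, hk, hkm⟩ := J.exists_max_image (fun k => ahlforsFun h v R k (z k)) ⟨j, hj⟩
    have hmax : ∀ i ∈ J, ∀ y, ‖y‖ ≤ R → ahlforsFun h v R i y ≤ ahlforsFun h v R k (z k) :=
      fun i hi y hy => (hzm i y hy).trans (hkm i hi)
    have h0 : ahlforsFun h v R j 0 = a * R ^ 2 := by simp [ahlforsFun, a]
    have hle : a * R ^ 2 ≤ ahlforsFun h v R k (z k) := h0 ▸ hmax j hj 0 (by simpa using hR.le)
    rcases (ahlforsFun_nonneg (h := h) (v := v) (j := k) (hzR k)).eq_or_lt with h2 | h2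
    · have h5 : a * R ^ 2 = 0 := le_antisymm (h2 ▸ hle) (mul_nonneg ha (sq_nonneg R))
      rw [h5, zero_pow two_ne_zero]; positivity
    · have hlt : ‖z k‖ < R := by
        refine (hzR k).lt_of_ne fun heq => ?_
        simp [ahlforsFun, heq] at h2
      refine le_trans ?_ (ahlforsFun_sq_le hC hcov hh hε hv hk hlt hmax h2)
      gcongr
  have ha0 : a = 0 := by
    by_contra hne
    have hapos : 0 < a := lt_of_le_of_ne ha (Ne.symm hne)
    obtain ⟨R, hR⟩ := exists_gt (max 1 (4 / (ε * a ^ 2)))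
    have hR1 : 1 < R := (le_max_left _ _).trans_lt hR
    have hR2 : 4 / (ε * a ^ 2) < R := (le_max_right _ _).trans_lt hR
    have h3 := hbound R (by linarith)
    rw [div_lt_iff₀ (by positivity)] at hR2
    rw [le_div_iff₀ hε] at h3
    have h4 : R * (ε * a ^ 2) ≤ R ^ 2 * (ε * a ^ 2) := by
      have : 0 ≤ ε * a ^ 2 := by positivity
      nlinarith
    have h5 : R ^ 2 * (R ^ 2 * (ε * a ^ 2)) ≤ R ^ 2 * 4 := by linarith [show (a * R ^ 2) ^ 2 * ε = R ^ 2 * (R ^ 2 * (ε * a ^ 2)) by ring]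
    have h6 := le_of_mul_le_mul_left h5 (by positivity)
    linarith
  have h7 := mul_eq_zero.1 ha0
  rcases h7 with h7 | h7
  · exact absurd h7 (mul_pos (Real.exp_pos _) hβ).ne'
  · exact norm_eq_zero.1 h7

end Ahlfors

/-- A holomorphic map from the plane to a compact Riemann surface which omits infinitely many
values is constant. -/
theorem eq_of_infinite_omitted [CompactSpace X] [ConnectedSpace X] {h : ℂ → X}
    (hh : MDifferentiable 𝓘(ℂ) 𝓘(ℂ) h) (hinf : (range h)ᶜ.Infinite) (z w : ℂ) : h z = h w := by
  -- By compactness the omitted values accumulate at some `b`. All the poles the weight needs can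
  -- therefore be taken inside one coordinate disc about `b`.
  obtain ⟨b, -, hb⟩ := hinf.exists_accPt_of_subset_isCompact isCompact_univ (subset_univ _)
  obtain ⟨J, hbJ, hcov⟩ := exists_finset_discChart b
  obtain ⟨C, hC1, hCb⟩ := exists_bound_transition J
  have hC : TransitionBound J C := ⟨hC1, hCb⟩
  obtain ⟨m, hm⟩ := exists_weight hC hbJ hcov (K := 8 * C ^ 2) (by positivity)
  set e := discChart b
  have he : IsDiscChart e b := isDiscChart_discChart b
  set B := {p | p ∈ e.source ∧ ‖e p‖ < 1}
  have hB : B ∈ 𝓝 b := by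
    have hc : ContinuousAt (fun q => ‖e q‖) b := (e.continuousAt he.mem).norm
    filter_upwards [e.open_source.mem_nhds he.mem,
      hc.eventually (gt_mem_nhds (show ‖e b‖ < 1 by rw [he.map_eq]; simp))] with q h1 h2 using ⟨h1, h2⟩
  have hBinf : (B ∩ (range h)ᶜ).Infinite := by
    intro hfin
    have h1 : ((B ∩ (range h)ᶜ) \ {b})ᶜ ∈ 𝓝 b :=
      (hfin.subset sdiff_subset).isClosed.isOpen_compl.mem_nhds fun h' => h'.2 rfl
    have h2 := accPt_iff_frequently.1 hb
    obtain ⟨y, ⟨hy1, hy2⟩, hy3, hy4⟩ := (h2.and_eventually (inter_mem h1 hB)).exists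
    exact hy3 ⟨⟨hy4, hy2⟩, hy1⟩
  have hinj : InjOn e (B ∩ (range h)ᶜ) := e.injOn.mono fun p hp => hp.1.1
  obtain ⟨A, hA, hAm⟩ := (hBinf.image hinj).exists_subset_card_eq m
  have hA1 : ∀ a ∈ A, ‖a‖ < 1 := fun a ha => by
    obtain ⟨p, hp, rfl⟩ := hA ha
    exact hp.1.2
  obtain ⟨v, ε, hε, hv⟩ := hm A hA1 hAm.ge
  have hv' : ∀ z, ContinuousAt v (h z) ∧ JetGE J v (h z) (8 * C ^ 2 + ε * Real.exp (2 * v (h z))) := by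
    refine fun z => hv (h z) fun a ha hs heq => ?_
    obtain ⟨p, hp, hpa⟩ := hA ha
    have : p = h z := e.injOn hp.1.1 hs (hpa.trans heq.symm)
    exact hp.2 ⟨z, this.symm⟩
  have hder : ∀ z, ∀ j ∈ J, h z ∈ (discChart j).source → ‖discChart j (h z)‖ < 1 →
      deriv (fun y => discChart j (h y)) z = 0 := by
    intro z j hj hs h1
    have htr : MDifferentiable 𝓘(ℂ) 𝓘(ℂ) (fun y => h (y + z)) := fun y =>
      (hh (y + z)).comp y (by fun_prop : DifferentiableAt ℂ (fun y : ℂ => y + z) y).mdifferentiableAt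
    have := deriv_eq_zero_of_weight (h := fun y => h (y + z)) hC hcov htr hε (fun y => hv' (y + z)) hj
      (by simpa using hs) (by simpa using h1)
    rw [deriv_comp_add_const (fun y => discChart j (h y))] at this
    simpa using this
  have hlc : IsLocallyConstant h := by
    refine (IsLocallyConstant.iff_eventually_eq h).2 fun z => ?_
    obtain ⟨j, hj, hs, h2⟩ := hcov (h z)
    have hcont : ContinuousAt (fun y => ‖discChart j (h y)‖) z :=
      (((discChart j).continuousAt hs).comp (hh z).continuousAt).norm
    obtain ⟨r, hr, hball⟩ := Metric.eventually_nhds_iff_ball.1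
      (((hh z).continuousAt.eventually ((discChart j).open_source.mem_nhds hs)).and
        (hcont.eventually (gt_mem_nhds (h2.trans (by norm_num : (1 / 2 : ℝ) < 1)))))
    filter_upwards [Metric.ball_mem_nhds z hr] with y hy
    have hconst := Metric.isOpen_ball.is_const_of_deriv_eq_zero (convex_ball z r).isPreconnected
      (f := fun y => discChart j (h y))
      (fun x hx => (differentiableAt_chart_comp (isDiscChart_discChart j).mdiff (hh x)
        (hball x hx).1).differentiableWithinAt)
      (fun x hx => hder x j hj (hball x hx).1 (hball x hx).2) hy (Metric.mem_ball_self hr)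
    exact (discChart j).injOn (hball y hy).1 hs hconst
  exact hlc.apply_eq_of_preconnectedSpace z w

end IslandMaps

namespace IslandMaps

variable {X : Type*} [TopologicalSpace X] [ChartedSpace ℂ X] [IsManifold 𝓘(ℂ) 1 X] [T2Space X]
variable {E : Type*} [NormedAddCommGroup E] [NormedSpace ℂ E]

/-! ### Rescaling and normality -/

/-- The unit disc in the chart `discChart p`. -/
def unitDisc (p : X) : Set X := {q | q ∈ (discChart p).source ∧ ‖discChart p q‖ < 1}

theorem isOpen_unitDisc (p : X) : IsOpen (unitDisc p) := by
  rw [isOpen_iff_mem_nhds]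
  rintro q ⟨h1, h2⟩
  filter_upwards [(discChart p).open_source.mem_nhds h1,
    ((discChart p).continuousAt h1).norm.eventually (gt_mem_nhds h2)] with y h3 h4 using ⟨h3, h4⟩

theorem unitDisc_subset (p : X) : unitDisc p ⊆ chartDisc (discChart p) 1 := fun _ h => ⟨h.1, h.2.le⟩

/-- On the ball of radius `s` about `a`, the map `g` takes values in one of the discs with centre
in `J`. -/
def MapsToDisc (J : Finset X) (g : E → X) (a : E) (s : ℝ) : Prop :=
  ∃ p ∈ J, MapsTo g (Metric.ball a s) (unitDisc p)

/-- Point picking: a ball on which `g` is not confined to a disc can be improved so that `g` is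
confined on all balls of half the radius nearby. -/
theorem exists_critical_ball [CompleteSpace E] {J : Finset X} (hJ : ∀ p : X, ∃ j ∈ J, p ∈ unitDisc j)
    {g : E → X} {a : E} {r k : ℝ} (hr : 0 < r) (hk : 0 ≤ k)
    (hg : ∀ b ∈ Metric.closedBall a (2 * k * r), ContinuousAt g b)
    (ha : ¬ MapsToDisc J g a r) :
    ∃ b s, 0 < s ∧ s ≤ r ∧ dist b a ≤ 2 * k * r ∧ ¬ MapsToDisc J g b s ∧
      ∀ c ∈ Metric.ball b (k * s), MapsToDisc J g c (s / 2) := by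
  by_contra! hcon
  -- If no ball were critical, one could halve the radius forever, moving the centre by less than
  -- `k` times the current radius. The displacements sum to at most `2 k r`, so the centres
  -- converge. Continuity at the limit confines `g` on small balls around it, a contradiction.
  choose! next hnext using hcon
  let s : ℕ → ℝ := fun n => r / 2 ^ n
  let b : ℕ → E := fun n => n.rec a fun n b => next b (s n)
  have hs : ∀ n, 0 < s n := fun n => by positivity
  have hs' : ∀ n, s (n + 1) = s n / 2 := fun n => by simp only [s]; rw [pow_succ]; field_simp
  have hsr : ∀ n, s n ≤ r := fun n => div_le_self hr.le (one_le_pow₀ (by norm_num))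
  have hb : ∀ n, b (n + 1) = next (b n) (s n) := fun n => rfl
  have hind : ∀ n, dist (b n) a ≤ 2 * k * r - 2 * k * s n ∧ ¬ MapsToDisc J g (b n) (s n) := by
    intro n
    induction n with
    | zero => simpa [s, b] using ha
    | succ n ih =>
      have h0 : 0 ≤ 2 * k * s n := by have := hs n; positivity
      obtain ⟨h1, h2⟩ := hnext (b n) (s n) (hs n) (hsr n) (by linarith [ih.1]) ih.2
      rw [← hb] at h1 h2
      rw [hs']
      refine ⟨?_, h2⟩
      have h3 := dist_triangle (b (n + 1)) (b n) a
      have h4 : dist (b (n + 1)) (b n) < k * s n := h1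
      linarith [ih.1]
  have hdist : ∀ n, dist (b n) (b (n + 1)) ≤ k * r / 2 ^ n := fun n => by
    have h0 : 0 ≤ 2 * k * s n := by have := hs n; positivity
    have h1 := (hnext (b n) (s n) (hs n) (hsr n) (by linarith [(hind n).1]) (hind n).2).1
    rw [← hb, Metric.mem_ball, dist_comm] at h1
    refine h1.le.trans (le_of_eq ?_)
    simp only [s]; ring
  have hcau : CauchySeq b := by
    refine cauchySeq_of_le_geometric (1 / 2) (k * r) (by norm_num) fun n => ?_
    refine (hdist n).trans (le_of_eq ?_)
    rw [one_div, inv_pow]; rfl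
  obtain ⟨b', hb'⟩ := cauchySeq_tendsto_of_complete hcau
  have hmem : b' ∈ Metric.closedBall a (2 * k * r) := by
    refine Metric.isClosed_closedBall.mem_of_tendsto hb' (Eventually.of_forall fun n => ?_)
    have h0 : 0 ≤ 2 * k * s n := by have := hs n; positivity
    rw [Metric.mem_closedBall]; linarith [(hind n).1]
  obtain ⟨p, hp, hpb⟩ := hJ (g b')
  obtain ⟨δ, hδ, hball⟩ := Metric.mem_nhds_iff.1 ((hg b' hmem).preimage_mem_nhds
    ((isOpen_unitDisc p).mem_nhds hpb))
  have hs0 : Tendsto s atTop (𝓝 0) := by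
    have := tendsto_pow_atTop_nhds_zero_of_lt_one (r := (1 / 2 : ℝ)) (by norm_num) (by norm_num)
    have := this.const_mul r
    rw [mul_zero] at this
    refine this.congr fun n => ?_
    simp only [s]; rw [one_div, inv_pow]; rfl
  obtain ⟨n, h1, h2⟩ := ((hs0.eventually (gt_mem_nhds (half_pos hδ))).and
    (hb'.eventually (Metric.ball_mem_nhds b' (half_pos hδ)))).exists
  refine (hind n).2 ⟨p, hp, fun y hy => hball ?_⟩
  rw [Metric.mem_ball] at hy ⊢
  have := dist_triangle y (b n) b'
  linarith

/-- A sequence of holomorphic maps which are confined to discs on a fixed ball converges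
continuously along any ultrafilter. -/
theorem exists_contConvAt [CompactSpace X] {ι : Type*} {l : Ultrafilter ι} {J : Finset X}
    {H : ι → E → X} {a : E} {s : ℝ} (hs : 0 < s) (hH : ∀ᶠ i in l, MapsToDisc J (H i) a s)
    (hd : ∀ᶠ i in l, ∀ y ∈ Metric.ball a s, MDifferentiableAt 𝓘(ℂ, E) 𝓘(ℂ) (H i) y) :
    ∃ x : X, Tendsto (fun q : ι × E => H q.1 q.2) (l ×ˢ 𝓝 a) (𝓝 x) := by
  obtain ⟨p, -, hp⟩ : ∃ p ∈ J, ∀ᶠ i in l, MapsTo (H i) (Metric.ball a s) (unitDisc p) := by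
    have : (⋃ p ∈ (J : Set X), {i | MapsTo (H i) (Metric.ball a s) (unitDisc p)}) ∈ l := by
      filter_upwards [hH] with i hi
      obtain ⟨p, hp, h⟩ := hi
      simp only [mem_iUnion]
      exact ⟨p, hp, h⟩
    obtain ⟨p, hp, h⟩ := (Ultrafilter.finite_biUnion_mem_iff J.finite_toSet).1 this
    exact ⟨p, hp, h⟩
  set e := discChart p
  have he := isDiscChart_discChart p
  have has : a ∈ Metric.ball a s := Metric.mem_ball_self hs
  obtain ⟨x, hx, hlx⟩ := (isCompact_chartDisc (he.closedBall_subset (by norm_num : (1 : ℝ) ≤ 4))).ultrafilter_le_nhds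
    (l.map fun i => H i a) (by
      rw [le_principal_iff]
      exact Ultrafilter.mem_map.2 (hp.mono fun i hi => unitDisc_subset p (hi has)))
  have hlim : Tendsto (fun i => H i a) l (𝓝 x) := hlx
  have hlim2 : Tendsto (fun i => e (H i a)) l (𝓝 (e x)) := (e.continuousAt hx.1).tendsto.comp hlim
  refine ⟨x, ?_⟩
  have hin : ∀ᶠ q : ι × E in (l : Filter ι) ×ˢ 𝓝 a, (MapsTo (H q.1) (Metric.ball a s) (unitDisc p) ∧
      ∀ y ∈ Metric.ball a s, MDifferentiableAt 𝓘(ℂ, E) 𝓘(ℂ) (H q.1) y) ∧ q.2 ∈ Metric.ball a s :=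
    (hp.and hd).prod_mk (Metric.ball_mem_nhds a hs)
  -- In the chart the maps take values in a disc of radius `2` about their value at `a`. By the
  -- Schwarz lemma they are Lipschitz at `a` with constant `2 / s`, uniformly in `i`, so convergence
  -- at the point `a` upgrades to continuous convergence.
  have hdiff : Tendsto (fun q : ι × E => e (H q.1 q.2) - e (H q.1 a)) ((l : Filter ι) ×ˢ 𝓝 a) (𝓝 0) := by
    have h2 : Tendsto (fun q : ι × E => 2 / s * dist q.2 a) ((l : Filter ι) ×ˢ 𝓝 a) (𝓝 0) := by
      have h3 : Tendsto (fun y : E => 2 / s * dist y a) (𝓝 a) (𝓝 (2 / s * dist a a)) :=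
        (by fun_prop : Continuous fun y : E => 2 / s * dist y a).tendsto a
      rw [dist_self, mul_zero] at h3
      exact h3.comp tendsto_snd
    refine squeeze_zero_norm' ?_ h2
    filter_upwards [hin] with q ⟨⟨h3, h4⟩, h5⟩
    have h6 : DifferentiableOn ℂ (fun y => e (H q.1 y)) (Metric.ball a s) := fun y hy =>
      (differentiableAt_chart_comp he.mdiff (h4 y hy) (h3 hy).1).differentiableWithinAt
    have h7 : MapsTo (fun y => e (H q.1 y)) (Metric.ball a s) (Metric.ball (e (H q.1 a)) 2) := fun y hy => by
      rw [Metric.mem_ball, dist_eq_norm]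
      have := norm_sub_le (e (H q.1 y)) (e (H q.1 a))
      linarith [(h3 hy).2, (h3 has).2]
    have h8 := Complex.dist_le_div_mul_dist_of_mapsTo_ball h6 (h7.mono_right Metric.ball_subset_closedBall) h5
    rwa [dist_eq_norm] at h8
  have hsum : Tendsto (fun q : ι × E => e (H q.1 q.2)) ((l : Filter ι) ×ˢ 𝓝 a) (𝓝 (e x)) := by
    have := hdiff.add (hlim2.comp tendsto_fst : Tendsto _ ((l : Filter ι) ×ˢ 𝓝 a) _)
    rw [zero_add] at this
    exact this.congr fun q => by simp
  have hfin := (e.continuousAt_symm (e.map_source hx.1)).tendsto.comp hsum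
  rw [e.left_inv hx.1] at hfin
  refine hfin.congr' ?_
  filter_upwards [hin] with q ⟨⟨h3, h4⟩, h5⟩
  exact e.left_inv (h3 h5).1

theorem mdifferentiableAt_of_contConvAt {ι : Type*} {l : Filter ι} [l.NeBot] {H : ι → ℂ → X}
    [RegularSpace X] {h : ℂ → X} {z : ℂ} (hc : ∀ᶠ y in 𝓝 z, ContConvAt H h l y)
    (hd : ∀ᶠ q : ι × ℂ in l ×ˢ 𝓝 z, MDifferentiableAt 𝓘(ℂ) 𝓘(ℂ) (H q.1) q.2) :
    MDifferentiableAt 𝓘(ℂ) 𝓘(ℂ) h z := by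
  have hcont : ContinuousAt h z := continuousAt_of_contConvAt hc
  set e := discChart (h z)
  have he := isDiscChart_discChart (h z)
  have hs := e.open_source.mem_nhds he.mem
  refine mdifferentiableAt_of_chart_comp he.mdiff hcont he.mem ?_
  obtain ⟨pa, hpa, pb, hpb, hab⟩ := eventually_prod_iff.1 (hd.and (hc.self_of_nhds.eventually hs))
  obtain ⟨r, hr, hball⟩ := Metric.eventually_nhds_iff_ball.1 (hpb.and (hc.and (hcont.eventually hs)))
  refine (differentiableOn_of_contConvAt (l := l) (c := fun i y => e (H i y)) Metric.isOpen_ball ?_ ?_).differentiableAt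
    (Metric.ball_mem_nhds z hr)
  · exact fun y hy => (hball y hy).2.1.comp_left (e.continuousAt (hball y hy).2.2)
  · intro y hy
    refine eventually_prod_iff.2 ⟨pa, hpa, _, Metric.isOpen_ball.mem_nhds hy, fun {i} hi {w} hw => ?_⟩
    obtain ⟨h1, h2⟩ := hab hi (hball w hw).1
    exact differentiableAt_chart_comp he.mdiff h1 h2

/-- Zalcman's lemma: a family of holomorphic maps which is not normal at `a` has a nonconstant
rescaling limit. -/
theorem exists_rescaling [CompactSpace X] [FiniteDimensional ℂ E] {ι : Type*} {J : Finset X}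
    (hJ : ∀ p : X, ∃ j ∈ J, p ∈ (discChart j).source ∧ ‖discChart j p‖ < 1 / 2)
    {g : ι → E → X} {a : E} {R : ℝ} (hR : 0 < R)
    (hg : ∀ i, ∀ b ∈ Metric.ball a R, MDifferentiableAt 𝓘(ℂ, E) 𝓘(ℂ) (g i) b)
    (hbad : ∀ r > 0, ∃ i, ∃ b ∈ Metric.ball a r, ¬ MapsToDisc J (g i) b r) :
    ∃ (i : ℕ → ι) (μ : ℕ → E) (ρ : ℕ → ℝ) (u : E) (h : ℂ → X), (∀ k, 0 < ρ k) ∧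
      Tendsto ρ atTop (𝓝 0) ∧ Tendsto μ atTop (𝓝 a) ∧ MDifferentiable 𝓘(ℂ) 𝓘(ℂ) h ∧ h 0 ≠ h 1 ∧
      ∀ z, ContConvAt (fun k z => g (i k) (μ k + (ρ k : ℂ) • z • u)) h (hyperfilter ℕ) z := by
  have : ProperSpace E := FiniteDimensional.proper ℂ E
  have hJ' : ∀ p : X, ∃ j ∈ J, p ∈ unitDisc j := fun p => by
    obtain ⟨j, hj, h1, h2⟩ := hJ p
    exact ⟨j, hj, h1, h2.trans (by norm_num)⟩
  -- Being confined to a disc plays the role of a derivative bound. The starting radius is so small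
  -- that the displacement `2 k r` in the choice of the critical ball stays below `R / (2 (k + 1))`.
  -- Rescaling by `s` then gives maps confined on balls of radius `1 / 2` about all points of norm
  -- less than `k`.
  have hseq : ∀ k : ℕ, ∃ (i : ι) (b : E) (s : ℝ), 0 < s ∧ s ≤ R / (8 * (k + 1) ^ 2) ∧
      dist b a ≤ R / (2 * (k + 1)) ∧ ¬ MapsToDisc J (g i) b s ∧
      ∀ c ∈ Metric.ball b (k * s), MapsToDisc J (g i) c (s / 2) := by
    intro k
    set r := R / (8 * ((k : ℝ) + 1) ^ 2) with hrdef
    have hr : 0 < r := by positivity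
    obtain ⟨i, b, hb, hbr⟩ := hbad r hr
    have hk : (0 : ℝ) ≤ k := k.cast_nonneg
    have hle : r + 2 * k * r ≤ R / (2 * (k + 1)) := by
      rw [hrdef, le_div_iff₀ (by positivity)]
      have : (R / (8 * ((k : ℝ) + 1) ^ 2) + 2 * k * (R / (8 * (k + 1) ^ 2))) * (2 * (k + 1)) =
        R * ((1 + 2 * k) / (4 * (k + 1))) := by field_simp; ring
      rw [this]
      refine mul_le_of_le_one_right hR.le ?_
      rw [div_le_one (by positivity)]; linarith
    have hlt : R / (2 * ((k : ℝ) + 1)) < R := by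
      rw [div_lt_iff₀ (by positivity)]; nlinarith
    obtain ⟨c, s, hs, hsr, hc, hbad, hgood⟩ := exists_critical_ball hJ' hr hk (fun c hc => by
      refine (hg i c ?_).continuousAt
      rw [Metric.mem_closedBall] at hc
      rw [Metric.mem_ball] at hb ⊢
      linarith [dist_triangle c b a]) hbr
    refine ⟨i, c, s, hs, hsr, ?_, hbad, hgood⟩
    rw [Metric.mem_ball] at hb
    linarith [dist_triangle c b a]
  choose i μ ρ hρ hρle hμ hnot hgood using hseq
  have hone : ∀ k : ℕ, (0 : ℝ) ≤ k := fun k => k.cast_nonneg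
  have hlim : Tendsto (fun k : ℕ => R / ((k : ℝ) + 1)) atTop (𝓝 0) := by
    have := (tendsto_one_div_add_atTop_nhds_zero_nat (𝕜 := ℝ)).const_mul R
    simpa [div_eq_mul_inv] using this
  have hρ0 : Tendsto ρ atTop (𝓝 0) := by
    refine squeeze_zero (fun k => (hρ k).le) (fun k => (hρle k).trans ?_) hlim
    have := hone k
    gcongr
    nlinarith
  have hμ0 : Tendsto μ atTop (𝓝 a) := by
    rw [tendsto_iff_dist_tendsto_zero]
    refine squeeze_zero (fun k => dist_nonneg) (fun k => (hμ k).trans ?_) hlim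
    have := hone k
    gcongr
    linarith
  -- the rescaled maps
  set H : ℕ → E → X := fun k y => g (i k) (μ k + (ρ k : ℂ) • y)
  have hHgood : ∀ y : E, ∀ᶠ k in hyperfilter ℕ, MapsToDisc J (H k) y (1 / 2) := by
    intro y
    refine Filter.Eventually.filter_mono Nat.hyperfilter_le_atTop ?_
    obtain ⟨m, hm⟩ := exists_nat_gt ‖y‖
    filter_upwards [eventually_ge_atTop m] with k hk
    have hk' : ‖y‖ < k := hm.trans_le (by exact_mod_cast hk)
    obtain ⟨p, hp, hmaps⟩ := hgood k (μ k + (ρ k : ℂ) • y) (by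
      rw [Metric.mem_ball, dist_eq_norm, add_sub_cancel_left, norm_smul, Complex.norm_real,
        Real.norm_of_nonneg (hρ k).le, mul_comm]
      exact mul_lt_mul_of_pos_right hk' (hρ k))
    refine ⟨p, hp, fun w hw => hmaps ?_⟩
    rw [Metric.mem_ball, dist_eq_norm] at hw ⊢
    rw [add_sub_add_left_eq_sub, ← smul_sub, norm_smul, Complex.norm_real, Real.norm_of_nonneg (hρ k).le]
    have := mul_lt_mul_of_pos_left hw (hρ k)
    linarith
  have hHd : ∀ y : E, ∀ᶠ k in hyperfilter ℕ, ∀ w ∈ Metric.ball y (1 / 2),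
      MDifferentiableAt 𝓘(ℂ, E) 𝓘(ℂ) (H k) w := by
    intro y
    refine Filter.Eventually.filter_mono Nat.hyperfilter_le_atTop ?_
    have h1 : Tendsto (fun k => dist (μ k) a + ρ k * (‖y‖ + 1)) atTop (𝓝 (0 + 0 * (‖y‖ + 1))) :=
      (tendsto_iff_dist_tendsto_zero.1 hμ0).add (hρ0.mul_const _)
    rw [zero_mul, add_zero] at h1
    filter_upwards [h1.eventually (gt_mem_nhds hR)] with k hk w hw
    refine MDifferentiableAt.comp w (hg (i k) _ ?_)
      (by fun_prop : DifferentiableAt ℂ (fun w : E => μ k + (ρ k : ℂ) • w) w).mdifferentiableAt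
    rw [Metric.mem_ball] at hw ⊢
    have h2 : dist (μ k + (ρ k : ℂ) • w) (μ k) ≤ ρ k * (‖y‖ + 1) := by
      rw [dist_eq_norm, add_sub_cancel_left, norm_smul, Complex.norm_real, Real.norm_of_nonneg (hρ k).le]
      have h3 : ‖w‖ ≤ ‖y‖ + 1 := by
        rw [dist_eq_norm] at hw
        have := norm_sub_norm_le w y
        linarith
      exact mul_le_mul_of_nonneg_left h3 (hρ k).le
    linarith [dist_triangle (μ k + (ρ k : ℂ) • w) (μ k) a]
  choose G hG using fun y => exists_contConvAt (by norm_num : (0 : ℝ) < 1 / 2) (hHgood y) (hHd y)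
  -- Failure of confinement on the critical ball keeps the limit from being constant. The centre
  -- lies deep in some disc, but a point `v` of the rescaled unit ball is sent outside that disc.
  -- The complex line spanned by a limit `u` of these points carries the one-variable limit map.
  have hnear : ∀ k, ∃ p ∈ J, ∃ v : E, ‖v‖ < 1 ∧ H k 0 ∈ (discChart p).source ∧
      ‖discChart p (H k 0)‖ < 1 / 2 ∧ H k v ∉ unitDisc p := by
    intro k
    obtain ⟨p, hp, h1, h2⟩ := hJ (H k 0)
    have : ¬ MapsTo (g (i k)) (Metric.ball (μ k) (ρ k)) (unitDisc p) := fun h => hnot k ⟨p, hp, h⟩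
    simp only [MapsTo] at this
    push Not at this
    obtain ⟨c, hc, hcn⟩ := this
    have hρk : (ρ k : ℂ) ≠ 0 := by exact_mod_cast (hρ k).ne'
    refine ⟨p, hp, (ρ k : ℂ)⁻¹ • (c - μ k), ?_, h1, h2, ?_⟩
    · rw [norm_smul, norm_inv, Complex.norm_real, Real.norm_of_nonneg (hρ k).le,
        inv_mul_lt_iff₀ (hρ k), mul_one]
      rwa [Metric.mem_ball, dist_eq_norm] at hc
    · simp only [H]
      rw [smul_smul, mul_inv_cancel₀ hρk, one_smul, add_sub_cancel]
      exact hcn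
  choose p hpJ v hv1 hps hph hpv using hnear
  obtain ⟨q, -, hq⟩ : ∃ q ∈ J, ∀ᶠ k in hyperfilter ℕ, p k = q := by
    have : (⋃ q ∈ (J : Set X), {k | p k = q}) ∈ hyperfilter ℕ := by
      refine Filter.mem_of_superset univ_mem fun k _ => ?_
      simp only [mem_iUnion]
      exact ⟨p k, hpJ k, rfl⟩
    obtain ⟨q, hq, h⟩ := (Ultrafilter.finite_biUnion_mem_iff J.finite_toSet).1 this
    exact ⟨q, hq, h⟩
  obtain ⟨u, -, hu⟩ := (isCompact_closedBall (0 : E) 1).ultrafilter_le_nhds ((hyperfilter ℕ).map v) (by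
    rw [le_principal_iff]
    exact Ultrafilter.mem_map.2 (Eventually.of_forall fun k => by simpa using (hv1 k).le))
  have hu' : Tendsto v (hyperfilter ℕ) (𝓝 u) := hu
  have hcc : ∀ z : ℂ, ContConvAt (fun k (z : ℂ) => g (i k) (μ k + (ρ k : ℂ) • z • u)) (fun z => G (z • u))
      (hyperfilter ℕ) z := by
    intro z
    have h1 : Tendsto (fun z : ℂ => z • u) (𝓝 z) (𝓝 (z • u)) :=
      (by fun_prop : Continuous fun z : ℂ => z • u).tendsto z
    exact (hG (z • u)).comp (tendsto_fst.prodMk (h1.comp tendsto_snd))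
  refine ⟨i, μ, ρ, u, fun z => G (z • u), hρ, hρ0, hμ0, fun z => ?_, ?_, hcc⟩
  · refine mdifferentiableAt_of_contConvAt (l := (hyperfilter ℕ : Filter ℕ)) (Eventually.of_forall hcc) ?_
    have h1 : Tendsto (fun z : ℂ => z • u) (𝓝 z) (𝓝 (z • u)) :=
      (by fun_prop : Continuous fun z : ℂ => z • u).tendsto z
    have h2 : ∀ᶠ z' in 𝓝 z, z' • u ∈ Metric.ball (z • u) (1 / 2) :=
      h1.eventually (Metric.ball_mem_nhds _ (by norm_num))
    filter_upwards [(hHd (z • u)).prod_mk h2] with q hq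
    exact MDifferentiableAt.comp (g := H q.1) q.2 (hq.1 _ hq.2)
      (by fun_prop : DifferentiableAt ℂ (fun z : ℂ => z • u) q.2).mdifferentiableAt
  · have h0 : Tendsto (fun k => H k 0) (hyperfilter ℕ) (𝓝 (G 0)) :=
      (hG 0).comp (tendsto_id.prodMk tendsto_const_nhds)
    have h1 : Tendsto (fun k => H k (v k)) (hyperfilter ℕ) (𝓝 (G u)) :=
      (hG u).comp (tendsto_id.prodMk hu')
    have h2 : G 0 ∈ chartDisc (discChart q) (1 / 2) := by
      refine ((isDiscChart_discChart q).isClosed_chartDisc (by norm_num)).mem_of_tendsto h0 ?_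
      filter_upwards [hq] with k hk
      exact hk ▸ ⟨hps k, (hph k).le⟩
    have h3 : G u ∈ (unitDisc q)ᶜ := by
      refine (isOpen_unitDisc q).isClosed_compl.mem_of_tendsto h1 ?_
      filter_upwards [hq] with k hk
      exact hk ▸ hpv k
    intro heq
    simp only [zero_smul, one_smul] at heq
    rw [← heq] at h3
    exact h3 ⟨h2.1, h2.2.trans_lt (by norm_num)⟩

/-- Limits are taken along an ultrafilter, but `IsNormalOn` asks for sequences. A countably
generated uniformity makes the space of continuous maps first countable, so a cluster point of a
sequence is a limit of a subsequence. -/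
theorem isCountablyGenerated_uniformity [CompactSpace X] :
    letI : UniformSpace X := uniformSpaceOfCompactR1
    (uniformity X).IsCountablyGenerated := by
  have : SecondCountableTopology X := ChartedSpace.secondCountable_of_sigmaCompact ℂ X
  let : MetricSpace X := TopologicalSpace.metrizableSpaceMetric X
  have : (uniformSpaceOfCompactR1 : UniformSpace X) = PseudoMetricSpace.toUniformSpace := by
    refine unique_uniformity_of_compact ?_ ?_ <;> rfl
  rw [this]
  infer_instance

theorem isNormalOn_of_mapsToDisc [CompactSpace X] [FiniteDimensional ℂ E] {ι : Type*} {J : Finset X}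
    {g : ι → E → X} {a : E} {r : ℝ} (hr : 0 < r)
    (hg : ∀ i, ∀ b ∈ Metric.ball a r, MDifferentiableAt 𝓘(ℂ, E) 𝓘(ℂ) (g i) b)
    (hgood : ∀ i, ∀ b ∈ Metric.ball a r, MapsToDisc J (g i) b r) :
    IsNormalOn g (Metric.ball a r) := by
  have : ProperSpace E := FiniteDimensional.proper ℂ E
  let : UniformSpace X := uniformSpaceOfCompactR1
  have : (uniformity X).IsCountablyGenerated := isCountablyGenerated_uniformity
  set O := Metric.ball a r
  have : LocallyCompactSpace O := Metric.isOpen_ball.locallyCompactSpace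
  have : SecondCountableTopology E := secondCountable_of_proper
  intro u
  have hlim : ∀ b : O, ∃ x : X, Tendsto (fun q : ℕ × E => g (u q.1) q.2)
      ((hyperfilter ℕ : Filter ℕ) ×ˢ 𝓝 (b : E)) (𝓝 x) := by
    rintro ⟨b, hb⟩
    obtain ⟨s, hs, hball⟩ := Metric.isOpen_iff.1 Metric.isOpen_ball b hb
    refine exists_contConvAt (J := J) (s := min s r) (lt_min hs hr) (Eventually.of_forall fun k => ?_)
      (Eventually.of_forall fun k y hy => hg _ y (hball ?_))
    · obtain ⟨p, hp, h⟩ := hgood (u k) b hb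
      exact ⟨p, hp, h.mono_left (Metric.ball_subset_ball (min_le_right _ _))⟩
    · exact Metric.ball_subset_ball (min_le_left _ _) hy
  choose G hG using hlim
  have hcc : ∀ b : O, ContConvAt (fun k (b : O) => g (u k) b) G (hyperfilter ℕ) b := fun b =>
    (hG b).comp (tendsto_fst.prodMk ((continuous_subtype_val.tendsto b).comp tendsto_snd))
  have hGc : Continuous G := continuous_iff_continuousAt.2 fun b =>
    continuousAt_of_contConvAt (Eventually.of_forall hcc)
  let g' : ℕ → C(O, X) := fun k => ⟨fun b => g (u k) b, continuous_iff_continuousAt.2 fun b =>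
    (hg _ b b.2).continuousAt.comp continuous_subtype_val.continuousAt⟩
  let G' : C(O, X) := ⟨G, hGc⟩
  have hT : Tendsto g' (hyperfilter ℕ) (𝓝 G') := by
    rw [ContinuousMap.tendsto_iff_tendstoLocallyUniformly, tendstoLocallyUniformly_iff_forall_tendsto]
    intro b
    have h1 : Tendsto (fun q : ℕ × O => (G q.2, g (u q.1) q.2)) ((hyperfilter ℕ : Filter ℕ) ×ˢ 𝓝 b)
        (𝓝 (G b, G b)) := (hGc.continuousAt.tendsto.comp tendsto_snd).prodMk_nhds (hcc b)
    exact h1.mono_right (nhds_le_uniformity _)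
  have hcl : MapClusterPt G' atTop g' :=
    (hT.mapClusterPt).mono (Nat.hyperfilter_le_atTop)
  obtain ⟨s, hs, hsT⟩ := hcl.tendsto_subseq
  rw [ContinuousMap.tendsto_iff_tendstoLocallyUniformly] at hsT
  classical
  refine ⟨s, fun y => if hy : y ∈ O then G ⟨y, hy⟩ else g (u 0) y, hs, ?_⟩
  rw [tendstoLocallyUniformlyOn_iff_tendstoLocallyUniformly_comp_coe]
  have : (fun y => if hy : y ∈ O then G ⟨y, hy⟩ else g (u 0) y) ∘ Subtype.val = G := by
    funext b
    simp
  rw [this]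
  exact hsT

end IslandMaps

namespace IslandMaps

variable {X : Type*} [TopologicalSpace X] [ChartedSpace ℂ X] [IsManifold 𝓘(ℂ) 1 X] [T2Space X]
variable {E : Type*} [NormedAddCommGroup E] [NormedSpace ℂ E]

/-! ### Holomorphic motions -/

theorem nhdsNE_neBot (p : X) : (𝓝[≠] p).NeBot := by
  set e := discChart p
  have he := isDiscChart_discChart p
  have h1 : Tendsto e.symm (𝓝[≠] (e p)) (𝓝[≠] p) := by
    refine tendsto_nhdsWithin_iff.2 ⟨?_, ?_⟩
    · have := e.continuousAt_symm (e.map_source he.mem)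
      rw [ContinuousAt, e.left_inv he.mem] at this
      exact this.mono_left nhdsWithin_le_nhds
    · filter_upwards [self_mem_nhdsWithin, nhdsWithin_le_nhds (e.open_target.mem_nhds (e.map_source he.mem))]
        with z hz hzt hzp
      rw [mem_singleton_iff] at hzp
      exact hz (by rw [mem_singleton_iff, ← e.right_inv hzt, hzp])
  exact h1.neBot

theorem infinite_of_isOpen {O : Set X} (hO : IsOpen O) (hne : O.Nonempty) : O.Infinite := by
  obtain ⟨p, hp⟩ := hne
  have := nhdsNE_neBot p
  exact infinite_of_mem_nhds p (hO.mem_nhds hp)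

/-- A nonconstant rescaling limit does not meet the limits of maps which the rescaled maps
avoid. -/
theorem eventuallyEq_of_avoid {ι : Type*} {l : Filter ι} [l.NeBot] [RegularSpace X]
    {H : ι → ℂ → X} {h : ℂ → X} {a : E} {γ : ι → ℂ → E} {t : E → X} {z : ℂ}
    (hH : ∀ᶠ y in 𝓝 z, ContConvAt H h l y)
    (hHd : ∀ᶠ q : ι × ℂ in l ×ˢ 𝓝 z, MDifferentiableAt 𝓘(ℂ) 𝓘(ℂ) (H q.1) q.2)
    (hγ : ∀ y, ContConvAt γ (fun _ => a) l y) (hγd : ∀ i, Differentiable ℂ (γ i))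
    (ht : ∀ᶠ b in 𝓝 a, MDifferentiableAt 𝓘(ℂ, E) 𝓘(ℂ) t b)
    (hne : ∀ᶠ q : ι × ℂ in l ×ˢ 𝓝 z, H q.1 q.2 ≠ t (γ q.1 q.2)) (h0 : h z = t a) :
    ∀ᶠ y in 𝓝 z, h y = t a := by
  refine eventuallyEq_of_contConvAt (l := l) (b := fun i y => t (γ i y)) (b₀ := fun _ => t a) hH ?_ hHd ?_ hne h0
  · exact Eventually.of_forall fun y => (ht.self_of_nhds.continuousAt.tendsto).comp (hγ y)
  · filter_upwards [(hγ z).eventually ht] with q hq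
    exact hq.comp q.2 (hγd q.1 q.2).mdifferentiableAt

theorem contConvAt_affine {μ : ℕ → E} {ρ : ℕ → ℝ} {a u : E} (hρ : Tendsto ρ atTop (𝓝 0))
    (hμ : Tendsto μ atTop (𝓝 a)) (z : ℂ) :
    ContConvAt (fun k (z : ℂ) => μ k + (ρ k : ℂ) • z • u) (fun _ => a) (hyperfilter ℕ) z := by
  have h1 : Tendsto μ (hyperfilter ℕ) (𝓝 a) := hμ.mono_left Nat.hyperfilter_le_atTop
  have h2 : Tendsto (fun k => (ρ k : ℂ)) (hyperfilter ℕ) (𝓝 0) := by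
    have := (Complex.continuous_ofReal.tendsto 0).comp (hρ.mono_left Nat.hyperfilter_le_atTop)
    rwa [Complex.ofReal_zero] at this
  have h3 : Tendsto (fun z : ℂ => z • u) (𝓝 z) (𝓝 (z • u)) :=
    (by fun_prop : Continuous fun z : ℂ => z • u).tendsto z
  have h4 : Tendsto (fun q : ℕ × ℂ => μ q.1 + (ρ q.1 : ℂ) • q.2 • u) (hyperfilter ℕ ×ˢ 𝓝 z)
      (𝓝 (a + (0 : ℂ) • z • u)) :=
    (h1.comp tendsto_fst).add ((h2.comp tendsto_fst).smul (h3.comp tendsto_snd))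
  rw [zero_smul, add_zero] at h4
  exact h4

theorem differentiable_affine (b u : E) (ρ : ℂ) : Differentiable ℂ fun z : ℂ => b + ρ • z • u := by
  fun_prop

/-- A family of homeomorphisms depending holomorphically on the parameter is locally confined to
discs. -/
theorem exists_mapsToDisc_motion [CompactSpace X] [ConnectedSpace X] [FiniteDimensional ℂ E]
    {J : Finset X} (hJ : ∀ p : X, ∃ j ∈ J, p ∈ (discChart j).source ∧ ‖discChart j p‖ < 1 / 2)
    {φ : E → X ≃ₜ X} {a : E}
    {R : ℝ} (hR : 0 < R)
    (hφ : ∀ z, ∀ b ∈ Metric.ball a R, MDifferentiableAt 𝓘(ℂ, E) 𝓘(ℂ) (fun y => φ y z) b) :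
    ∃ r > 0, ∀ z, ∀ b ∈ Metric.ball a r, MapsToDisc J (fun y => φ y z) b r := by
  by_contra! hcon
  obtain ⟨i, μ, ρ, u, h, -, hρ, hμ, hh, h01, hcc⟩ :=
    exists_rescaling (g := fun z y => φ y z) hJ hR (fun z b hb => hφ z b hb) hcon
  have hγ := contConvAt_affine (u := u) hρ hμ
  -- If `i k ≠ w` for almost all `k`, the points `φ y (i k)` and `φ y w` never coincide, so by
  -- Hurwitz the nonconstant limit avoids `φ a w`. At most one `w` can agree with almost all `i k`.
  have homit : ∀ w : X, (¬ ∀ᶠ k in hyperfilter ℕ, i k = w) → φ a w ∉ range h := by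
    rintro w hw ⟨z, hz⟩
    have hw' : ∀ᶠ k in hyperfilter ℕ, i k ≠ w := Ultrafilter.eventually_not.2 hw
    have hball : ∀ᶠ b in 𝓝 a, b ∈ Metric.ball a R := Metric.ball_mem_nhds a hR
    have h1 := eventuallyEq_of_avoid (l := (hyperfilter ℕ : Filter ℕ)) (t := fun y => φ y w) (z := z)
      (Eventually.of_forall hcc)
      (by
        filter_upwards [(hγ z).eventually hball] with q hq
        exact MDifferentiableAt.comp (g := fun y => φ y (i q.1)) q.2 (hφ (i q.1) _ hq)
          (differentiable_affine (μ q.1) u (ρ q.1) q.2).mdifferentiableAt) hγ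
      (fun k => differentiable_affine (μ k) u (ρ k)) (hball.mono fun b hb => hφ w b hb)
      (by
        filter_upwards [hw'.prod_inl (𝓝 z)] with q hq
        exact fun heq => hq ((φ _).injective heq)) hz
    have h2 := eqOn_of_mdifferentiable isOpen_univ isPreconnected_univ (fun y _ => hh y)
      (fun y _ => (mdifferentiable_const (c := φ a w)) y) (mem_univ z) h1
    exact h01 ((h2 0 (mem_univ _)).trans (h2 1 (mem_univ _)).symm)
  refine h01 (eq_of_infinite_omitted hh ?_ 0 1)
  have hsub : (φ a) '' {w | ∀ᶠ k in hyperfilter ℕ, i k = w}ᶜ ⊆ (range h)ᶜ := by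
    rintro _ ⟨w, hw, rfl⟩
    exact homit w hw
  refine Set.Infinite.mono hsub (Set.Infinite.image (φ a).injective.injOn ?_)
  have hss : {w | ∀ᶠ k in hyperfilter ℕ, i k = w}.Subsingleton := fun w hw w' hw' => by
    obtain ⟨k, h1, h2⟩ := (hw.and hw').exists
    exact h1.symm.trans h2
  intro hfin
  have := infinite_of_isOpen (X := X) isOpen_univ univ_nonempty
  exact this (by rw [← union_compl_self {w | ∀ᶠ k in hyperfilter ℕ, i k = w}]; exact hss.finite.union hfin)

/-- The maps `y ↦ φ y w`, for all `w`, are confined on one common ball, hence converge continuously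
along any ultrafilter. The limit is identified at the parameter `a`, where `φ a` is continuous in
`w`. -/
theorem continuousAt_motion [CompactSpace X] [ConnectedSpace X] [FiniteDimensional ℂ E]
    {φ : E → X ≃ₜ X} {a : E}
    (hφ : ∀ᶠ b in 𝓝 a, ∀ z, MDifferentiableAt 𝓘(ℂ, E) 𝓘(ℂ) (fun y => φ y z) b) (z : X) :
    ContinuousAt (fun q : E × X => φ q.1 q.2) (a, z) := by
  obtain ⟨R, hR, hball⟩ := Metric.eventually_nhds_iff_ball.1 hφ
  obtain ⟨J, -, hJ⟩ := exists_finset_discChart z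
  obtain ⟨r, hr, hgood⟩ := exists_mapsToDisc_motion hJ hR fun z b hb => hball b hb z
  rw [ContinuousAt, tendsto_iff_ultrafilter]
  intro l hl
  have hl1 : Tendsto (fun q : E × X => q.1) l (𝓝 a) := (continuous_fst.tendsto (a, z)).mono_left hl
  have hl2 : Tendsto (fun q : E × X => q.2) l (𝓝 z) := (continuous_snd.tendsto (a, z)).mono_left hl
  obtain ⟨x, hx⟩ := exists_contConvAt (l := l) (J := J) (H := fun q y => φ y q.2) (a := a) (s := min r R)
    (lt_min hr hR) (Eventually.of_forall fun q => by
      obtain ⟨p, hp, h⟩ := hgood q.2 a (Metric.mem_ball_self hr)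
      exact ⟨p, hp, h.mono_left (Metric.ball_subset_ball (min_le_left _ _))⟩)
    (Eventually.of_forall fun q y hy => hball y (Metric.ball_subset_ball (min_le_right _ _) hy) q.2)
  have h1 : Tendsto (fun q : E × X => φ a q.2) l (𝓝 x) := hx.comp (tendsto_id.prodMk tendsto_const_nhds)
  have h2 : Tendsto (fun q : E × X => φ a q.2) l (𝓝 (φ a z)) := ((φ a).continuous.tendsto z).comp hl2
  have h3 : Tendsto (fun q : E × X => φ q.1 q.2) l (𝓝 x) := hx.comp (tendsto_id.prodMk hl1)
  rw [tendsto_nhds_unique h1 h2] at h3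
  exact h3

theorem continuousAt_motion_symm [CompactSpace X] [ConnectedSpace X] [FiniteDimensional ℂ E]
    {φ : E → X ≃ₜ X} {a : E}
    (hφ : ∀ᶠ b in 𝓝 a, ∀ z, MDifferentiableAt 𝓘(ℂ, E) 𝓘(ℂ) (fun y => φ y z) b) (z : X) :
    ContinuousAt (fun q : E × X => (φ q.1).symm q.2) (a, z) := by
  rw [ContinuousAt, tendsto_iff_ultrafilter]
  intro l hl
  have hl1 : Tendsto (fun q : E × X => q.1) l (𝓝 a) := (continuous_fst.tendsto (a, z)).mono_left hl
  have hl2 : Tendsto (fun q : E × X => q.2) l (𝓝 z) := (continuous_snd.tendsto (a, z)).mono_left hl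
  obtain ⟨w, -, hw⟩ := isCompact_univ.ultrafilter_le_nhds (l.map fun q : E × X => (φ q.1).symm q.2) (by simp)
  have hw' : Tendsto (fun q : E × X => (φ q.1).symm q.2) l (𝓝 w) := hw
  have h1 : Tendsto (fun q : E × X => q.2) l (𝓝 (φ a w)) := by
    have := (continuousAt_motion hφ w).tendsto.comp (hl1.prodMk_nhds hw')
    refine this.congr fun q => ?_
    simp
  have h2 : z = φ a w := tendsto_nhds_unique hl2 h1
  have h3 : (φ a).symm z = w := by rw [h2]; simp
  change Tendsto (fun q : E × X => (φ q.1).symm q.2) l (𝓝 ((φ a).symm z))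
  rw [h3]
  exact hw'

/-! ### Local families -/

variable (X E) in
/-- A natural family, parametrized by an open subset of a vector space. -/
structure LocalFamily where
  /-- The parameter domain. -/
  B : Set E
  /-- The domain of the model map. -/
  W : Set X
  /-- The model map. -/
  f : X → X
  /-- The homeomorphisms acting on values. -/
  φ : E → X ≃ₜ X
  /-- The homeomorphisms acting on the domain. -/
  ψ : E → X ≃ₜ X
  isOpen_B : IsOpen B
  isOpen_W : IsOpen W
  mdiff_f : MDifferentiableOn 𝓘(ℂ) 𝓘(ℂ) f W
  mdiff_φ : ∀ z, ∀ b ∈ B, MDifferentiableAt 𝓘(ℂ, E) 𝓘(ℂ) (fun y => φ y z) b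
  mdiff_ψ : ∀ z, ∀ b ∈ B, MDifferentiableAt 𝓘(ℂ, E) 𝓘(ℂ) (fun y => ψ y z) b
  mdiff_map : ∀ b ∈ B, MDifferentiableOn 𝓘(ℂ) 𝓘(ℂ) (fun z => φ b (f ((ψ b).symm z))) (ψ b '' W)

/-- A scalar function which is holomorphic in `z`, jointly continuous, and holomorphic in `b` along
one curve `c` is holomorphic in `b` along all curves that meet `c`. -/
theorem differentiableAt_of_curve {F : E → ℂ → ℂ} {a : E} {u c : E → ℂ} {r : ℝ} (hr : 0 < r)
    (hu : DifferentiableAt ℂ u a) (hc : DifferentiableAt ℂ c a) (huc : u a = c a)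
    (hF : ∀ᶠ b in 𝓝 a, DifferentiableOn ℂ (F b) (Metric.ball (c a) r))
    (hFc : ∀ z ∈ Metric.ball (c a) r, ContinuousAt (fun q : E × ℂ => F q.1 q.2) (a, z))
    (hFd : DifferentiableAt ℂ (fun b => F b (c b)) a) :
    DifferentiableAt ℂ (fun b => F b (u b)) a := by
  have hFa : DifferentiableAt ℂ (F a) (c a) := hF.self_of_nhds.differentiableAt (Metric.ball_mem_nhds _ hr)
  have hO : (fun b => u b - c b) =O[𝓝 a] fun b => b - a := by
    have := (hu.sub hc).hasFDerivAt.isBigO_sub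
    simpa [huc] using this
  have hsmall : ∀ ε > 0, ∀ᶠ b in 𝓝 a, ∀ z ∈ Metric.closedBall (c a) (r / 2), ‖F b z - F a z‖ ≤ ε := by
    intro ε hε
    refine eventually_forall_of_isCompact (P := fun b z => ‖F b z - F a z‖ ≤ ε) (isCompact_closedBall _ _)
      fun z hz => ?_
    have hz' : z ∈ Metric.ball (c a) r := Metric.closedBall_subset_ball (by linarith) hz
    have h1 : Tendsto (fun q : E × ℂ => F q.1 q.2) (𝓝 a ×ˢ 𝓝 z) (𝓝 (F a z)) := by
      rw [← nhds_prod_eq]; exact hFc z hz'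
    have h2 : Tendsto (fun q : E × ℂ => F a q.2) (𝓝 a ×ˢ 𝓝 z) (𝓝 (F a z)) :=
      (hF.self_of_nhds.differentiableAt (Metric.isOpen_ball.mem_nhds hz')).continuousAt.tendsto.comp tendsto_snd
    have h3 := (h1.sub h2).norm
    rw [sub_self, norm_zero] at h3
    exact (h3.eventually (gt_mem_nhds hε)).mono fun q hq => hq.le
  -- The map `F b - F a` is uniformly small on a disc, so by the Schwarz lemma its increment between
  -- `c b` and `u b` is `o(u b - c b)`. Up to this error `F b (u b)` is a combination of `F a (u
  -- b)`, `F b (c b)` and `F a (c b)`, all differentiable at `a`.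
  have ho : (fun b => (F b (u b) - F a (u b)) - (F b (c b) - F a (c b))) =o[𝓝 a] fun b => u b - c b := by
    rw [Asymptotics.isLittleO_iff]
    intro ε hε
    have h1 : ∀ᶠ b in 𝓝 a, c b ∈ Metric.ball (c a) (r / 4) :=
      hc.continuousAt.eventually (Metric.ball_mem_nhds _ (by positivity))
    have h2 : ∀ᶠ b in 𝓝 a, u b ∈ Metric.ball (c a) (r / 8) := by
      rw [← huc]; exact hu.continuousAt.eventually (Metric.ball_mem_nhds _ (by positivity))
    have h2' : ∀ᶠ b in 𝓝 a, c b ∈ Metric.ball (c a) (r / 8) :=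
      hc.continuousAt.eventually (Metric.ball_mem_nhds _ (by positivity))
    filter_upwards [h1, h2, h2', hF, hsmall (ε * r / 8) (by positivity)] with b h3 h4 h4' h5 h6
    have hsub : Metric.ball (c b) (r / 4) ⊆ Metric.closedBall (c a) (r / 2) := fun y hy => by
      rw [Metric.mem_ball] at hy h3; rw [Metric.mem_closedBall]
      linarith [dist_triangle y (c b) (c a)]
    have hsub' : Metric.closedBall (c a) (r / 2) ⊆ Metric.ball (c a) r :=
      Metric.closedBall_subset_ball (by linarith)
    have hcb : c b ∈ Metric.closedBall (c a) (r / 2) := hsub (Metric.mem_ball_self (by positivity))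
    have h7 := Complex.dist_le_div_mul_dist_of_mapsTo_ball (f := fun z => F b z - F a z) (c := c b)
      (R₁ := r / 4) (R₂ := ε * r / 4) (z := u b)
      ((h5.mono (hsub.trans hsub')).sub (hF.self_of_nhds.mono (hsub.trans hsub')))
      (fun y hy => by
        rw [Metric.mem_closedBall, dist_eq_norm]
        have h8 := norm_sub_le (F b y - F a y) (F b (c b) - F a (c b))
        linarith [h6 y (hsub hy), h6 (c b) hcb])
      (by
        rw [Metric.mem_ball] at h4 h4' ⊢
        rw [dist_comm] at h4'
        linarith [dist_triangle (u b) (c a) (c b)])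
    rw [dist_eq_norm, dist_eq_norm] at h7
    refine h7.trans (le_of_eq ?_)
    field_simp
  have hd1 : DifferentiableAt ℂ (fun b => (F b (u b) - F a (u b)) - (F b (c b) - F a (c b))) a := by
    have h1 := ho.trans_isBigO hO
    refine HasFDerivAt.differentiableAt (f' := 0) (HasFDerivAt.of_isLittleO ?_)
    simpa [huc] using h1
  have hd2 : DifferentiableAt ℂ (fun b => F a (u b)) a :=
    DifferentiableAt.comp a (by rw [huc]; exact hFa) hu
  have hd3 : DifferentiableAt ℂ (fun b => F a (c b)) a := DifferentiableAt.comp a hFa hc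
  have := ((hd1.add hd2).add hFd).sub hd3
  refine this.congr_of_eventuallyEq (Eventually.of_forall fun b => ?_)
  simp only [Pi.add_apply, Pi.sub_apply]
  ring

namespace LocalFamily

variable (F : LocalFamily X E)

/-- The domain `ψ_b(W)`. -/
def dom (b : E) : Set X := F.ψ b '' F.W

/-- The map `φ_b ∘ f ∘ ψ_b⁻¹`. -/
def map (b : E) : X → X := fun z => F.φ b (F.f ((F.ψ b).symm z))

variable {F} {b : E} {z : X}

theorem mem_dom_iff : z ∈ F.dom b ↔ (F.ψ b).symm z ∈ F.W := by
  constructor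
  · rintro ⟨w, hw, rfl⟩; simpa
  · exact fun h => ⟨_, h, by simp⟩

theorem map_ψ (w : X) : F.map b (F.ψ b w) = F.φ b (F.f w) := by simp [map]

theorem isOpen_dom : IsOpen (F.dom b) := (F.ψ b).isOpenMap _ F.isOpen_W

theorem mdifferentiableAt_map_of_mem (hb : b ∈ F.B) (hz : z ∈ F.dom b) :
    MDifferentiableAt 𝓘(ℂ) 𝓘(ℂ) (F.map b) z :=
  (F.mdiff_map b hb).mdifferentiableAt (isOpen_dom.mem_nhds hz)

theorem mdifferentiableAt_f (hz : z ∈ F.W) : MDifferentiableAt 𝓘(ℂ) 𝓘(ℂ) F.f z :=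
  F.mdiff_f.mdifferentiableAt (F.isOpen_W.mem_nhds hz)

variable [CompactSpace X] [ConnectedSpace X] [FiniteDimensional ℂ E]

theorem continuousAt_φ (hb : b ∈ F.B) (z : X) : ContinuousAt (fun q : E × X => F.φ q.1 q.2) (b, z) :=
  continuousAt_motion (by filter_upwards [F.isOpen_B.mem_nhds hb] with c hc w using F.mdiff_φ w c hc) z

theorem continuousAt_ψ (hb : b ∈ F.B) (z : X) : ContinuousAt (fun q : E × X => F.ψ q.1 q.2) (b, z) :=
  continuousAt_motion (by filter_upwards [F.isOpen_B.mem_nhds hb] with c hc w using F.mdiff_ψ w c hc) z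

theorem continuousAt_φ_symm (hb : b ∈ F.B) (z : X) :
    ContinuousAt (fun q : E × X => (F.φ q.1).symm q.2) (b, z) :=
  continuousAt_motion_symm (by filter_upwards [F.isOpen_B.mem_nhds hb] with c hc w using F.mdiff_φ w c hc) z

theorem continuousAt_ψ_symm (hb : b ∈ F.B) (z : X) :
    ContinuousAt (fun q : E × X => (F.ψ q.1).symm q.2) (b, z) :=
  continuousAt_motion_symm (by filter_upwards [F.isOpen_B.mem_nhds hb] with c hc w using F.mdiff_ψ w c hc) z

theorem eventually_mem_dom (hb : b ∈ F.B) (hz : z ∈ F.dom b) :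
    ∀ᶠ q : E × X in 𝓝 (b, z), q.2 ∈ F.dom q.1 := by
  filter_upwards [(continuousAt_ψ_symm hb z).eventually (F.isOpen_W.mem_nhds (mem_dom_iff.1 hz))] with q hq
  exact mem_dom_iff.2 hq

theorem continuousAt_map (hb : b ∈ F.B) (hz : z ∈ F.dom b) :
    ContinuousAt (fun q : E × X => F.map q.1 q.2) (b, z) := by
  have h1 := continuousAt_ψ_symm hb z
  have h2 : ContinuousAt (fun q : E × X => F.f ((F.ψ q.1).symm q.2)) (b, z) :=
    ContinuousAt.comp (g := F.f) (mdifferentiableAt_f (mem_dom_iff.1 hz)).continuousAt h1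
  exact ContinuousAt.comp (f := fun q : E × X => (q.1, F.f ((F.ψ q.1).symm q.2)))
    (continuousAt_φ hb _) (continuousAt_fst.prodMk h2)

/-- Although `(ψ y).symm` need not be holomorphic in `y`, there is one curve through `g b` along
which holomorphy is evident: on `y ↦ ψ y w` the map equals `φ y (f w)`. By
`differentiableAt_of_curve` this suffices for every other curve through that point. -/
theorem mdifferentiableAt_map {g : E → X} (hb : b ∈ F.B) (hg : MDifferentiableAt 𝓘(ℂ, E) 𝓘(ℂ) g b)
    (hgb : g b ∈ F.dom b) : MDifferentiableAt 𝓘(ℂ, E) 𝓘(ℂ) (fun y => F.map y (g y)) b := by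
  set e := discChart (g b)
  have he := isDiscChart_discChart (g b)
  set d := discChart (F.map b (g b))
  have hd := isDiscChart_discChart (F.map b (g b))
  set w := (F.ψ b).symm (g b)
  have hw : F.ψ b w = g b := by simp [w]
  have hcont : ContinuousAt (fun y => F.map y (g y)) b :=
    ContinuousAt.comp (f := fun y => (y, g y)) (continuousAt_map hb hgb)
      (continuousAt_id.prodMk hg.continuousAt)
  refine mdifferentiableAt_of_chart_comp hd.mdiff hcont hd.mem ?_
  have hψ : MDifferentiableAt 𝓘(ℂ, E) 𝓘(ℂ) (fun y => F.ψ y w) b := F.mdiff_ψ w b hb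
  have hes : ContinuousAt e.symm (e (g b)) := e.continuousAt_symm (e.map_source he.mem)
  -- the set where everything is defined
  have hev : ∀ᶠ q : E × ℂ in 𝓝 (b, e (g b)), q.2 ∈ e.target ∧ q.1 ∈ F.B ∧ e.symm q.2 ∈ F.dom q.1 ∧
      F.map q.1 (e.symm q.2) ∈ d.source := by
    have h1 : ContinuousAt (fun q : E × ℂ => (q.1, e.symm q.2)) (b, e (g b)) :=
      continuousAt_fst.prodMk (ContinuousAt.comp (f := fun q : E × ℂ => q.2) hes continuousAt_snd)
    have h2 : (b, e.symm (e (g b))) = (b, g b) := by rw [e.left_inv he.mem]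
    have h3 : Tendsto (fun q : E × ℂ => (q.1, e.symm q.2)) (𝓝 (b, e (g b))) (𝓝 (b, g b)) := h2 ▸ h1
    filter_upwards [continuousAt_snd.eventually (e.open_target.mem_nhds (e.map_source he.mem)),
      continuousAt_fst.eventually (F.isOpen_B.mem_nhds hb), h3.eventually (eventually_mem_dom hb hgb),
      h3.eventually ((continuousAt_map hb hgb).eventually (d.open_source.mem_nhds hd.mem))]
      with q h4 h5 h6 h7 using ⟨h4, h5, h6, h7⟩
  rw [nhds_prod_eq] at hev
  obtain ⟨pa, hpa, pb, hpb, hab⟩ := eventually_prod_iff.1 hev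
  obtain ⟨r, hr, hball⟩ := Metric.eventually_nhds_iff_ball.1 hpb
  have key := differentiableAt_of_curve (F := fun y z => d (F.map y (e.symm z))) (a := b)
    (u := fun y => e (g y)) (c := fun y => e (F.ψ y w)) (r := r) hr
    (differentiableAt_chart_comp he.mdiff hg he.mem)
    (differentiableAt_chart_comp he.mdiff hψ (by rw [hw]; exact he.mem)) (by simp only [hw]) ?_ ?_ ?_
  · refine key.congr_of_eventuallyEq ?_
    filter_upwards [hg.continuousAt.eventually (e.open_source.mem_nhds he.mem)] with y hy
    rw [e.left_inv hy]
  · filter_upwards [hpa] with y hy z hz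
    simp only [hw] at hz
    obtain ⟨h1, h2, h3, h4⟩ := hab hy (hball z hz)
    refine (differentiableAt_chart_comp (g := fun z => F.map y (e.symm z)) hd.mdiff ?_ h4).differentiableWithinAt
    exact (mdifferentiableAt_map_of_mem h2 h3).comp z (he.mdiff.mdifferentiableAt_symm h1)
  · intro z hz
    simp only [hw] at hz
    obtain ⟨h1, h2, h3, h4⟩ := hab hpa.self_of_nhds (hball z hz)
    have h5 : ContinuousAt (fun q : E × ℂ => (q.1, e.symm q.2)) (b, z) :=
      continuousAt_fst.prodMk (ContinuousAt.comp (f := fun q : E × ℂ => q.2) (e.continuousAt_symm h1)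
        continuousAt_snd)
    have h6 : ContinuousAt (fun q : E × ℂ => F.map q.1 (e.symm q.2)) (b, z) :=
      ContinuousAt.comp (f := fun q : E × ℂ => (q.1, e.symm q.2)) (continuousAt_map hb h3) h5
    exact ContinuousAt.comp (f := fun q : E × ℂ => F.map q.1 (e.symm q.2)) (d.continuousAt h4) h6
  · have h1 : DifferentiableAt ℂ (fun y => d (F.φ y (F.f w))) b := by
      refine differentiableAt_chart_comp hd.mdiff (F.mdiff_φ _ b hb) ?_
      have : F.map b (g b) = F.φ b (F.f w) := rfl
      rw [← this]; exact hd.mem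
    refine h1.congr_of_eventuallyEq ?_
    filter_upwards [hψ.continuousAt.eventually (e.open_source.mem_nhds (by simp only [hw]; exact he.mem))] with y hy
    rw [e.left_inv hy, map_ψ]

end LocalFamily

theorem IterDefined.mono {W : Set X} {f : X → X} {m n : ℕ} {z : X} (h : IterDefined W f n z)
    (hmn : m ≤ n) : IterDefined W f m z := fun j hj => h j (hj.trans_le hmn)

theorem iterDefined_succ {W : Set X} {f : X → X} {n : ℕ} {z : X} :
    IterDefined W f (n + 1) z ↔ IterDefined W f n z ∧ f^[n] z ∈ W := by
  constructor
  · exact fun h => ⟨h.mono n.le_succ, h n n.lt_succ_self⟩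
  · rintro ⟨h1, h2⟩ j hj
    rcases Nat.lt_succ_iff_lt_or_eq.1 hj with h | rfl
    exacts [h1 j h, h2]

theorem iterDefined_add {W : Set X} {f : X → X} {m n : ℕ} {z : X} :
    IterDefined W f (m + n) z ↔ IterDefined W f n z ∧ IterDefined W f m (f^[n] z) := by
  constructor
  · refine fun h => ⟨h.mono (Nat.le_add_left n m), fun j hj => ?_⟩
    rw [← Function.iterate_add_apply]
    exact h _ (by omega)
  · rintro ⟨h1, h2⟩ j hj
    rcases lt_or_ge j n with h | h
    · exact h1 j h
    · obtain ⟨k, rfl⟩ := Nat.exists_eq_add_of_le' h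
      rw [Function.iterate_add_apply]
      exact h2 k (by omega)

theorem IterDefined.add_mul_period {W : Set X} {f : X → X} {n p : ℕ} {z x : X}
    (h : IterDefined W f n z) (hz : f^[n] z = x) (hx : IterDefined W f p x) (hp : f^[p] x = x) (k : ℕ) :
    IterDefined W f (n + k * p) z ∧ f^[n + k * p] z = x := by
  induction k with
  | zero => simpa using ⟨h, hz⟩
  | succ k ih =>
    have : n + (k + 1) * p = p + (n + k * p) := by ring
    rw [this, iterDefined_add, Function.iterate_add_apply f p, ih.2]
    exact ⟨⟨ih.1, hx⟩, hp⟩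

namespace LocalFamily

variable {F : LocalFamily X E} {b : E} [CompactSpace X] [ConnectedSpace X] [FiniteDimensional ℂ E]

theorem mdifferentiableAt_iterate {g : E → X} {n : ℕ} (hb : b ∈ F.B)
    (hg : MDifferentiableAt 𝓘(ℂ, E) 𝓘(ℂ) g b) (h : IterDefined (F.dom b) (F.map b) n (g b)) :
    MDifferentiableAt 𝓘(ℂ, E) 𝓘(ℂ) (fun y => (F.map y)^[n] (g y)) b := by
  induction n with
  | zero => simpa using hg
  | succ n ih =>
    obtain ⟨h1, h2⟩ := iterDefined_succ.1 h
    simp only [Function.iterate_succ_apply']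
    exact mdifferentiableAt_map hb (ih h1) h2

theorem continuousAt_iterate {z : X} {n : ℕ} (hb : b ∈ F.B) (h : IterDefined (F.dom b) (F.map b) n z) :
    ContinuousAt (fun q : E × X => (F.map q.1)^[n] q.2) (b, z) := by
  induction n with
  | zero => simpa using continuousAt_snd
  | succ n ih =>
    obtain ⟨h1, h2⟩ := iterDefined_succ.1 h
    simp only [Function.iterate_succ_apply']
    exact ContinuousAt.comp (f := fun q : E × X => (q.1, (F.map q.1)^[n] q.2)) (continuousAt_map hb h2)
      (continuousAt_fst.prodMk (ih h1))

theorem eventually_iterDefined {z : X} {n : ℕ} (hb : b ∈ F.B) (h : IterDefined (F.dom b) (F.map b) n z) :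
    ∀ᶠ q : E × X in 𝓝 (b, z), IterDefined (F.dom q.1) (F.map q.1) n q.2 := by
  induction n with
  | zero => exact Eventually.of_forall fun q j hj => absurd hj (Nat.not_lt_zero j)
  | succ n ih =>
    obtain ⟨h1, h2⟩ := iterDefined_succ.1 h
    have h3 : ContinuousAt (fun q : E × X => (q.1, (F.map q.1)^[n] q.2)) (b, z) :=
      continuousAt_fst.prodMk (continuousAt_iterate hb h1)
    filter_upwards [ih h1, h3.eventually (eventually_mem_dom hb h2)] with q h4 h5
    exact iterDefined_succ.2 ⟨h4, h5⟩

end LocalFamily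

end IslandMaps

namespace IslandMaps

variable {X : Type*} [TopologicalSpace X] [ChartedSpace ℂ X] [IsManifold 𝓘(ℂ) 1 X] [T2Space X]

/-! ### Holomorphic maps between surfaces -/

theorem tendsto_nhdsNE_chart {e : OpenPartialHomeomorph X ℂ} {z : X} (hz : z ∈ e.source) :
    Tendsto e (𝓝[≠] z) (𝓝[≠] (e z)) := by
  refine tendsto_nhdsWithin_iff.2 ⟨(e.continuousAt hz).tendsto.mono_left nhdsWithin_le_nhds, ?_⟩
  filter_upwards [self_mem_nhdsWithin, nhdsWithin_le_nhds (e.open_source.mem_nhds hz)] with w h1 h2 h3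
  exact h1 (e.injOn h2 hz h3)

theorem eventually_mdifferentiableAt_comp_symm {e : OpenPartialHomeomorph X ℂ}
    (he : e.MDifferentiable 𝓘(ℂ) 𝓘(ℂ)) {f : X → X} {z : X} (hz : z ∈ e.source)
    (hf : ∀ᶠ w in 𝓝 z, MDifferentiableAt 𝓘(ℂ) 𝓘(ℂ) f w) :
    ∀ᶠ y in 𝓝 (e z), MDifferentiableAt 𝓘(ℂ) 𝓘(ℂ) (fun y => f (e.symm y)) y := by
  have h1 : Tendsto e.symm (𝓝 (e z)) (𝓝 z) := by
    have := e.continuousAt_symm (e.map_source hz)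
    rwa [ContinuousAt, e.left_inv hz] at this
  filter_upwards [h1.eventually hf, e.open_target.mem_nhds (e.map_source hz)] with y h2 h3
  exact h2.comp y (he.mdifferentiableAt_symm h3)

theorem eventually_eq_or_eventually_ne {f : X → X} {z q : X}
    (hf : ∀ᶠ w in 𝓝 z, MDifferentiableAt 𝓘(ℂ) 𝓘(ℂ) f w) :
    (∀ᶠ w in 𝓝 z, f w = q) ∨ ∀ᶠ w in 𝓝[≠] z, f w ≠ q := by
  set e := discChart z
  have he := isDiscChart_discChart z
  have hs := e.open_source.mem_nhds he.mem
  rcases eventually_eq_or_eventually_ne_of_mdifferentiable (b := fun _ => q)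
    (eventually_mdifferentiableAt_comp_symm he.mdiff he.mem hf)
    (Eventually.of_forall fun y => mdifferentiableAt_const) with h | h
  · left
    filter_upwards [(e.continuousAt he.mem).eventually h, hs] with w h1 h2
    rwa [e.left_inv h2] at h1
  · right
    filter_upwards [(tendsto_nhdsNE_chart he.mem).eventually h, nhdsWithin_le_nhds hs] with w h1 h2
    rwa [e.left_inv h2] at h1

/-- The open mapping theorem for surfaces. -/
theorem nhds_le_map_nhds {f : X → X} {z : X} (hf : ∀ᶠ w in 𝓝 z, MDifferentiableAt 𝓘(ℂ) 𝓘(ℂ) f w)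
    (hne : ¬ ∀ᶠ w in 𝓝 z, f w = f z) : 𝓝 (f z) ≤ map f (𝓝 z) := by
  set e := discChart z
  have he := isDiscChart_discChart z
  set d := discChart (f z)
  have hd := isDiscChart_discChart (f z)
  have hez : f (e.symm (e z)) = f z := by rw [e.left_inv he.mem]
  have hm := eventually_mdifferentiableAt_comp_symm he.mdiff he.mem hf
  have hana : AnalyticAt ℂ (fun y => d (f (e.symm y))) (e z) :=
    analyticAt_chart_comp (h := fun y => f (e.symm y)) hd.mdiff hm (by rw [hez]; exact hd.mem)
  have hsrc : ∀ᶠ w in 𝓝 z, w ∈ e.source ∧ f w ∈ d.source :=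
    (show ∀ᶠ w in 𝓝 z, w ∈ e.source from e.open_source.mem_nhds he.mem).and (hf.self_of_nhds.continuousAt.eventually (d.open_source.mem_nhds hd.mem))
  rcases hana.eventually_constant_or_nhds_le_map_nhds with h | h
  · refine absurd ?_ hne
    filter_upwards [(e.continuousAt he.mem).eventually h, hsrc] with w h1 h2
    rw [e.left_inv h2.1, hez] at h1
    exact d.injOn h2.2 hd.mem h1
  · intro s hs
    rw [mem_map] at hs
    have h1 : Tendsto e.symm (𝓝 (e z)) (𝓝 z) := by
      have := e.continuousAt_symm (e.map_source he.mem)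
      rwa [ContinuousAt, e.left_inv he.mem] at this
    have h2 : (fun y => d (f (e.symm y))) '' {y | f (e.symm y) ∈ s ∧ f (e.symm y) ∈ d.source} ∈ 𝓝 (d (f z)) := by
      rw [← hez]
      refine h (mem_map.2 ?_)
      filter_upwards [h1.eventually hs, h1.eventually hsrc] with y h3 h4
      exact ⟨y, ⟨h3, h4.2⟩, rfl⟩
    filter_upwards [(d.continuousAt hd.mem).eventually h2, d.open_source.mem_nhds hd.mem] with w hw hws
    obtain ⟨y, ⟨h3, h4⟩, h5⟩ := hw
    rw [← d.injOn h4 hws h5]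
    exact h3

theorem isPreconnected_punctured_ball (r : ℝ) : IsPreconnected (Metric.ball (0 : ℂ) r \ {0}) := by
  rcases le_or_gt r 0 with hr | hr
  · rw [Metric.ball_eq_empty.2 hr, empty_sdiff]; exact isPreconnected_empty
  · have h1 : Metric.ball (0 : ℂ) r \ {0} = Complex.exp '' {z | z.re < Real.log r} := by
      ext z
      constructor
      · rintro ⟨h1, h2⟩
        refine ⟨Complex.log z, ?_, Complex.exp_log h2⟩
        rw [mem_ofPred_eq, Complex.log_re]
        exact Real.log_lt_log (norm_pos_iff.2 h2) (by simpa using h1)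
      · rintro ⟨w, hw, rfl⟩
        refine ⟨?_, Complex.exp_ne_zero w⟩
        rw [mem_ball_zero_iff, Complex.norm_exp]
        exact (Real.lt_log_iff_exp_lt hr).1 hw
    rw [h1]
    exact (convex_halfSpace_re_lt _).isPreconnected.image _ Complex.continuous_exp.continuousOn

/-- If `W` has finite boundary, a holomorphic map on `W` which is constant near one point of `W` is
constant on `W`. -/
theorem eq_const_of_finite_frontier [ConnectedSpace X] {W : Set X} {f : X → X} {q : X} (hW : IsOpen W)
    (hf : MDifferentiableOn 𝓘(ℂ) 𝓘(ℂ) f W) (hfin : (frontier W).Finite) {z₀ : X} (hz₀ : z₀ ∈ W)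
    (h : ∀ᶠ w in 𝓝 z₀, f w = q) : ∀ w ∈ W, f w = q := by
  have hfd : ∀ z ∈ W, ∀ᶠ w in 𝓝 z, MDifferentiableAt 𝓘(ℂ) 𝓘(ℂ) f w := fun z hz => by
    filter_upwards [hW.mem_nhds hz] with w hw using hf.mdifferentiableAt (hW.mem_nhds hw)
  set Z := W ∩ {z | ∀ᶠ w in 𝓝 z, f w = q}
  have hZo : IsOpen Z := hW.inter isOpen_setOfPred_eventually_nhds
  have hcl : ∀ z ∈ W, z ∈ closure Z → z ∈ Z := by
    intro z hzW hz
    by_contra hzZ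
    refine hzZ ⟨hzW, (eventually_eq_or_eventually_ne (hfd z hzW)).resolve_right fun hne => ?_⟩
    obtain ⟨y, hy1, hy2⟩ := ((mem_closure_iff_frequently.1 hz).and_eventually
      (eventually_nhdsWithin_iff.1 hne)).exists
    exact hy2 (fun hyz => hzZ (hyz ▸ hy1)) hy1.2.self_of_nhds
  have hfr : frontier Z ⊆ frontier W := by
    intro z hz
    rw [hZo.frontier_eq] at hz
    rw [hW.frontier_eq]
    exact ⟨closure_mono inter_subset_left hz.1, fun hzW => hz.2 (hcl z hzW hz.1)⟩
  -- The frontier of `Z` is finite, and a finite set does not separate a surface locally. A small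
  -- punctured disc about a frontier point is connected and meets no other frontier point, so it
  -- lies entirely in `Z`.
  have hopen : IsOpen (closure Z) := by
    rw [isOpen_iff_mem_nhds]
    intro z hz
    by_cases hzZ : z ∈ Z
    · exact mem_of_superset (hZo.mem_nhds hzZ) subset_closure
    set e := discChart z
    have he := isDiscChart_discChart z
    have hnear : ∀ᶠ w in 𝓝 z, w ∉ frontier Z \ {z} :=
      ((hfin.subset hfr).subset sdiff_subset).isClosed.isOpen_compl.mem_nhds fun h' => h'.2 rfl
    have h1 : Tendsto e.symm (𝓝 0) (𝓝 z) := by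
      have := e.continuousAt_symm (e.map_source he.mem)
      rwa [ContinuousAt, e.left_inv he.mem, he.map_eq] at this
    obtain ⟨r, hr, hball⟩ := Metric.eventually_nhds_iff_ball.1 ((h1.eventually hnear).and
      (e.open_target.mem_nhds (he.subset (by simp))))
    set S := e.symm '' (Metric.ball 0 r \ {0})
    have hSc : IsPreconnected S := (isPreconnected_punctured_ball r).image _
      (e.continuousOn_symm.mono fun y hy => (hball y hy.1).2)
    have hmem : ∀ᶠ w in 𝓝 z, w ≠ z → w ∈ S := by
      have h2 : ∀ᶠ w in 𝓝 z, e w ∈ Metric.ball 0 r := by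
        refine (e.continuousAt he.mem).eventually ?_
        rw [he.map_eq]; exact Metric.ball_mem_nhds 0 hr
      filter_upwards [h2, e.open_source.mem_nhds he.mem] with w h3 h4 h5
      refine ⟨e w, ⟨h3, fun h6 => h5 (e.injOn h4 he.mem ?_)⟩, e.left_inv h4⟩
      rw [h6, he.map_eq]
    have hSZ : (S ∩ Z).Nonempty := by
      obtain ⟨w, hw1, hw2⟩ := ((mem_closure_iff_frequently.1 hz).and_eventually hmem).exists
      exact ⟨w, hw2 fun h' => hzZ (h' ▸ hw1), hw1⟩
    have hSsub : S ⊆ Z := by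
      refine hSc.subset_of_closure_inter_subset hZo hSZ fun y hy => ?_
      obtain ⟨hyc, hyS⟩ := hy
      by_contra hyZ
      have hyF : y ∈ frontier Z := by rw [hZo.frontier_eq]; exact ⟨hyc, hyZ⟩
      obtain ⟨t, ht, rfl⟩ := hyS
      refine (hball t ht.1).1 ⟨hyF, fun h' => ht.2 ?_⟩
      rw [mem_singleton_iff] at h' ⊢
      have h2 : e (e.symm t) = t := e.right_inv (hball t ht.1).2
      rw [← h2, h', he.map_eq]
    filter_upwards [hmem] with w hw
    by_cases hwz : w = z
    · rwa [hwz]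
    · exact subset_closure (hSsub (hw hwz))
  have huniv : closure Z = univ := (isClopen_iff.1 ⟨isClosed_closure, hopen⟩).resolve_left fun h' =>
    notMem_empty z₀ (h' ▸ subset_closure ⟨hz₀, h⟩)
  exact fun w hw => (hcl w hw (huniv ▸ mem_univ w)).2.self_of_nhds

/-! ### Backward orbits of repelling periodic points -/

/-- The points of the backward orbit of `x` near which the iterate of `f` that sends them to `x` is
not constant. -/
def backwardOrbit (W : Set X) (f : X → X) (x : X) : Set X :=
  {z | ∃ m, IterDefined W f m z ∧ f^[m] z = x ∧ ∀ᶠ w in 𝓝[≠] z, f^[m] w ≠ x}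

theorem eventually_mul_norm_le_of_multiplier {F : X → X} {x : X}
    (hF : MDifferentiableAt 𝓘(ℂ) 𝓘(ℂ) F x) (hx : F x = x) {κ : ℝ} (hκ : κ < ‖multiplier F x‖) :
    ∀ᶠ w in 𝓝 x, κ * ‖chartAt ℂ x w - chartAt ℂ x x‖ ≤ ‖chartAt ℂ x (F w) - chartAt ℂ x x‖ := by
  set c := chartAt ℂ x
  have hcm : c.MDifferentiable 𝓘(ℂ) 𝓘(ℂ) := mdifferentiable_chart x
  have hxs : x ∈ c.source := mem_chart_source ℂ x
  have hcx : c.symm (c x) = x := c.left_inv hxs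
  have hd : DifferentiableAt ℂ (fun z => c (F (c.symm z))) (c x) := by
    refine differentiableAt_chart_comp (g := fun z => F (c.symm z)) hcm ?_ (by rw [hcx, hx]; exact hxs)
    exact MDifferentiableAt.comp (c x) (by rw [hcx]; exact hF) (hcm.mdifferentiableAt_symm (c.map_source hxs))
  have hd' := hd.hasDerivAt
  have hmul : deriv (fun z => c (F (c.symm z))) (c x) = multiplier F x := rfl
  rw [hmul, hasDerivAt_iff_isLittleO] at hd'
  have h1 := hd'.def (sub_pos.2 hκ)
  filter_upwards [(c.continuousAt hxs).eventually h1, c.open_source.mem_nhds hxs] with w h2 h3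
  rw [c.left_inv h3, hcx, hx] at h2
  have h4 := norm_sub_norm_le ((c w - c x) • multiplier F x) (c (F w) - c x)
  rw [norm_smul, norm_sub_rev ((c w - c x) • multiplier F x)] at h4
  nlinarith

/-- A holomorphic self-map of a compact surface cannot have a repelling fixed point `x` with
`F⁻¹(x) = {x}` if there is a backward invariant nonempty open set `A` with `x ∉ closure A`. -/
theorem false_of_backward_invariant [CompactSpace X] [ConnectedSpace X] {F : X → X}
    (hF : MDifferentiable 𝓘(ℂ) 𝓘(ℂ) F) {x : X} (hx : F x = x) (hμ : 1 < ‖multiplier F x‖)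
    {A : Set X} (hA : IsOpen A) (hAne : A.Nonempty) (hxA : x ∉ closure A)
    (hAF : ∀ w, F w ∈ A → w ∈ A) : False := by
  set c := chartAt ℂ x
  have hcm : c.MDifferentiable 𝓘(ℂ) 𝓘(ℂ) := mdifferentiable_chart x
  have hxs : x ∈ c.source := mem_chart_source ℂ x
  have hcx : c.symm (c x) = x := c.left_inv hxs
  have hsymm : Tendsto c.symm (𝓝 (c x)) (𝓝 x) := by
    have := c.continuousAt_symm (c.map_source hxs)
    rwa [ContinuousAt, hcx] at this
  obtain ⟨κ, hκ1, hκ⟩ := exists_between hμ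
  -- expansion near the fixed point
  have hexp := eventually_mul_norm_le_of_multiplier (hF x) hx hκ
  obtain ⟨s, hs, hsball⟩ := Metric.eventually_nhds_iff_ball.1 ((hsymm.eventually hexp).and
    (c.open_target.mem_nhds (c.map_source hxs)))
  obtain ⟨R, hR, hRball⟩ := Metric.eventually_nhds_iff_ball.1 ((hsymm.eventually
    (isClosed_closure.isOpen_compl.mem_nhds hxA)).and (c.open_target.mem_nhds (c.map_source hxs)))
  set N : Set X := {w | w ∈ c.source ∧ ‖c w - c x‖ < s}
  have hN : N ∈ 𝓝 x := by
    filter_upwards [c.open_source.mem_nhds hxs, (c.continuousAt hxs).eventually (Metric.ball_mem_nhds _ hs)]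
      with w h1 h2
    exact ⟨h1, by rwa [dist_eq_norm] at h2⟩
  have hNexp : ∀ w ∈ N, κ * ‖c w - c x‖ ≤ ‖c (F w) - c x‖ := by
    rintro w ⟨h1, h2⟩
    have h3 := (hsball (c w) (by rwa [Metric.mem_ball, dist_eq_norm])).1
    rwa [c.left_inv h1] at h3
  have hFk : ∀ k, MDifferentiable 𝓘(ℂ) 𝓘(ℂ) F^[k] := by
    intro k
    induction k with
    | zero => exact mdifferentiable_id
    | succ k ih => rw [Function.iterate_succ]; exact ih.comp hF
  have hFx : ∀ k, F^[k] x = x := fun k => Function.iterate_fixed hx k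
  set g : ℕ → ℂ → X := fun k z => F^[k] (c.symm z)
  have hg : ∀ k, ∀ z ∈ Metric.ball (c x) R, MDifferentiableAt 𝓘(ℂ) 𝓘(ℂ) (g k) z := fun k z hz =>
    (hFk k _).comp z (hcm.mdifferentiableAt_symm (hRball z hz).2)
  obtain ⟨J, -, hJ⟩ := exists_finset_discChart x
  -- the iterates are not equicontinuous
  have hbad : ∀ r > 0, ∃ k, ∃ b ∈ Metric.ball (c x) r, ¬ MapsToDisc J (g k) b r := by
    by_contra! hcon
    obtain ⟨r, hr, hgood⟩ := hcon
    -- Confinement of all iterates would make them equicontinuous at the fixed point. Small orbits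
    -- would then stay forever in `N`, where every step expands distances to the fixed point by the
    -- factor `κ > 1`, which is absurd.
    have hequi : ∃ δ > 0, ∀ k, ∀ z ∈ Metric.ball (c x) δ, g k z ∈ N := by
      by_contra! hno
      choose k z hz hzN using fun n : ℕ => hno (1 / ((n : ℝ) + 1)) (by positivity)
      have hz0 : Tendsto z atTop (𝓝 (c x)) := by
        rw [tendsto_iff_dist_tendsto_zero]
        exact squeeze_zero (fun n => dist_nonneg) (fun n => (hz n).le) tendsto_one_div_add_atTop_nhds_zero_nat
      obtain ⟨x', hx'⟩ := exists_contConvAt (l := hyperfilter ℕ) (J := J) (H := fun n => g (k n)) (a := c x)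
        (s := min r R) (lt_min hr hR)
        (Eventually.of_forall fun n => by
          obtain ⟨p, hp, h⟩ := hgood (k n) (c x) (Metric.mem_ball_self hr)
          exact ⟨p, hp, h.mono_left (Metric.ball_subset_ball (min_le_left _ _))⟩)
        (Eventually.of_forall fun n y hy => hg _ y (Metric.ball_subset_ball (min_le_right _ _) hy))
      have h1 : Tendsto (fun n => g (k n) (c x)) (hyperfilter ℕ) (𝓝 x') :=
        hx'.comp (tendsto_id.prodMk tendsto_const_nhds)
      have h2 : Tendsto (fun n => g (k n) (z n)) (hyperfilter ℕ) (𝓝 x') :=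
        hx'.comp (tendsto_id.prodMk (hz0.mono_left Nat.hyperfilter_le_atTop))
      have h3 : x' = x := by
        refine tendsto_nhds_unique h1 ?_
        have : (fun n => g (k n) (c x)) = fun _ => x := by
          funext n; simp only [g]; rw [hcx, hFx]
        rw [this]; exact tendsto_const_nhds
      rw [h3] at h2
      obtain ⟨n, hn⟩ := (h2.eventually hN).exists
      exact hzN n hn
    obtain ⟨δ, hδ, hδN⟩ := hequi
    set δ' := min δ R / 2
    have hδ' : 0 < δ' := by positivity
    have hz : c x + δ' ∈ Metric.ball (c x) (min δ R) := by
      rw [Metric.mem_ball, dist_eq_norm, add_sub_cancel_left, Complex.norm_real, Real.norm_of_nonneg hδ'.le]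
      exact half_lt_self (by positivity)
    have hz1 := Metric.ball_subset_ball (min_le_left _ _) hz
    have hz2 := Metric.ball_subset_ball (min_le_right _ _) hz
    have hgrow : ∀ k, κ ^ k * δ' ≤ ‖c (g k (c x + δ')) - c x‖ := by
      intro k
      induction k with
      | zero =>
        simp only [g, Function.iterate_zero, id]
        rw [c.right_inv (hRball _ hz2).2, add_sub_cancel_left, Complex.norm_real, Real.norm_of_nonneg hδ'.le]
        simp
      | succ k ih =>
        have h1 := hNexp _ (hδN k _ hz1)
        have h2 : F (g k (c x + δ')) = g (k + 1) (c x + δ') := (Function.iterate_succ_apply' F k _).symm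
        rw [h2] at h1
        rw [pow_succ]
        nlinarith
    obtain ⟨k, hk⟩ := pow_unbounded_of_one_lt (s / δ') hκ1
    rw [div_lt_iff₀ hδ'] at hk
    linarith [hgrow k, (hδN k _ hz1).2]
  obtain ⟨i, μ, ρ, u, h, -, hρ, hμ0, hh, h01, hcc⟩ := exists_rescaling (J := J) hJ hR hg hbad
  refine h01 (eq_of_infinite_omitted hh ((infinite_of_isOpen hA hAne).mono ?_) 0 1)
  -- The rescaled iterates start near `x`, outside `closure A`. By backward invariance of `A` they
  -- never enter `A`, so their limit cannot take a value in the open set `A`.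
  rintro w hw ⟨z, rfl⟩
  have hAc : ∀ k w, F^[k] w ∈ A → w ∈ A := by
    intro k
    induction k with
    | zero => exact fun w h => h
    | succ k ih => exact fun w h => hAF _ (ih _ h)
  have h1 := (contConvAt_affine (u := u) hρ hμ0 z).tendsto.eventually (Metric.ball_mem_nhds (c x) hR)
  obtain ⟨k, h2, h3⟩ := (((hcc z).tendsto.eventually (hA.mem_nhds hw)).and h1).exists
  exact (hRball _ h3).1 (subset_closure (hAc _ _ h2))

/-- If `Wᶜ` is finite, the map is nowhere locally constant, since otherwise it would be constant and
`x` would be fixed. If moreover `W ≠ X`, non-exceptionality gives infinitely many first preimages.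
If `W = X` and the backward orbit is finite, the map permutes it and `f^[p]` has `x` as its only
preimage of `x`. Such a repelling point is excluded by `false_of_backward_invariant`. -/
theorem infinite_compl_union_backwardOrbit [CompactSpace X] [ConnectedSpace X] {W : Set X} {f : X → X}
    (hW : IsOpen W) (hf : MDifferentiableOn 𝓘(ℂ) 𝓘(ℂ) f W) {p : ℕ} {x : X} (hp : 2 ≤ p)
    (hx : IsRepellingPeriodicPt W f p x) (hpic : ¬ IsPicardExceptional W f x) :
    (Wᶜ ∪ backwardOrbit W f x).Infinite := by
  intro hfin
  have hWc : Wᶜ.Finite := hfin.subset subset_union_left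
  have hBO : (backwardOrbit W f x).Finite := hfin.subset subset_union_right
  have hfd : ∀ z ∈ W, ∀ᶠ w in 𝓝 z, MDifferentiableAt 𝓘(ℂ) 𝓘(ℂ) f w := fun z hz => by
    filter_upwards [hW.mem_nhds hz] with w hw using hf.mdifferentiableAt (hW.mem_nhds hw)
  have hfr : (frontier W).Finite := hWc.subset (by
    rw [hW.frontier_eq]; exact fun z hz => hz.2)
  have hxW : x ∈ W := hx.defined 0 (by omega)
  have hper : f^[p] x = x := by
    have := Function.iterate_minimalPeriod (f := f) (x := x)
    rwa [hx.period] at this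
  have hfx : f x ≠ x := fun h => by
    have h1 : Function.IsPeriodicPt f 1 x := h
    have := h1.minimalPeriod_le one_pos
    rw [hx.period] at this
    omega
  have hnc : ∀ z ∈ W, ∀ q, ¬ ∀ᶠ w in 𝓝 z, f w = q := by
    intro z hz q hq
    have hall := eq_const_of_finite_frontier hW hf hfr hz hq
    have h1 : f x = q := hall x hxW
    have h2 : f q = q := by
      rw [← h1]
      refine (hall (f x) ?_).trans h1.symm
      simpa using hx.defined 1 (by omega)
    obtain ⟨k, rfl⟩ : ∃ k, p = k + 1 := ⟨p - 1, by omega⟩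
    rw [Function.iterate_succ_apply, h1, Function.iterate_fixed h2] at hper
    exact hfx (h1.trans hper)
  have hiso : ∀ z ∈ W, ∀ q, ∀ᶠ w in 𝓝[≠] z, f w ≠ q := fun z hz q =>
    (eventually_eq_or_eventually_ne (hfd z hz)).resolve_left (hnc z hz q)
  by_cases hne : (frontier W).Nonempty
  · refine hpic ⟨hne, hBO.subset ?_⟩
    rintro z ⟨hz, hzx⟩
    refine ⟨1, fun j hj => ?_, hzx, hiso z hz x⟩
    obtain rfl : j = 0 := by omega
    exact hz
  have hWu : W = univ := by
    rw [not_nonempty_iff_eq_empty, frontier_eq_empty_iff] at hne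
    exact hne.resolve_left fun h => notMem_empty x (h ▸ hxW)
  subst hWu
  have hfm : MDifferentiable 𝓘(ℂ) 𝓘(ℂ) f := mdifferentiableOn_univ.1 hf
  have hfc : Continuous f := hfm.continuous
  have hisok : ∀ m z, ∀ᶠ w in 𝓝[≠] z, f^[m] w ≠ f^[m] z := by
    intro m
    induction m with
    | zero => exact fun z => self_mem_nhdsWithin
    | succ m ih =>
      intro z
      have h1 : Tendsto f (𝓝[≠] z) (𝓝[≠] (f z)) :=
        tendsto_nhdsWithin_iff.2 ⟨hfc.continuousAt.tendsto.mono_left nhdsWithin_le_nhds,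
          hiso z (mem_univ z) (f z)⟩
      exact h1.eventually (ih (f z))
  have hBOeq : ∀ z, z ∈ backwardOrbit univ f x ↔ ∃ m, f^[m] z = x := by
    intro z
    constructor
    · rintro ⟨m, -, h, -⟩; exact ⟨m, h⟩
    · rintro ⟨m, rfl⟩
      exact ⟨m, fun j _ => mem_univ _, rfl, hisok m z⟩
  set Bo := backwardOrbit univ f x
  have hBpre : ∀ z, f z ∈ Bo → z ∈ Bo := fun z hz => by
    obtain ⟨m, hm⟩ := (hBOeq _).1 hz
    exact (hBOeq z).2 ⟨m + 1, hm⟩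
  have hBmaps : MapsTo f Bo Bo := fun z hz => by
    obtain ⟨m, hm⟩ := (hBOeq _).1 hz
    cases m with
    | zero =>
      refine (hBOeq _).2 ⟨p - 1, ?_⟩
      rw [← Function.iterate_succ_apply, Nat.succ_eq_add_one, Nat.sub_add_cancel (by omega)]
      have : z = x := hm
      rw [this, hper]
    | succ m => exact (hBOeq _).2 ⟨m, hm⟩
  have hsurj : Function.Surjective f := by
    have hro : IsOpen (range f) := by
      rw [isOpen_iff_mem_nhds]
      rintro _ ⟨z, rfl⟩
      refine nhds_le_map_nhds (hfd z (mem_univ z)) (hnc z (mem_univ z) _) ?_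
      rw [mem_map]
      exact Filter.mem_of_superset univ_mem fun w _ => mem_range_self w
    exact range_eq_univ.1 ((isClopen_iff.1 ⟨(isCompact_range hfc).isClosed, hro⟩).resolve_left
      (range_nonempty f).ne_empty)
  have hbij : BijOn f Bo Bo := by
    refine (hBO.surjOn_iff_bijOn_of_mapsTo hBmaps).1 fun y hy => ?_
    obtain ⟨z, rfl⟩ := hsurj y
    exact ⟨z, hBpre z hy, rfl⟩
  have hFix : ∀ z, f^[p] z = x → z = x := by
    intro z hz
    have h1 : InjOn f^[p] Bo := (hbij.iterate p).injOn
    exact h1 ((hBOeq z).2 ⟨p, hz⟩) ((hBOeq x).2 ⟨0, rfl⟩) (hz.trans hper.symm)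
  set F := f^[p]
  have hFm : MDifferentiable 𝓘(ℂ) 𝓘(ℂ) F := by
    have : ∀ k, MDifferentiable 𝓘(ℂ) 𝓘(ℂ) f^[k] := by
      intro k
      induction k with
      | zero => exact mdifferentiable_id
      | succ k ih => rw [Function.iterate_succ]; exact ih.comp hfm
    exact this p
  -- a backward invariant neighbourhood of the fixed point
  obtain ⟨O₁, O₂, hO₁, hO₂, hxO₁, hfxO₂, hdisj⟩ := t2_separation (Ne.symm hfx)
  obtain ⟨N, hNo, hxN, hNO, hNF⟩ : ∃ N : Set X, IsOpen N ∧ x ∈ N ∧ N ⊆ O₁ ∧ ∀ w, F w ∈ N → w ∈ N := by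
    set c := chartAt ℂ x
    have hcm : c.MDifferentiable 𝓘(ℂ) 𝓘(ℂ) := mdifferentiable_chart x
    have hxs : x ∈ c.source := mem_chart_source ℂ x
    have hcx : c.symm (c x) = x := c.left_inv hxs
    have hsymm : Tendsto c.symm (𝓝 (c x)) (𝓝 x) := by
      have := c.continuousAt_symm (c.map_source hxs)
      rwa [ContinuousAt, hcx] at this
    have hexp := eventually_mul_norm_le_of_multiplier (hFm x) hper hx.repelling
    obtain ⟨V, hV, hVo, hxV⟩ := mem_nhds_iff.1 (hexp.and (c.open_source.mem_nhds hxs))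
    have hK : (F '' Vᶜ)ᶜ ∈ 𝓝 x := by
      refine (hVo.isClosed_compl.isCompact.image hFm.continuous).isClosed.isOpen_compl.mem_nhds ?_
      rintro ⟨w, hw, hwx⟩
      exact hw (by rw [hFix w hwx]; exact hxV)
    obtain ⟨s, hs, hsball⟩ := Metric.eventually_nhds_iff_ball.1 ((hsymm.eventually
      (inter_mem hK (hO₁.mem_nhds hxO₁))))
    refine ⟨c.source ∩ c ⁻¹' Metric.ball (c x) s, c.isOpen_inter_preimage Metric.isOpen_ball,
      ⟨hxs, Metric.mem_ball_self hs⟩, ?_, ?_⟩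
    · rintro w ⟨h1, h2⟩
      have := (hsball _ h2).2
      rwa [c.left_inv h1] at this
    · rintro w ⟨h1, h2⟩
      have h3 := (hsball _ h2).1
      rw [c.left_inv h1] at h3
      have hwV : w ∈ V := by
        by_contra h4
        exact h3 ⟨w, h4, rfl⟩
      have h5 := hV hwV
      refine ⟨h5.2, ?_⟩
      rw [mem_preimage, Metric.mem_ball, dist_eq_norm] at h2 ⊢
      have h6 := h5.1
      rw [one_mul] at h6
      exact h6.trans_lt h2
  -- The neighbourhood `N` of `x` is disjoint from a neighbourhood of `f x`, so points near `x` do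
  -- not lie in `f ⁻¹' N`. Thus `f ⁻¹' N` is open, stays away from `x`, and inherits backward
  -- invariance because `f` commutes with `f^[p]`.
  refine false_of_backward_invariant hFm hper hx.repelling (A := f ⁻¹' N) (hNo.preimage hfc) ?_ ?_ ?_
  · obtain ⟨z, hz⟩ := hsurj x
    exact ⟨z, by rw [mem_preimage, hz]; exact hxN⟩
  · intro hcl
    obtain ⟨w, hw1, hw2⟩ := mem_closure_iff.1 hcl (f ⁻¹' O₂) (hO₂.preimage hfc) hfxO₂
    exact hdisj.le_bot ⟨hNO hw2, hw1⟩
  · intro w hw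
    refine hNF _ ?_
    have h1 : f (F w) = F (f w) :=
      (Function.iterate_succ_apply' f p w).symm.trans (Function.iterate_succ_apply f p w)
    rwa [mem_preimage, h1] at hw

end IslandMaps

/-! ### The case of a non-normal orbit -/

namespace IslandMaps

variable {X : Type*} [TopologicalSpace X] [ChartedSpace ℂ X] [IsManifold 𝓘(ℂ) 1 X] [T2Space X]
  [CompactSpace X] [ConnectedSpace X]
variable {E : Type*} [NormedAddCommGroup E] [NormedSpace ℂ E] [FiniteDimensional ℂ E]

/-- If all iterates of a marked point are defined but do not form a normal family, then they meet
each marked repelling periodic point which is not exceptional. -/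
theorem LocalFamily.exists_iterate_eq_of_not_mapsToDisc {F : LocalFamily X E} {J : Finset X}
    (hJ : ∀ p : X, ∃ j ∈ J, p ∈ (discChart j).source ∧ ‖discChart j p‖ < 1 / 2)
    {a : E} {R : ℝ} (hR : 0 < R) (hB : Metric.ball a R ⊆ F.B) {g x : E → X}
    (hg : ∀ b ∈ Metric.ball a R, MDifferentiableAt 𝓘(ℂ, E) 𝓘(ℂ) g b)
    (hdef : ∀ n, ∀ b ∈ Metric.ball a R, IterDefined (F.dom b) (F.map b) n (g b))
    (hx : ∀ b ∈ Metric.ball a R, MDifferentiableAt 𝓘(ℂ, E) 𝓘(ℂ) x b) {p : ℕ} (hp : 2 ≤ p)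
    (hxa : IsRepellingPeriodicPt (F.dom a) (F.map a) p (x a))
    (hpic : ¬ IsPicardExceptional (F.dom a) (F.map a) (x a))
    (hbad : ∀ r > 0, ∃ n : ℕ, ∃ b ∈ Metric.ball a r,
      ¬ MapsToDisc J (fun y => (F.map y)^[n] (g y)) b r) :
    ∃ b ∈ Metric.ball a R, ∃ n, (F.map b)^[n] (g b) = x b := by
  by_contra! hcon
  have ha : a ∈ F.B := hB (Metric.mem_ball_self hR)
  have hGd : ∀ n, ∀ b ∈ Metric.ball a R,
      MDifferentiableAt 𝓘(ℂ, E) 𝓘(ℂ) (fun y => (F.map y)^[n] (g y)) b := fun n b hb =>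
    mdifferentiableAt_iterate (hB hb) (hg b hb) (hdef n b hb)
  obtain ⟨i, μ, ρ, u, h, -, hρ, hμ, hh, h01, hcc⟩ := exists_rescaling hJ hR hGd hbad
  set γ : ℕ → ℂ → E := fun k z => μ k + (ρ k : ℂ) • z • u
  have hγ : ∀ z, ContConvAt γ (fun _ => a) (hyperfilter ℕ : Filter ℕ) z := contConvAt_affine hρ hμ
  have hγd : ∀ k, Differentiable ℂ (γ k) := fun k => differentiable_affine (μ k) u (ρ k)
  have hball : ∀ᶠ b in 𝓝 a, b ∈ Metric.ball a R := Metric.ball_mem_nhds a hR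
  have hconst : ∀ y z, (∀ᶠ w in 𝓝 z, h w = y) → False := fun y z hyz => by
    have h2 := eqOn_of_mdifferentiable isOpen_univ isPreconnected_univ (fun w _ => hh w)
      (fun w _ => (mdifferentiable_const (c := y)) w) (mem_univ z) hyz
    exact h01 ((h2 0 (mem_univ _)).trans (h2 1 (mem_univ _)).symm)
  have hHd : ∀ m z, ∀ᶠ q : ℕ × ℂ in (hyperfilter ℕ : Filter ℕ) ×ˢ 𝓝 z, MDifferentiableAt 𝓘(ℂ) 𝓘(ℂ)
      (fun z => (F.map (γ q.1 z))^[m + i q.1] (g (γ q.1 z))) q.2 := by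
    intro m z
    filter_upwards [(hγ z).eventually hball] with q hq
    exact MDifferentiableAt.comp (g := fun y => (F.map y)^[m + i q.1] (g y)) q.2 (hGd _ _ hq)
      (hγd q.1 q.2).mdifferentiableAt
  refine h01 (eq_of_infinite_omitted hh
    ((infinite_compl_union_backwardOrbit isOpen_dom (F.mdiff_map a ha) hp hxa hpic).mono ?_) 0 1)
  rintro y hy ⟨z, rfl⟩
  rcases hy with hy | ⟨m, hm, hmx, hiso⟩
  · set w := (F.ψ a).symm (h z) with hw
    have hψw : F.ψ a w = h z := by simp [w]
    have hwW : w ∉ F.W := fun h' => hy (mem_dom_iff.2 h')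
    refine hconst _ z (eventuallyEq_of_avoid (l := (hyperfilter ℕ : Filter ℕ)) (t := fun y => F.ψ y w)
      (Eventually.of_forall hcc) ?_ hγ hγd (hball.mono fun b hb => F.mdiff_ψ w b (hB hb)) ?_ hψw.symm)
    · have h0 := hHd 0 z
      simp only [zero_add] at h0
      exact h0
    -- The next iterate is defined as well, so the current one lies in the moving domain and cannot
    -- equal `ψ y w` with `w ∉ F.W`.
    · filter_upwards [(hγ z).eventually hball] with q hq heq
      have h1 := (iterDefined_succ.1 (hdef (i q.1 + 1) _ hq)).2
      have h2 : (F.map (γ q.1 q.2))^[i q.1] (g (γ q.1 q.2)) = F.ψ (γ q.1 q.2) w := heq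
      rw [h2, mem_dom_iff] at h1
      exact hwW (by simpa using h1)
  · have hhc : ∀ z, ContinuousAt h z := fun z => (hh z).continuousAt
    have hdefm : ∀ᶠ w in 𝓝 z, IterDefined (F.dom a) (F.map a) m (h w) := by
      have h1 : ContinuousAt (fun w => (a, h w)) z := continuousAt_const.prodMk (hhc z)
      exact h1.eventually (eventually_iterDefined ha hm)
    -- Applying `m` more iterates turns a value of `h` in the backward orbit into a value `x a` of
    -- `f^[m] ∘ h`. The `m + i k`-th iterates avoid the marked periodic point, so Hurwitz makes
    -- `f^[m] ∘ h` constant near `z`. The isolation condition in `backwardOrbit` passes this on to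
    -- `h`.
    have hcm : ∀ᶠ w in 𝓝 z, ContConvAt (fun k z => (F.map (γ k z))^[m + i k] (g (γ k z)))
        (fun w => (F.map a)^[m] (h w)) (hyperfilter ℕ : Filter ℕ) w := by
      filter_upwards [hdefm] with w hw
      have h1 : Tendsto (fun q : ℕ × ℂ => (γ q.1 q.2, (F.map (γ q.1 q.2))^[i q.1] (g (γ q.1 q.2))))
          ((hyperfilter ℕ : Filter ℕ) ×ˢ 𝓝 w) (𝓝 (a, h w)) := (hγ w).prodMk_nhds (hcc w)
      have h2 := (continuousAt_iterate ha hw).tendsto.comp h1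
      refine h2.congr fun q => ?_
      simp [Function.iterate_add_apply]
    have h1 := eventuallyEq_of_avoid (l := (hyperfilter ℕ : Filter ℕ)) (t := x) hcm (hHd m z) hγ hγd
      (hball.mono fun b hb => hx b hb)
      (by
        filter_upwards [(hγ z).eventually hball] with q hq
        exact hcon _ hq _) hmx
    refine hconst (h z) z ?_
    filter_upwards [h1, (hhc z).eventually (eventually_nhdsWithin_iff.1 hiso)] with w h2 h3
    by_contra h4
    exact h3 h4 h2

end IslandMaps

namespace IslandMaps

variable {X : Type*} [TopologicalSpace X] [ChartedSpace ℂ X] [IsManifold 𝓘(ℂ) 1 X] [T2Space X]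

/-! ### Coordinate discs -/

/-- The open disc of radius `s` in the chart `discChart p`. -/
def coordDisc (p : X) (s : ℝ) : Set X := {w | w ∈ (discChart p).source ∧ ‖discChart p w‖ < s}

theorem mem_coordDisc (p : X) {s : ℝ} (hs : 0 < s) : p ∈ coordDisc p s :=
  ⟨(isDiscChart_discChart p).mem, by rw [(isDiscChart_discChart p).map_eq]; simpa⟩

theorem mem_chartDisc (p : X) {s : ℝ} (hs : 0 < s) : p ∈ chartDisc (discChart p) s :=
  ⟨(isDiscChart_discChart p).mem, by rw [(isDiscChart_discChart p).map_eq]; simpa using hs.le⟩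

theorem closure_coordDisc_subset (p : X) {s : ℝ} (hs : s ≤ 1) :
    closure (coordDisc p s) ⊆ chartDisc (discChart p) s :=
  closure_minimal (fun _ h => ⟨h.1, h.2.le⟩) ((isDiscChart_discChart p).isClosed_chartDisc (by linarith))

theorem isOpen_coordDisc (p : X) (s : ℝ) : IsOpen (coordDisc p s) := by
  rw [isOpen_iff_mem_nhds]
  rintro q ⟨h1, h2⟩
  filter_upwards [(discChart p).open_source.mem_nhds h1,
    ((discChart p).continuousAt h1).norm.eventually (gt_mem_nhds h2)] with y h3 h4 using ⟨h3, h4⟩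

theorem isJordanDomain_coordDisc (p : X) {s : ℝ} (hs : 0 < s) (hs1 : s ≤ 1) :
    IsJordanDomain (coordDisc p s) := by
  set e := discChart p
  have he := isDiscChart_discChart p
  have hs' : (s : ℂ) ≠ 0 := by exact_mod_cast hs.ne'
  have hmaps : MapsTo (fun z : ℂ => (s : ℂ) * z) (Metric.closedBall 0 1) e.target := fun z hz => by
    refine he.subset ?_
    rw [mem_closedBall_zero_iff] at hz ⊢
    rw [norm_mul, Complex.norm_real, Real.norm_of_nonneg hs.le]
    nlinarith [norm_nonneg z]
  refine ⟨isOpen_coordDisc p s, fun z => e.symm (s * z), ?_, ?_, ?_⟩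
  · exact e.continuousOn_symm.comp (by fun_prop) hmaps
  · intro z hz w hw hzw
    exact mul_left_cancel₀ hs' (e.symm.injOn (hmaps hz) (hmaps hw) hzw)
  · ext w
    constructor
    · rintro ⟨z, hz, rfl⟩
      have hz' := hmaps (Metric.ball_subset_closedBall hz)
      refine ⟨e.map_target hz', ?_⟩
      change ‖e (e.symm (s * z))‖ < s
      rw [e.right_inv hz', norm_mul, Complex.norm_real, Real.norm_of_nonneg hs.le]
      rw [mem_ball_zero_iff] at hz
      nlinarith
    · rintro ⟨h1, h2⟩
      refine ⟨(s : ℂ)⁻¹ * e w, ?_, ?_⟩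
      · rw [mem_ball_zero_iff, norm_mul, norm_inv, Complex.norm_real, Real.norm_of_nonneg hs.le,
          inv_mul_lt_iff₀ hs, mul_one]
        exact h2
      · change e.symm (s * ((s : ℂ)⁻¹ * e w)) = w
        rw [mul_inv_cancel_left₀ hs', e.left_inv h1]

theorem exists_chartDisc_subset {p : X} {O : Set X} (hO : O ∈ 𝓝 p) :
    ∃ s, 0 < s ∧ s ≤ 1 ∧ chartDisc (discChart p) s ⊆ O := by
  set e := discChart p
  have he := isDiscChart_discChart p
  have h1 : Tendsto e.symm (𝓝 0) (𝓝 p) := by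
    have := e.continuousAt_symm (e.map_source he.mem)
    rwa [ContinuousAt, e.left_inv he.mem, he.map_eq] at this
  obtain ⟨r, hr, hball⟩ := Metric.eventually_nhds_iff_ball.1 (h1.eventually hO)
  refine ⟨min 1 (r / 2), by positivity, min_le_left _ _, ?_⟩
  rintro w ⟨h2, h3⟩
  have h4 := hball (e w) (by
    rw [mem_ball_zero_iff]
    linarith [min_le_right 1 (r / 2)])
  rwa [e.left_inv h2] at h4

/-- A holomorphic map which is injective on `Ω` maps the boundary of `Ω` outside the image of `Ω`. -/
theorem notMem_image_of_mem_frontier {f : X → X} {Ω D : Set X} (hΩ : IsOpen Ω)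
    (hf : ∀ z ∈ Ω, MDifferentiableAt 𝓘(ℂ) 𝓘(ℂ) f z) (hbij : BijOn f Ω D) {y : X} (hy : y ∈ closure Ω)
    (hyΩ : y ∉ Ω) (hfy : ContinuousAt f y) : f y ∉ D := by
  intro hD
  obtain ⟨y', hy', hyy'⟩ := hbij.surjOn hD
  have hne : y ≠ y' := fun h => hyΩ (h ▸ hy')
  obtain ⟨V, V', hV, hV', hyV, hyV', hdisj⟩ := t2_separation hne
  have hopen : f '' (V' ∩ Ω) ∈ 𝓝 (f y) := by
    rw [← hyy']
    refine nhds_le_map_nhds ?_ ?_ ?_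
    · filter_upwards [hΩ.mem_nhds hy'] with w hw using hf w hw
    · intro hc
      have := nhdsNE_neBot y'
      have h0 : ∀ᶠ w in 𝓝[≠] y', f w = f y' ∧ w ∈ Ω ∧ w ∈ ({y'}ᶜ : Set X) := by
        filter_upwards [nhdsWithin_le_nhds hc, nhdsWithin_le_nhds (hΩ.mem_nhds hy'), self_mem_nhdsWithin]
          with w h1 h2 h3 using ⟨h1, h2, h3⟩
      obtain ⟨w, h1, h2, h3⟩ := h0.exists
      exact h3 (hbij.injOn h2 hy' h1)
    · rw [mem_map]
      filter_upwards [(hV'.inter hΩ).mem_nhds ⟨hyV', hy'⟩] with w hw using mem_image_of_mem f hw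
  obtain ⟨w, hw1, hw2, hw3⟩ := ((mem_closure_iff_frequently.1 hy).and_eventually
    (show ∀ᶠ w in 𝓝 y, w ∈ V ∧ f w ∈ f '' (V' ∩ Ω) from
      inter_mem (hV.mem_nhds hyV) (hfy.preimage_mem_nhds hopen))).exists
  obtain ⟨w', ⟨h1, h2⟩, h3⟩ := hw3
  have := hbij.injOn h2 hw1 h3
  exact hdisj.le_bot ⟨hw2, this ▸ h1⟩

/-! ### Crossing the boundary of the domain -/

/-- At the parameter `c`, the marked point `g` crosses the marked boundary point `η` of the domain. -/
structure IsCrossing (F : LocalFamily X ℂ) (g : ℂ → X) (η : X) (c : ℂ) : Prop where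
  mem : c ∈ F.B
  mdiff : ∀ᶠ y in 𝓝 c, MDifferentiableAt 𝓘(ℂ) 𝓘(ℂ) g y
  frontier : η ∈ frontier F.W
  eq : g c = F.ψ c η
  ne : ∀ᶠ y in 𝓝[≠] c, g y ≠ F.ψ y η

/-- `T` is a holomorphic function of the parameter along all holomorphic curves through `q`, and
continuous at `q`. -/
def IsCurveHolAt (T : ℂ → X → X) (q : ℂ × X) : Prop :=
  ContinuousAt (fun q : ℂ × X => T q.1 q.2) q ∧ ∀ u : ℂ → X, MDifferentiableAt 𝓘(ℂ) 𝓘(ℂ) u q.1 →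
    u q.1 = q.2 → MDifferentiableAt 𝓘(ℂ) 𝓘(ℂ) (fun y => T y (u y)) q.1

theorem isCurveHolAt_snd (q : ℂ × X) : IsCurveHolAt (fun _ z => z) q :=
  ⟨continuousAt_snd, fun _ hu _ => hu⟩

variable [CompactSpace X] [ConnectedSpace X] {F : LocalFamily X ℂ} {c : ℂ}

theorem isCurveHolAt_map {q : ℂ × X} (h1 : q.1 ∈ F.B) (h2 : q.2 ∈ F.dom q.1) : IsCurveHolAt F.map q :=
  ⟨LocalFamily.continuousAt_map h1 h2, fun u hu huq =>
    LocalFamily.mdifferentiableAt_map h1 hu (by rwa [huq])⟩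

/-- Hurwitz's theorem with `w` as the index: if `g` missed `ψ y w` for a family of `w` tending to
`η`, the limiting coincidence at `c` would persist near `c`. So near the crossing, `g` sweeps over
the moving copies of all points close to `η`. -/
theorem IsCrossing.eventually_exists_eq {g : ℂ → X} {η : X} (h : IsCrossing F g η c) {ε : ℝ}
    (hε : 0 < ε) : ∀ᶠ w in 𝓝 η, ∃ y ∈ Metric.ball c ε, g y = F.ψ y w := by
  by_contra hcon
  rw [not_eventually] at hcon
  set l := 𝓝 η ⊓ 𝓟 {w | ¬ ∃ y ∈ Metric.ball c ε, g y = F.ψ y w}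
  have hl : l.NeBot := frequently_mem_iff_neBot.1 hcon
  have hbad : ∀ᶠ w in l, ∀ y ∈ Metric.ball c ε, g y ≠ F.ψ y w := by
    filter_upwards [mem_inf_of_right (mem_principal_self _)] with w hw y hy heq
    exact hw ⟨y, hy, heq⟩
  have hB : ∀ᶠ y in 𝓝 c, y ∈ F.B := F.isOpen_B.mem_nhds h.mem
  have key := eventuallyEq_of_contConvAt (l := l) (a := fun _ => g) (b := fun w y => F.ψ y w) (a₀ := g)
    (b₀ := fun y => F.ψ y η) (z := c)
    (by
      filter_upwards [h.mdiff] with y hy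
      exact hy.continuousAt.tendsto.comp tendsto_snd)
    (by
      filter_upwards [hB] with y hy
      have h1 := LocalFamily.continuousAt_ψ hy η
      have h2 : Tendsto (fun q : X × ℂ => (q.2, q.1)) (l ×ˢ 𝓝 y) (𝓝 (y, η)) :=
        tendsto_snd.prodMk_nhds (tendsto_fst.mono_right inf_le_left)
      exact h1.tendsto.comp h2)
    (h.mdiff.prod_inr l) ((hB.mono fun y hy w => F.mdiff_ψ w y hy).prod_inr l |>.mono fun q hq => hq q.1)
    ((hbad.prod_mk (Metric.ball_mem_nhds c hε)).mono fun q hq => hq.1 q.2 hq.2) h.eq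
  obtain ⟨y, h1, h2⟩ := ((key.filter_mono nhdsWithin_le_nhds).and h.ne).exists
  exact h2 h1

/-- Estimates which are needed to apply Rouché's theorem to `T` and `t` over a small disc at `A`. -/
theorem exists_disc_estimate {A : X} {T : ℂ → X → X} {t : ℂ → X} {P : ℂ → X → Prop}
    {τ : ℂ → X → X} (hτ : ∀ z, ContinuousAt (fun q : ℂ × X => τ q.1 q.2) (c, z)) (hτc : ∀ z, τ c z = z)
    (hT : ∀ᶠ q in 𝓝 (c, A), IsCurveHolAt T q) (ht : ∀ᶠ y in 𝓝 c, MDifferentiableAt 𝓘(ℂ) 𝓘(ℂ) t y)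
    (hTt : T c A = t c) (hiso : ∀ᶠ z in 𝓝[≠] A, T c z ≠ t c) (hP : ∀ᶠ q : ℂ × X in 𝓝 (c, A), P q.1 q.2)
    {O : Set X} (hO : O ∈ 𝓝 A) :
    ∃ s δ : ℝ, 0 < s ∧ s ≤ 1 ∧ 0 < δ ∧ chartDisc (discChart A) s ⊆ O ∧ ∀ᶠ y in 𝓝 c,
      (∀ z ∈ chartDisc (discChart A) s, IsCurveHolAt T (y, τ y z) ∧ P y (τ y z) ∧
        T y (τ y z) ∈ (discChart (t c)).source) ∧
      (∀ z ∈ chartDisc (discChart A) s, z ∉ coordDisc A s →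
        δ ≤ ‖discChart (t c) (T y (τ y z)) - discChart (t c) (T y (τ y A))‖) ∧
      ‖discChart (t c) (T y (τ y A)) - discChart (t c) (t y)‖ ≤ δ / 4 ∧
      t y ∈ (discChart (t c)).source ∧ MDifferentiableAt 𝓘(ℂ) 𝓘(ℂ) t y := by
  set e := discChart (t c)
  have he : IsDiscChart e (t c) := isDiscChart_discChart (t c)
  set Q : ℂ × X → Prop := fun q => IsCurveHolAt T q ∧ P q.1 q.2 ∧ T q.1 q.2 ∈ e.source
  have hQ : ∀ᶠ q in 𝓝 (c, A), Q q := by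
    have h1 : ContinuousAt (fun q : ℂ × X => T q.1 q.2) (c, A) := hT.self_of_nhds.1
    exact hT.and (hP.and (h1.eventually (e.open_source.mem_nhds (by
      change T c A ∈ _; rw [hTt]; exact he.mem))))
  have hQs : ∀ᶠ z in 𝓝 A, ∀ᶠ q in 𝓝 (c, z), Q q :=
    (continuousAt_const.prodMk continuousAt_id : ContinuousAt (fun z : X => (c, z)) A).eventually
      (eventually_eventually_nhds.2 hQ)
  -- The closed disc is so small that `A` is the only solution of `T c z = t c` in it. The distance
  -- to `t c` in the chart is then positive on the compact boundary. Half of its minimum is kept as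
  -- `δ`, to leave room for moving the parameter.
  obtain ⟨s, hs, hs1, hsub⟩ := exists_chartDisc_subset
    (inter_mem hO (inter_mem hQs (eventually_nhdsWithin_iff.1 hiso)))
  set K := chartDisc (discChart A) s
  have hA : A ∈ K := mem_chartDisc A hs
  have hK : IsCompact K := isCompact_chartDisc ((isDiscChart_discChart A).closedBall_subset (by linarith))
  have hτ' : ∀ z, Tendsto (fun q : ℂ × X => (q.1, τ q.1 q.2)) (𝓝 c ×ˢ 𝓝 z) (𝓝 (c, z)) := fun z => by
    have h1 : ContinuousAt (fun q : ℂ × X => (q.1, τ q.1 q.2)) (c, z) := continuousAt_fst.prodMk (hτ z)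
    rw [ContinuousAt, hτc] at h1
    rwa [← nhds_prod_eq]
  have hS : ∀ z ∈ K, Tendsto (fun q : ℂ × X => e (T q.1 (τ q.1 q.2))) (𝓝 c ×ˢ 𝓝 z) (𝓝 (e (T c z))) := by
    intro z hz
    obtain ⟨h1, -, h3⟩ := (hsub hz).2.1.self_of_nhds
    exact ((e.continuousAt h3).tendsto.comp h1.1.tendsto).comp (hτ' z)
  have hcA : Tendsto (fun y : ℂ => (y, A)) (𝓝 c) (𝓝 c ×ˢ 𝓝 A) := tendsto_id.prodMk tendsto_const_nhds
  have hSA : Tendsto (fun y => e (T y (τ y A))) (𝓝 c) (𝓝 (e (t c))) := by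
    rw [← hTt]; exact (hS A hA).comp hcA
  have hK' : IsCompact (K \ coordDisc A s) := hK.diff (isOpen_coordDisc A s)
  obtain ⟨δ, hδ, hδK⟩ := hK'.exists_forall_le' (f := fun z => ‖e (T c z) - e (t c)‖) (a := 0)
    (by
      intro z hz
      have h1 : ContinuousAt (fun z => e (T c z)) z := by
        have h2 : Tendsto (fun z' : X => (c, z')) (𝓝 z) (𝓝 (c, z)) :=
          (continuous_const.prodMk continuous_id).tendsto z
        obtain ⟨h3, -, h4⟩ := (hsub hz.1).2.1.self_of_nhds
        exact (e.continuousAt h4).tendsto.comp (h3.1.tendsto.comp h2)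
      exact ((h1.sub continuousAt_const).norm).continuousWithinAt)
    (by
      intro z hz
      rw [norm_pos_iff, sub_ne_zero]
      intro heq
      obtain ⟨-, h2, h3⟩ := hsub hz.1
      refine h3 (fun hzA => hz.2 ?_) (e.injOn h2.self_of_nhds.2.2 he.mem heq)
      rw [mem_singleton_iff.1 hzA]; exact mem_coordDisc A hs)
  refine ⟨s, δ / 2, hs, hs1, by positivity, fun z hz => (hsub hz).1, ?_⟩
  have ev1 : ∀ᶠ y in 𝓝 c, ∀ z ∈ K, Q (y, τ y z) :=
    eventually_forall_of_isCompact (P := fun y z => Q (y, τ y z)) hK fun z hz =>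
      (hτ' z).eventually (hsub hz).2.1
  have ev2 : ∀ᶠ y in 𝓝 c, ∀ z ∈ K \ coordDisc A s, δ / 2 ≤ ‖e (T y (τ y z)) - e (T y (τ y A))‖ := by
    refine eventually_forall_of_isCompact
      (P := fun y z => δ / 2 ≤ ‖e (T y (τ y z)) - e (T y (τ y A))‖) hK' fun z hz => ?_
    have h1 := ((hS z hz.1).sub (hSA.comp tendsto_fst)).norm
    exact (h1.eventually (lt_mem_nhds (show δ / 2 < _ by linarith [hδK z hz]))).mono fun q hq => le_of_lt hq
  have ev3 : ∀ᶠ y in 𝓝 c, t y ∈ e.source :=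
    ht.self_of_nhds.continuousAt.eventually (e.open_source.mem_nhds he.mem)
  have ev4 : ∀ᶠ y in 𝓝 c, ‖e (T y (τ y A)) - e (t y)‖ ≤ δ / 2 / 4 := by
    have h1 : Tendsto (fun y => e (t y)) (𝓝 c) (𝓝 (e (t c))) :=
      (e.continuousAt he.mem).tendsto.comp ht.self_of_nhds.continuousAt.tendsto
    have h2 := (hSA.sub h1).norm
    rw [sub_self, norm_zero] at h2
    exact (h2.eventually (gt_mem_nhds (by positivity : (0 : ℝ) < δ / 2 / 4))).mono fun y hy => le_of_lt hy
  filter_upwards [ev1, ev2, ev3, ev4, ht] with y h1 h2 h3 h4 h5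
  exact ⟨h1, fun z hz hz' => h2 z ⟨hz, hz'⟩, h4, h3, h5⟩

/-- At a crossing, the islands over small discs at the points `A i` produce parameters at which the
image of the marked point satisfies one of the equations `T i = t i`. -/
theorem IsCrossing.exists_hit {g : ℂ → X} {η : X} (h : IsCrossing F g η c) {N : ℕ}
    (hisl : HasIslandProperty (F.dom c) (F.map c) N) {A : Fin N → X} (hA : Function.Injective A)
    {T : Fin N → ℂ → X → X} {t : Fin N → ℂ → X} {P : Fin N → ℂ → X → Prop}
    (hT : ∀ i, ∀ᶠ q in 𝓝 (c, A i), IsCurveHolAt (T i) q)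
    (ht : ∀ i, ∀ᶠ y in 𝓝 c, MDifferentiableAt 𝓘(ℂ) 𝓘(ℂ) (t i) y)
    (hTt : ∀ i, T i c (A i) = t i c) (hiso : ∀ i, ∀ᶠ z in 𝓝[≠] (A i), T i c z ≠ t i c)
    (hP : ∀ i, ∀ᶠ q : ℂ × X in 𝓝 (c, A i), P i q.1 q.2) {ε : ℝ} (hε : 0 < ε) :
    ∃ i, ∃ y ∈ Metric.ball c ε, g y ∈ F.dom y ∧ P i y (F.map y (g y)) ∧
      T i y (F.map y (g y)) = t i y ∧ ¬ ∀ᶠ y' in 𝓝 y, T i y' (F.map y' (g y')) = t i y' := by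
  set τ : ℂ → X → X := fun y z => F.φ y ((F.φ c).symm z)
  have hτ : ∀ z, ContinuousAt (fun q : ℂ × X => τ q.1 q.2) (c, z) := fun z => by
    have h1 : ContinuousAt (fun q : ℂ × X => (q.1, (F.φ c).symm q.2)) (c, z) :=
      continuousAt_fst.prodMk ((F.φ c).symm.continuous.continuousAt.comp continuousAt_snd)
    exact ContinuousAt.comp (f := fun q : ℂ × X => (q.1, (F.φ c).symm q.2))
      (LocalFamily.continuousAt_φ h.mem _) h1
  have hτc : ∀ z, τ c z = z := fun z => by simp [τ]
  obtain ⟨O, hO, hOd⟩ := (finite_range A).t2_separation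
  choose s δ hs hs1 hδ hsO hest using fun i => exists_disc_estimate hτ hτc (hT i) (ht i) (hTt i) (hiso i)
    (hP i) ((hO (A i)).2.mem_nhds (hO (A i)).1)
  have hBn : ∀ᶠ y in 𝓝 c, y ∈ F.B := F.isOpen_B.mem_nhds h.mem
  obtain ⟨ε₀, hε₀, hball⟩ := Metric.eventually_nhds_iff_ball.1
    ((eventually_all.2 hest).and (hBn.and (h.mdiff.and (eventually_nhdsWithin_iff.1 h.ne))))
  set ε₁ := min ε ε₀ / 2
  have hmin : 0 < min ε ε₀ := lt_min hε hε₀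
  have hε₁ : 0 < ε₁ := by positivity
  have hε₁' : ε₁ < min ε ε₀ := half_lt_self hmin
  have hsub₀ : Metric.closedBall c ε₁ ⊆ Metric.ball c ε₀ :=
    Metric.closedBall_subset_ball (hε₁'.trans_le (min_le_right _ _))
  -- Transporting the marked point back to the parameter `c` freezes the dynamics. The image `F.map
  -- y (g y)` becomes `τ y (F.map c (θ y))`, so membership in the moving domain and in moving
  -- islands can be tested with `F.map c` alone.
  set θ : ℂ → X := fun y => F.ψ c ((F.ψ y).symm (g y))
  have hθc : ∀ y ∈ Metric.ball c ε₀, ContinuousAt θ y := fun y hy => by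
    obtain ⟨-, h2, h3, -⟩ := hball y hy
    have h4 : ContinuousAt (fun y => (F.ψ y).symm (g y)) y :=
      ContinuousAt.comp (f := fun y => (y, g y)) (LocalFamily.continuousAt_ψ_symm h2 _)
        (continuousAt_id.prodMk h3.continuousAt)
    exact (F.ψ c).continuous.continuousAt.comp h4
  have hψθ : ∀ y, F.ψ y ((F.ψ c).symm (θ y)) = g y := fun y => by simp [θ]
  have hmapθ : ∀ y, F.map y (g y) = τ y (F.map c (θ y)) := fun y => by
    simp [τ, θ, LocalFamily.map]
  have hdomθ : ∀ y, g y ∈ F.dom y ↔ θ y ∈ F.dom c := fun y => by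
    rw [LocalFamily.mem_dom_iff, LocalFamily.mem_dom_iff]; simp [θ]
  -- the circle is mapped away from the boundary point
  set U₁ := (θ '' Metric.sphere c ε₁)ᶜ
  have hU₁ : IsOpen U₁ := by
    refine ((isCompact_sphere c ε₁).image_of_continuousOn fun y hy => ?_).isClosed.isOpen_compl
    exact (hθc y (hsub₀ (Metric.sphere_subset_closedBall hy))).continuousWithinAt
  have hηU₁ : F.ψ c η ∈ U₁ := by
    rintro ⟨y, hy, hyη⟩
    have h1 : y ≠ c := fun h' => by
      rw [h', Metric.mem_sphere, dist_self] at hy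
      exact hε₁.ne hy
    refine (hball y (hsub₀ (Metric.sphere_subset_closedBall hy))).2.2.2 h1 ?_
    rw [← hψθ y, hyη]; simp
  obtain ⟨U₂, hU₂, hU₂o, hηU₂⟩ := mem_nhds_iff.1 (h.eventually_exists_eq hε₁)
  have hfr : F.ψ c η ∈ _root_.frontier (F.dom c) := by
    rw [LocalFamily.dom, ← (F.ψ c).image_frontier]
    exact mem_image_of_mem _ h.frontier
  -- The open set prescribed for the islands avoids the `θ`-image of the circle, so that `L` below
  -- stays away from the circle. It is also contained in the region swept by `θ`, so that `L`
  -- contains a zero.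
  obtain ⟨i, Ω, hΩ, hΩcl, hbij⟩ := hisl (fun i => coordDisc (A i) (s i))
    (fun i => isJordanDomain_coordDisc _ (hs i) (hs1 i))
    (fun i j hij => by
      have h1 := hOd (mem_range_self i) (mem_range_self j) (hA.ne hij)
      exact h1.mono ((closure_coordDisc_subset _ (hs1 i)).trans (hsO i))
        ((closure_coordDisc_subset _ (hs1 j)).trans (hsO j)))
    (U₁ ∩ F.ψ c '' U₂) (hU₁.inter ((F.ψ c).isOpenMap _ hU₂o))
    ⟨F.ψ c η, ⟨hηU₁, mem_image_of_mem _ hηU₂⟩, hfr⟩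
  have hmd : ∀ z ∈ closure Ω, MDifferentiableAt 𝓘(ℂ) 𝓘(ℂ) (F.map c) z := fun z hz =>
    LocalFamily.mdifferentiableAt_map_of_mem h.mem (hΩcl hz).2
  have hclD : ∀ z ∈ closure Ω, F.map c z ∈ chartDisc (discChart (A i)) (s i) := fun z hz => by
    refine closure_coordDisc_subset _ (hs1 i) ?_
    exact hbij.mapsTo.closure_of_continuousOn (fun z hz => (hmd z hz).continuousAt.continuousWithinAt) hz
  set L := Metric.ball c ε₁ ∩ θ ⁻¹' Ω
  have hLo : IsOpen L := by
    rw [isOpen_iff_mem_nhds]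
    rintro y ⟨h1, h2⟩
    exact inter_mem (Metric.isOpen_ball.mem_nhds h1)
      ((hθc y (hsub₀ (Metric.ball_subset_closedBall h1))).preimage_mem_nhds (hΩ.mem_nhds h2))
  have hLcl : ∀ y ∈ closure L, y ∈ Metric.ball c ε₁ ∧ θ y ∈ closure Ω := by
    intro y hy
    have h1 : y ∈ Metric.closedBall c ε₁ :=
      closure_minimal (inter_subset_left.trans Metric.ball_subset_closedBall) Metric.isClosed_closedBall hy
    have h2 : θ y ∈ closure Ω := by
      have h3 : MapsTo θ L Ω := fun y hy => hy.2
      exact ((hθc y (hsub₀ h1)).continuousWithinAt.mem_closure hy h3)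
    refine ⟨?_, h2⟩
    rcases (Metric.mem_closedBall.1 h1).lt_or_eq with h3 | h3
    · exact h3
    · exact absurd (mem_image_of_mem θ (Metric.mem_sphere.2 h3)) (hΩcl h2).1.1
  set e := discChart (t i c)
  have he : IsDiscChart e (t i c) := isDiscChart_discChart _
  set G : ℂ → X := fun y => T i y (F.map y (g y))
  set σ : ℂ → X := fun y => T i y (τ y (A i))
  have hAK : A i ∈ chartDisc (discChart (A i)) (s i) := mem_chartDisc _ (hs i)
  have hB0 : ∀ y ∈ closure L, y ∈ Metric.ball c ε₀ := fun y hy =>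
    hsub₀ (Metric.ball_subset_closedBall (hLcl y hy).1)
  have hGT : ∀ y, G y = T i y (τ y (F.map c (θ y))) := fun y => by simp only [G]; rw [hmapθ]
  have hGs : ∀ y ∈ closure L, G y ∈ e.source := fun y hy => by
    rw [hGT]
    exact (((hball y (hB0 y hy)).1 i).1 _ (hclD _ (hLcl y hy).2)).2.2
  have hGd : ∀ y ∈ closure L, DifferentiableAt ℂ (fun y => e (G y)) y := fun y hy => by
    obtain ⟨h1, h2, h3, -⟩ := hball y (hB0 y hy)
    refine differentiableAt_chart_comp he.mdiff ?_ (hGs y hy)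
    have h4 := ((h1 i).1 _ (hclD _ (hLcl y hy).2)).1.2 (fun y => F.map y (g y)) ?_ (hmapθ y)
    · exact h4
    · exact LocalFamily.mdifferentiableAt_map h2 h3 ((hdomθ y).2 (hΩcl (hLcl y hy).2).2)
  have hσd : ∀ y ∈ closure L, DifferentiableAt ℂ (fun y => e (σ y)) y := fun y hy => by
    obtain ⟨h1, h2, -⟩ := hball y (hB0 y hy)
    obtain ⟨h3, -, h4⟩ := (h1 i).1 _ hAK
    exact differentiableAt_chart_comp he.mdiff (h3.2 (fun y => τ y (A i)) (F.mdiff_φ _ y h2) rfl) h4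
  have htd : ∀ y ∈ closure L, DifferentiableAt ℂ (fun y => e (t i y)) y := fun y hy => by
    obtain ⟨-, -, -, h1, h2⟩ := (hball y (hB0 y hy)).1 i
    exact differentiableAt_chart_comp he.mdiff h2 h1
  -- Compared are `T i` at the image of the marked point with the moving value of `T i` at `A i`,
  -- and with `t i`. On the frontier of `L` the point `θ y` lies on the boundary of the island, so
  -- its image lies on the boundary of the disc and the first difference is at least `δ i`. The
  -- preimage of `A i` in the island gives the required zero.
  obtain ⟨y, hyL, hy0, hyn⟩ := exists_zero_of_close (L := L) (u := fun y => e (G y) - e (σ y))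
    (w := fun y => e (G y) - e (t i y)) hLo (Metric.isBounded_ball.subset inter_subset_left)
    (DifferentiableOn.diffContOnCl fun y hy => ((hGd y hy).sub (hσd y hy)).differentiableWithinAt)
    (DifferentiableOn.diffContOnCl fun y hy => ((hGd y hy).sub (htd y hy)).differentiableWithinAt)
    (hδ i)
    (by
      intro y hy
      rw [hLo.frontier_eq] at hy
      obtain ⟨h1, h2⟩ := hLcl y hy.1
      have h3 : θ y ∉ Ω := fun h' => hy.2 ⟨h1, h'⟩
      have h4 := notMem_image_of_mem_frontier hΩ (fun z hz => hmd z (subset_closure hz)) hbij h2 h3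
        (hmd _ h2).continuousAt
      simp only [hGT]
      exact ((hball y (hB0 y hy.1)).1 i).2.1 _ (hclD _ h2) h4)
    (by
      intro y hy
      have h1 := ((hball y (hB0 y hy)).1 i).2.2.1
      have h2 : e (G y) - e (σ y) - (e (G y) - e (t i y)) = -(e (σ y) - e (t i y)) := by ring
      rw [h2, norm_neg]
      exact h1)
    (by
      obtain ⟨w, hw, hwA⟩ := hbij.surjOn (mem_coordDisc (A i) (hs i))
      obtain ⟨w', hw', hww'⟩ := (hΩcl (subset_closure hw)).1.2
      obtain ⟨y, hy, hyw⟩ := hU₂ hw'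
      have hθy : θ y = w := by
        simp only [θ]; rw [hyw, ← hww']; simp
      refine ⟨y, ⟨hy, by rw [mem_preimage, hθy]; exact hw⟩, ?_⟩
      simp only [hGT, hθy, hwA, σ, sub_self])
  have hyc : y ∈ closure L := subset_closure hyL
  refine ⟨i, y, Metric.ball_subset_ball (hε₁'.le.trans (min_le_left _ _)) hyL.1,
    (hdomθ y).2 (hΩcl (hLcl y hyc).2).2, ?_, ?_, fun hev => hyn ?_⟩
  · rw [hmapθ]
    exact (((hball y (hB0 y hyc)).1 i).1 _ (hclD _ (hLcl y hyc).2)).2.1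
  · exact e.injOn (hGs y hyc) ((hball y (hB0 y hyc)).1 i).2.2.2.1 (sub_eq_zero.1 hy0)
  · filter_upwards [hev] with y' hy'
    simp only [G]
    rw [hy', sub_self]

end IslandMaps

namespace IslandMaps

variable {X : Type*} [TopologicalSpace X] [ChartedSpace ℂ X] [IsManifold 𝓘(ℂ) 1 X] [T2Space X]
variable {E : Type*} [NormedAddCommGroup E] [NormedSpace ℂ E]

/-! ### Values with finitely many isolated preimages -/

/-- The preimages of `q` near which `f` is not constant. -/
def isolatedPreimages (W : Set X) (f : X → X) (q : X) : Set X :=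
  {w | w ∈ W ∧ f w = q ∧ ∀ᶠ w' in 𝓝[≠] w, f w' ≠ q}

/-- The values with finitely many isolated preimages. -/
def sparseValues (W : Set X) (f : X → X) : Set X := {q | (isolatedPreimages W f q).Finite}

theorem exists_injective_fin {S : Set X} (hS : S.Infinite) (N : ℕ) :
    ∃ A : Fin N → X, Function.Injective A ∧ ∀ i, A i ∈ S :=
  ⟨fun i => (hS.natEmbedding S i : X), fun _ _ h =>
    Fin.val_injective ((hS.natEmbedding S).injective (Subtype.val_injective h)), fun i => (hS.natEmbedding S i).2⟩

/-- From `N` such values, take small disjoint discs around them and ask for an island off the finite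
set of all their isolated preimages. Injectivity on an island makes the preimage found there
isolated, hence a new one, which is impossible. -/
theorem LocalFamily.finite_sparseValues {F : LocalFamily X E} {b : E} {N : ℕ}
    (hisl : HasIslandProperty (F.dom b) (F.map b) N) (hfr : (frontier F.W).Nonempty) :
    (sparseValues F.W F.f).Finite := by
  by_contra hinf
  obtain ⟨q, hq, hqS⟩ := exists_injective_fin hinf N
  set A : Fin N → X := fun i => F.φ b (q i)
  have hA : Function.Injective A := (F.φ b).injective.comp hq
  obtain ⟨O, hO, hOd⟩ := (finite_range A).t2_separation
  choose s hs hs1 hsO using fun i => exists_chartDisc_subset ((hO (A i)).2.mem_nhds (hO (A i)).1)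
  set S := ⋃ i, isolatedPreimages F.W F.f (q i)
  have hS : S.Finite := finite_iUnion fun i => hqS i
  obtain ⟨η, hη⟩ := hfr
  have hηW : η ∉ F.W := by
    rw [F.isOpen_W.frontier_eq] at hη
    exact hη.2
  obtain ⟨i, Ω, hΩ, hΩcl, hbij⟩ := hisl (fun i => coordDisc (A i) (s i))
    (fun i => isJordanDomain_coordDisc _ (hs i) (hs1 i))
    (fun i j hij => (hOd (mem_range_self i) (mem_range_self j) (hA.ne hij)).mono
      ((closure_coordDisc_subset _ (hs1 i)).trans (hsO i))
      ((closure_coordDisc_subset _ (hs1 j)).trans (hsO j)))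
    (F.ψ b '' S)ᶜ (hS.image _).isClosed.isOpen_compl
    ⟨F.ψ b η, by
      rintro ⟨w, hw, hwη⟩
      obtain ⟨i, hi⟩ := mem_iUnion.1 hw
      exact hηW ((F.ψ b).injective hwη ▸ hi.1), by
      rw [LocalFamily.dom, ← (F.ψ b).image_frontier]
      exact mem_image_of_mem _ hη⟩
  obtain ⟨z, hz, hzA⟩ := hbij.surjOn (mem_coordDisc (A i) (hs i))
  have hzU := hΩcl (subset_closure hz)
  refine hzU.1 ⟨(F.ψ b).symm z, mem_iUnion.2 ⟨i, mem_dom_iff.1 hzU.2, (F.φ b).injective hzA, ?_⟩, by simp⟩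
  have h1 : ∀ᶠ w in 𝓝 ((F.ψ b).symm z), F.ψ b w ∈ Ω :=
    (F.ψ b).continuous.continuousAt.eventually (hΩ.mem_nhds (by simpa using hz))
  filter_upwards [self_mem_nhdsWithin, nhdsWithin_le_nhds h1] with w hw1 hw2 hw3
  have h2 : F.map b (F.ψ b w) = F.map b z := by rw [map_ψ, hw3, hzA]
  have h3 := hbij.injOn hw2 hz h2
  exact hw1 (by rw [mem_singleton_iff, ← h3]; simp)

theorem Homeomorph.tendsto_nhdsNE (h : X ≃ₜ X) (z : X) : Tendsto h (𝓝[≠] z) (𝓝[≠] (h z)) :=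
  tendsto_nhdsWithin_iff.2 ⟨h.continuous.continuousAt.tendsto.mono_left nhdsWithin_le_nhds, by
    filter_upwards [self_mem_nhdsWithin] with w hw hw' using hw (h.injective hw')⟩

/-! ### Hitting the periodic point from a crossing -/

variable [CompactSpace X] [ConnectedSpace X]

/-- At a crossing, the marked point can be made to hit `x` after two steps if the value
corresponding to `x` has infinitely many isolated preimages. -/
theorem IsCrossing.exists_iterate_two_eq {F : LocalFamily X ℂ} {c : ℂ} {g : ℂ → X} {η : X}
    (h : IsCrossing F g η c) {N : ℕ} (hisl : HasIslandProperty (F.dom c) (F.map c) N) {x : ℂ → X}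
    (hx : ∀ᶠ y in 𝓝 c, MDifferentiableAt 𝓘(ℂ) 𝓘(ℂ) x y)
    (hxc : (F.φ c).symm (x c) ∉ sparseValues F.W F.f) {ε : ℝ} (hε : 0 < ε) :
    ∃ y ∈ Metric.ball c ε, IterDefined (F.dom y) (F.map y) 2 (g y) ∧ (F.map y)^[2] (g y) = x y := by
  obtain ⟨w, hw, hwS⟩ := exists_injective_fin hxc N
  have hdom : ∀ i, F.ψ c (w i) ∈ F.dom c := fun i => mem_image_of_mem _ (hwS i).1
  obtain ⟨i, y, hy, h1, h2, h3, -⟩ := h.exists_hit hisl (A := fun i => F.ψ c (w i))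
    ((F.ψ c).injective.comp hw) (T := fun _ => F.map) (t := fun _ => x) (P := fun _ y z => z ∈ F.dom y)
    (fun i => by
      filter_upwards [continuousAt_fst.eventually (F.isOpen_B.mem_nhds h.mem),
        LocalFamily.eventually_mem_dom h.mem (hdom i)] with q h1 h2
      exact isCurveHolAt_map h1 h2)
    (fun _ => hx)
    (fun i => by
      rw [LocalFamily.map_ψ, (hwS i).2.1]; simp)
    (fun i => by
      have h1 := Homeomorph.tendsto_nhdsNE (F.ψ c).symm (F.ψ c (w i))
      have h2 : (F.ψ c).symm (F.ψ c (w i)) = w i := by simp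
      rw [h2] at h1
      filter_upwards [h1.eventually (hwS i).2.2] with z hz hzx
      exact hz (by rw [← hzx]; simp [LocalFamily.map]))
    (fun i => LocalFamily.eventually_mem_dom h.mem (hdom i)) hε
  refine ⟨y, hy, ?_, h3⟩
  rw [iterDefined_succ, iterDefined_succ]
  exact ⟨⟨fun j hj => absurd hj (Nat.not_lt_zero j), h1⟩, h2⟩

/-- If the value corresponding to `x c` is not sparse, two steps suffice. If it is the sparse value
`q`, the hypothesis `hdeg` provides an open set `W₁` on which `F.f` is constantly `q`. Whether `x`
follows `φ y q` identically near `c` or only at `c` decides how to proceed. -/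
theorem IsCrossing.exists_iterate_eq {F : LocalFamily X ℂ} {c : ℂ} {g : ℂ → X} {η : X}
    (h : IsCrossing F g η c) (hisl : ∀ y ∈ F.B, ∃ N, HasIslandProperty (F.dom y) (F.map y) N) {x : ℂ → X}
    (hx : ∀ᶠ y in 𝓝 c, MDifferentiableAt 𝓘(ℂ) 𝓘(ℂ) x y) {q : X}
    (hq : ∀ᶠ y in 𝓝 c, (F.φ y).symm (x y) ∈ sparseValues F.W F.f → (F.φ y).symm (x y) = q)
    (hdeg : q ∈ sparseValues F.W F.f → (_root_.frontier F.W).Infinite ∧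
      ∃ W₁ ⊆ F.W, IsOpen W₁ ∧ W₁.Nonempty ∧ ∀ w ∈ W₁, F.f w = q) {ε : ℝ} (hε : 0 < ε) :
    ∃ y ∈ Metric.ball c ε, ∃ m, IterDefined (F.dom y) (F.map y) m (g y) ∧ (F.map y)^[m] (g y) = x y := by
  obtain ⟨N, hN⟩ := hisl c h.mem
  by_cases hc : (F.φ c).symm (x c) ∈ sparseValues F.W F.f
  swap
  · obtain ⟨y, hy, h1⟩ := h.exists_iterate_two_eq hN hx hc hε
    exact ⟨y, hy, 2, h1⟩
  have hcq := hq.self_of_nhds hc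
  obtain ⟨hfr, W₁, hW₁, hW₁o, hW₁ne, hW₁q⟩ := hdeg (hcq ▸ hc)
  have hB : ∀ᶠ y in 𝓝 c, y ∈ F.B := F.isOpen_B.mem_nhds h.mem
  rcases eventually_eq_or_eventually_ne_of_mdifferentiable hx
    (hB.mono fun y hy => F.mdiff_φ q y hy) with hxq | hxq
  · obtain ⟨ε', hε', hball⟩ := Metric.eventually_nhds_iff_ball.1 hxq
    -- Here `x y = φ y q` near `c`. The image of the marked point is aimed at the moving open set `ψ
    -- y '' W₁`, all of which is sent to `x y` by the next step.
    obtain ⟨A, hA, hAW⟩ := exists_injective_fin (infinite_of_isOpen ((F.ψ c).isOpenMap _ hW₁o)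
      (hW₁ne.image _)) N
    obtain ⟨i, y, hy, h1, h2, -, -⟩ := h.exists_hit hN hA (T := fun _ _ z => z)
      (t := fun i y => F.φ y ((F.φ c).symm (A i))) (P := fun _ y z => (F.ψ y).symm z ∈ W₁)
      (fun i => Eventually.of_forall isCurveHolAt_snd) (fun i => hB.mono fun y hy => F.mdiff_φ _ y hy)
      (fun i => by simp) (fun i => by
        filter_upwards [self_mem_nhdsWithin] with z hz
        simpa using hz)
      (fun i => by
        obtain ⟨w, hw, hwA⟩ := hAW i
        refine (LocalFamily.continuousAt_ψ_symm h.mem (A i)).eventually (hW₁o.mem_nhds ?_)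
        change (F.ψ c).symm (A i) ∈ W₁
        rw [← hwA]; simpa using hw) (lt_min hε hε')
    refine ⟨y, Metric.ball_subset_ball (min_le_left _ _) hy, 2, ?_, ?_⟩
    · rw [iterDefined_succ, iterDefined_succ]
      exact ⟨⟨fun j hj => absurd hj (Nat.not_lt_zero j), h1⟩, LocalFamily.mem_dom_iff.2 (hW₁ h2)⟩
    · change F.map y (F.map y (g y)) = x y
      rw [hball y (Metric.ball_subset_ball (min_le_right _ _) hy), LocalFamily.map, hW₁q _ h2]
  · obtain ⟨ε', hε', hball⟩ := Metric.eventually_nhds_iff_ball.1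
      ((eventually_nhdsWithin_iff.1 hxq).and (hB.and (hq.and (h.mdiff.and hx.eventually_nhds))))
    -- Here `q` is left behind as soon as the parameter differs from `c`. Infinitely many frontier
    -- points are available as targets, so the image of the marked point can be brought to a second
    -- crossing at a parameter `y ≠ c`. There `x y` is no longer sparse, and two further steps reach
    -- it.
    obtain ⟨ξ, hξ, hξW⟩ := exists_injective_fin hfr N
    obtain ⟨i, y, hy, h1, -, h2, h3⟩ := h.exists_hit hN (A := fun i => F.ψ c (ξ i))
      ((F.ψ c).injective.comp hξ) (T := fun _ _ z => z) (t := fun i y => F.ψ y (ξ i)) (P := fun _ _ _ => True)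
      (fun i => Eventually.of_forall isCurveHolAt_snd) (fun i => hB.mono fun y hy => F.mdiff_ψ _ y hy)
      (fun i => rfl) (fun i => self_mem_nhdsWithin) (fun i => Eventually.of_forall fun _ => trivial)
      (lt_min hε hε')
    have hyε := Metric.ball_subset_ball (min_le_left _ _) hy
    have hyε' := Metric.ball_subset_ball (min_le_right _ _) hy
    obtain ⟨h4, h5, h6, h7, h8⟩ := hball y hyε'
    have hyc : y ≠ c := by
      rintro rfl
      rw [h.eq, LocalFamily.mem_dom_iff, Homeomorph.symm_apply_apply] at h1
      have := h.frontier
      rw [F.isOpen_W.frontier_eq] at this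
      exact this.2 h1
    have hnear : ∀ᶠ y' in 𝓝 y, y' ∈ Metric.ball c ε' := Metric.isOpen_ball.mem_nhds hyε'
    have hdom : ∀ᶠ y' in 𝓝 y, g y' ∈ F.dom y' := by
      have h9 : ContinuousAt (fun y' => (y', g y')) y := continuousAt_id.prodMk h7.continuousAt
      exact h9.eventually (LocalFamily.eventually_mem_dom h5 h1)
    have hmd : ∀ᶠ y' in 𝓝 y, MDifferentiableAt 𝓘(ℂ) 𝓘(ℂ) (fun y => F.map y (g y)) y' := by
      filter_upwards [hnear, hdom] with y' h9 h10
      exact LocalFamily.mdifferentiableAt_map (hball y' h9).2.1 (hball y' h9).2.2.2.1 h10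
    have hcr : IsCrossing F (fun y => F.map y (g y)) (ξ i) y :=
      { mem := h5
        mdiff := hmd
        frontier := hξW i
        eq := h2
        ne := (eventually_eq_or_eventually_ne_of_mdifferentiable hmd (by
          -- The coincidence with the frontier point does not persist identically, by the isolation
          -- statement in `exists_hit`. The new configuration is therefore again a crossing.
          filter_upwards [hnear] with y' h9 using F.mdiff_ψ _ y' (hball y' h9).2.1)).resolve_left h3 }
    obtain ⟨N', hN'⟩ := hisl y h5
    have hys : (F.φ y).symm (x y) ∉ sparseValues F.W F.f := fun hs => by
      have h9 := h6 hs
      refine h4 hyc ?_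
      rw [← h9]; simp
    obtain ⟨δ, hδ, hδball⟩ := Metric.eventually_nhds_iff_ball.1
      (hdom.and (Metric.isOpen_ball.mem_nhds hyε : ∀ᶠ y' in 𝓝 y, y' ∈ Metric.ball c ε))
    obtain ⟨y', hy', h9, h10⟩ := hcr.exists_iterate_two_eq hN' h8 hys hδ
    refine ⟨y', (hδball y' hy').2, 3, ?_, h10⟩
    rw [show 3 = 2 + 1 from rfl, iterDefined_add]
    refine ⟨fun j hj => ?_, h9⟩
    obtain rfl : j = 0 := by omega
    exact (hδball y' hy').1

/-! ### Restriction to lines -/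

namespace LocalFamily

/-- The restriction of a local family to the line through `b` in the direction `u`. -/
def line (F : LocalFamily X E) (b u : E) : LocalFamily X ℂ where
  B := (fun y : ℂ => b + y • u) ⁻¹' F.B
  W := F.W
  f := F.f
  φ y := F.φ (b + y • u)
  ψ y := F.ψ (b + y • u)
  isOpen_B := F.isOpen_B.preimage (by fun_prop)
  isOpen_W := F.isOpen_W
  mdiff_f := F.mdiff_f
  mdiff_φ z y hy := MDifferentiableAt.comp (g := fun b => F.φ b z) y (F.mdiff_φ z _ hy)
    (by fun_prop : DifferentiableAt ℂ (fun y : ℂ => b + y • u) y).mdifferentiableAt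
  mdiff_ψ z y hy := MDifferentiableAt.comp (g := fun b => F.ψ b z) y (F.mdiff_ψ z _ hy)
    (by fun_prop : DifferentiableAt ℂ (fun y : ℂ => b + y • u) y).mdifferentiableAt
  mdiff_map y hy := F.mdiff_map _ hy

variable [FiniteDimensional ℂ E]

/-- If the marked point is in the domain for some parameters of a ball but not for all, then it
crosses the boundary of the domain on some line. -/
theorem exists_isCrossing {F : LocalFamily X E} {a : E} {r : ℝ} (hB : Metric.ball a r ⊆ F.B) {g : E → X}
    (hg : ∀ b ∈ Metric.ball a r, MDifferentiableAt 𝓘(ℂ, E) 𝓘(ℂ) g b)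
    (h1 : ∃ b ∈ Metric.ball a r, g b ∈ F.dom b) (h2 : ∃ b ∈ Metric.ball a r, g b ∉ F.dom b) :
    ∃ b ∈ Metric.ball a r, ∃ (u : E) (η : X), IsCrossing (F.line b u) (fun y => g (b + y • u)) η 0 := by
  set θ : E → X := fun b => (F.ψ b).symm (g b)
  have hθ : ∀ b ∈ Metric.ball a r, ContinuousAt θ b := fun b hb =>
    ContinuousAt.comp (f := fun y => (y, g y)) (continuousAt_ψ_symm (hB hb) _)
      (continuousAt_id.prodMk (hg b hb).continuousAt)
  set S := Metric.ball a r ∩ θ ⁻¹' F.W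
  have hSo : IsOpen S := by
    rw [isOpen_iff_mem_nhds]
    rintro b ⟨hb1, hb2⟩
    exact inter_mem (Metric.isOpen_ball.mem_nhds hb1)
      ((hθ b hb1).preimage_mem_nhds (F.isOpen_W.mem_nhds hb2))
  -- The ball is connected, so the open set of parameters with the marked point in the domain has a
  -- boundary point `b` inside it. On the line from `b` to a parameter `b'` of that set, the
  -- coincidence with the frontier point cannot be identical, since it fails at `b'`.
  obtain ⟨b, hb, hbc, hbS⟩ : ∃ b ∈ Metric.ball a r, b ∈ closure S ∧ b ∉ S := by
    by_contra! hcon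
    obtain ⟨b₁, hb₁, hb₁d⟩ := h1
    obtain ⟨b₂, hb₂, hb₂d⟩ := h2
    let := NormedSpace.restrictScalars ℝ ℂ E
    have := (convex_ball a r).isPreconnected.subset_of_closure_inter_subset hSo
      ⟨b₁, hb₁, hb₁, mem_dom_iff.1 hb₁d⟩ fun b hb => hcon b hb.2 hb.1
    exact hb₂d (mem_dom_iff.2 (this hb₂).2)
  have hθb : θ b ∉ F.W := fun h => hbS ⟨hb, h⟩
  obtain ⟨b', hb'⟩ : S.Nonempty := closure_nonempty_iff.1 ⟨b, hbc⟩
  have hline : ∀ y : ℂ, b + y • (b' - b) ∈ Metric.ball a r →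
      MDifferentiableAt 𝓘(ℂ) 𝓘(ℂ) (fun y : ℂ => g (b + y • (b' - b))) y := fun y hy =>
    MDifferentiableAt.comp (g := g) y (hg _ hy)
      (by fun_prop : DifferentiableAt ℂ (fun y : ℂ => b + y • (b' - b)) y).mdifferentiableAt
  set O : Set ℂ := (fun y : ℂ => b + y • (b' - b)) ⁻¹' Metric.ball a r
  have hO : IsOpen O := Metric.isOpen_ball.preimage (by fun_prop)
  have hOc : IsPreconnected O := by
    let := NormedSpace.restrictScalars ℝ ℂ E
    refine Convex.isPreconnected ?_
    intro y hy z hz s t hs ht hst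
    have h3 := convex_ball a r hy hz hs ht hst
    have h4 : s • (b + y • (b' - b)) + t • (b + z • (b' - b)) = b + (s • y + t • z) • (b' - b) := by
      have h5 : (s : ℂ) + t = 1 := by exact_mod_cast hst
      have h6 : ∀ (s : ℝ) (w : E), s • w = (s : ℂ) • w := fun s w => rfl
      rw [h6, h6, smul_add, smul_add, Complex.real_smul, Complex.real_smul, add_smul, mul_smul, mul_smul,
        add_add_add_comm, ← add_smul, h5, one_smul]
    change b + (s • y + t • z) • (b' - b) ∈ Metric.ball a r
    rw [← h4]; exact h3
  have h0 : (0 : ℂ) ∈ O := by simpa [O] using hb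
  have h1' : (1 : ℂ) ∈ O := by simpa [O] using hb'.1
  refine ⟨b, hb, b' - b, θ b, ⟨hB h0, ?_, ?_, ?_, ?_⟩⟩
  · filter_upwards [hO.mem_nhds h0] with y hy using hline y hy
  · change θ b ∈ _root_.frontier F.W
    rw [F.isOpen_W.frontier_eq]
    refine ⟨?_, hθb⟩
    exact (hθ b hb).continuousWithinAt.mem_closure hbc fun y hy => hy.2
  · change g (b + (0 : ℂ) • (b' - b)) = F.ψ (b + (0 : ℂ) • (b' - b)) (θ b)
    simp [θ]
  · have hψ : ∀ y ∈ O, MDifferentiableAt 𝓘(ℂ) 𝓘(ℂ) (fun y => (F.line b (b' - b)).ψ y (θ b)) y :=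
      fun y hy => (F.line b (b' - b)).mdiff_ψ (θ b) y (hB hy)
    refine (eventually_eq_or_eventually_ne_of_mdifferentiable (a := fun y : ℂ => g (b + y • (b' - b)))
      (b := fun y => (F.line b (b' - b)).ψ y (θ b)) ?_ ?_).resolve_left fun heq => ?_
    · filter_upwards [hO.mem_nhds h0] with y hy using hline y hy
    · filter_upwards [hO.mem_nhds h0] with y hy using hψ y hy
    · have h3 := eqOn_of_mdifferentiable hO hOc hline hψ h0 heq 1 h1'
      have h4 : g (b + (1 : ℂ) • (b' - b)) = F.ψ (b + (1 : ℂ) • (b' - b)) (θ b) := h3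
      rw [one_smul, add_sub_cancel] at h4
      have h5 : θ b' = θ b := by simp only [θ]; rw [h4]; simp [θ]
      exact hθb (h5 ▸ hb'.2)

end LocalFamily

end IslandMaps

/-! ### The dichotomy and the local form of the theorem -/

namespace IslandMaps

section LocalResult

variable {X : Type*} [TopologicalSpace X] [ChartedSpace ℂ X] [IsManifold 𝓘(ℂ) 1 X] [T2Space X]
  [CompactSpace X] [ConnectedSpace X]
variable {E : Type*} [NormedAddCommGroup E] [NormedSpace ℂ E] [FiniteDimensional ℂ E]

namespace LocalFamily

/-- A value which is not exceptional has infinitely many preimages. If only finitely many are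
isolated, the map equals this value on an open set. With a finite frontier it would then be constant
on its whole domain, making `x` a fixed point and contradicting the exact period. -/
theorem infinite_frontier_of_mem_sparseValues {F : LocalFamily X E} {a : E} {p : ℕ} {x : X}
    (hp : 2 ≤ p) (hx : IsRepellingPeriodicPt (F.dom a) (F.map a) p x)
    (hpic : ¬ IsPicardExceptional (F.dom a) (F.map a) x) (hfr : (frontier F.W).Nonempty)
    (hq : (F.φ a).symm x ∈ sparseValues F.W F.f) :
    (frontier F.W).Infinite ∧
      ∃ W₁ ⊆ F.W, IsOpen W₁ ∧ W₁.Nonempty ∧ ∀ w ∈ W₁, F.f w = (F.φ a).symm x := by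
  set q := (F.φ a).symm x
  have hφq : F.φ a q = x := by simp [q]
  have hfd : ∀ z ∈ F.W, ∀ᶠ w in 𝓝 z, MDifferentiableAt 𝓘(ℂ) 𝓘(ℂ) F.f w := fun z hz => by
    filter_upwards [F.isOpen_W.mem_nhds hz] with w hw using mdifferentiableAt_f hw
  have hinf : {w | w ∈ F.W ∧ F.f w = q}.Infinite := fun hfin => by
    refine hpic ⟨?_, (hfin.image (F.ψ a)).subset ?_⟩
    · rw [dom, ← (F.ψ a).image_frontier]; exact hfr.image _
    · rintro z ⟨⟨w, hw, rfl⟩, hz⟩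
      rw [map_ψ] at hz
      exact ⟨w, ⟨hw, (F.φ a).injective (hz.trans hφq.symm)⟩, rfl⟩
  obtain ⟨w, ⟨hwW, hwq⟩, hwn⟩ : ({w | w ∈ F.W ∧ F.f w = q} \ isolatedPreimages F.W F.f q).Nonempty :=
    (hinf.sdiff hq).nonempty
  have hev : ∀ᶠ w' in 𝓝 w, F.f w' = q :=
    (eventually_eq_or_eventually_ne (hfd w hwW)).resolve_right fun h => hwn ⟨hwW, hwq, h⟩
  refine ⟨fun hfin => ?_, ?_⟩
  · have hall := eq_const_of_finite_frontier F.isOpen_W F.mdiff_f hfin hwW hev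
    have h1 : F.map a x = x := by
      have h2 := hall _ (mem_dom_iff.1 (hx.defined 0 (by omega)))
      change F.φ a (F.f ((F.ψ a).symm x)) = x
      rw [← hφq]
      congr 1
      rw [hφq]; exact h2
    have h3 : Function.IsPeriodicPt (F.map a) 1 x := h1
    have := h3.minimalPeriod_le one_pos
    rw [hx.period] at this
    omega
  · obtain ⟨V, hV, hVo, hwV⟩ := mem_nhds_iff.1 (inter_mem hev (F.isOpen_W.mem_nhds hwW))
    exact ⟨V, fun y hy => (hV hy).2, hVo, ⟨w, hwV⟩, fun y hy => (hV hy).1⟩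

/-- The hypothesis `hact` expresses activity on every small ball: no iterate leaves the domain
simultaneously for all parameters, and the iterates are not normal if they are all defined. The
proof distinguishes whether the whole orbit is defined throughout a small ball. -/
theorem exists_iterate_eq {F : LocalFamily X E} {a : E} {R : ℝ} (hR : 0 < R) (hB : Metric.ball a R ⊆ F.B)
    (hisl : ∀ b ∈ F.B, ∃ N, HasIslandProperty (F.dom b) (F.map b) N) {g x : E → X}
    (hg : ∀ b ∈ Metric.ball a R, MDifferentiableAt 𝓘(ℂ, E) 𝓘(ℂ) g b)
    (hx : ∀ b ∈ Metric.ball a R, MDifferentiableAt 𝓘(ℂ, E) 𝓘(ℂ) x b) {p : ℕ} (hp : 2 ≤ p)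
    (hxa : IsRepellingPeriodicPt (F.dom a) (F.map a) p (x a))
    (hpic : ¬ IsPicardExceptional (F.dom a) (F.map a) (x a))
    (hact : ∀ r > 0, r ≤ R →
      (∀ n, ∃ b ∈ Metric.ball a r, IterDefined (F.dom b) (F.map b) n (g b) → (F.map b)^[n] (g b) ∈ F.dom b) ∧
      ((∀ n, ∀ b ∈ Metric.ball a r, IterDefined (F.dom b) (F.map b) n (g b)) →
        ¬ IsNormalOn (fun n b => (F.map b)^[n] (g b)) (Metric.ball a r))) :
    ∃ b ∈ Metric.ball a R, ∃ m, IterDefined (F.dom b) (F.map b) m (g b) ∧ (F.map b)^[m] (g b) = x b := by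
  have haR : a ∈ Metric.ball a R := Metric.mem_ball_self hR
  set q := (F.φ a).symm (x a)
  have hqc : ContinuousAt (fun b => (F.φ b).symm (x b)) a :=
    ContinuousAt.comp (f := fun b => (b, x b)) (continuousAt_φ_symm (hB haR) _)
      (continuousAt_id.prodMk (hx a haR).continuousAt)
  have hev : ∀ᶠ b in 𝓝 a, (frontier F.W).Nonempty → (F.φ b).symm (x b) ∈ sparseValues F.W F.f →
      (F.φ b).symm (x b) = q := by
    by_cases hfr : (frontier F.W).Nonempty
    · obtain ⟨N, hN⟩ := hisl a (hB haR)
      -- Sparse values are finite in number and `(φ b).symm (x b)` depends continuously on `b`.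
      -- After shrinking the ball, `q` is thus the only sparse value that can occur.
      have h1 : (sparseValues F.W F.f \ {q})ᶜ ∈ 𝓝 q :=
        ((finite_sparseValues hN hfr).subset sdiff_subset).isClosed.isOpen_compl.mem_nhds fun h => h.2 rfl
      filter_upwards [hqc.eventually h1] with b hb _ hbs
      by_contra hne
      exact hb ⟨hbs, hne⟩
    · exact Eventually.of_forall fun b h => absurd h hfr
  obtain ⟨r₀, hr₀, hball₀⟩ := Metric.eventually_nhds_iff_ball.1 hev
  set r := min r₀ R
  have hr : 0 < r := lt_min hr₀ hR
  have hrR : Metric.ball a r ⊆ Metric.ball a R := Metric.ball_subset_ball (min_le_right _ _)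
  by_cases hall : ∀ n, ∀ b ∈ Metric.ball a r, IterDefined (F.dom b) (F.map b) n (g b)
  · obtain ⟨J, -, hJ⟩ := exists_finset_discChart (x a)
    obtain ⟨b, hb, n, hn⟩ := exists_iterate_eq_of_not_mapsToDisc hJ hr (hrR.trans hB)
      (fun b hb => hg b (hrR hb)) hall (fun b hb => hx b (hrR hb)) hp hxa hpic (by
        intro s hs
        by_contra! hgood
        have hsr : Metric.ball a (min s r) ⊆ Metric.ball a r := Metric.ball_subset_ball (min_le_right _ _)
        refine (hact (min s r) (lt_min hs hr) ((min_le_right _ _).trans (min_le_right _ _))).2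
          (fun n b hb => hall n b (hsr hb)) ?_
        refine isNormalOn_of_mapsToDisc (J := J) (lt_min hs hr) (fun n b hb => ?_) fun n b hb => ?_
        · exact mdifferentiableAt_iterate (hB (hrR (hsr hb))) (hg b (hrR (hsr hb))) (hall n b (hsr hb))
        · obtain ⟨j, hj, hjm⟩ := hgood n b (Metric.ball_subset_ball (min_le_left _ _) hb)
          exact ⟨j, hj, hjm.mono_left (Metric.ball_subset_ball (min_le_left _ _))⟩)
    exact ⟨b, hrR hb, n, hall n b hb, hn⟩
  · have hex : ∃ n, ∃ b ∈ Metric.ball a r, (F.map b)^[n] (g b) ∉ F.dom b := by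
      by_contra! hcon
      exact hall fun n b hb j _ => hcon j b hb
    classical
    -- Minimality of `n` makes the `n`-th iterate defined, hence holomorphic, on the whole ball.
    -- Activity supplies a parameter at which this iterate still lies in the domain, so it must
    -- cross the boundary somewhere.
    obtain ⟨n, hn, hmin⟩ : ∃ n, (∃ b ∈ Metric.ball a r, (F.map b)^[n] (g b) ∉ F.dom b) ∧
        ∀ j < n, ∀ b ∈ Metric.ball a r, (F.map b)^[j] (g b) ∈ F.dom b := by
      refine ⟨Nat.find hex, Nat.find_spec hex, fun j hj b hb => ?_⟩
      by_contra h
      exact Nat.find_min hex hj ⟨b, hb, h⟩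
    have hdef : ∀ b ∈ Metric.ball a r, IterDefined (F.dom b) (F.map b) n (g b) :=
      fun b hb j hj => hmin j hj b hb
    have hin : ∃ b ∈ Metric.ball a r, (F.map b)^[n] (g b) ∈ F.dom b := by
      obtain ⟨b, hb, h⟩ := (hact r hr (min_le_right _ _)).1 n
      exact ⟨b, hb, h (hdef b hb)⟩
    obtain ⟨b, hb, u, η, hcr⟩ := exists_isCrossing (hrR.trans hB)
      (fun b hb => mdifferentiableAt_iterate (hB (hrR hb)) (hg b (hrR hb)) (hdef b hb)) hin hn
    have hline : Continuous fun y : ℂ => b + y • u := by fun_prop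
    obtain ⟨ε, hε, hεball⟩ := Metric.isOpen_iff.1 (Metric.isOpen_ball.preimage hline :
      IsOpen ((fun y : ℂ => b + y • u) ⁻¹' Metric.ball a r)) 0 (by simpa using hb)
    have hnear : ∀ᶠ y in 𝓝 (0 : ℂ), b + y • u ∈ Metric.ball a r :=
      mem_of_superset (Metric.ball_mem_nhds 0 hε) hεball
    obtain ⟨y, hy, m, hm1, hm2⟩ := hcr.exists_iterate_eq (x := fun y => x (b + y • u)) (q := q)
      (fun y hy => hisl _ hy)
      (by
        filter_upwards [hnear] with y hy
        exact MDifferentiableAt.comp (g := x) y (hx _ (hrR hy))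
          (by fun_prop : DifferentiableAt ℂ (fun y : ℂ => b + y • u) y).mdifferentiableAt)
      (by
        filter_upwards [hnear] with y hy
        exact hball₀ _ (Metric.ball_subset_ball (min_le_left _ _) hy) ⟨η, hcr.frontier⟩)
      (infinite_frontier_of_mem_sparseValues hp hxa hpic ⟨η, hcr.frontier⟩) hε
    have hyr := hεball hy
    refine ⟨b + y • u, hrR hyr, m + n, iterDefined_add.2 ⟨hdef _ hyr, hm1⟩, ?_⟩
    rw [Function.iterate_add_apply]
    exact hm2

end LocalFamily

end LocalResult

/-! ### From manifolds of parameters to vector spaces -/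

section Charts

variable {X : Type*} [TopologicalSpace X] [ChartedSpace ℂ X]
variable {E : Type*} [NormedAddCommGroup E] [NormedSpace ℂ E]
variable {M : Type*} [TopologicalSpace M] [ChartedSpace E M] [IsManifold 𝓘(ℂ, E) 1 M]

/-- A natural family, read in a chart of its parameter space. -/
noncomputable def NaturalFamily.localFamily (F : NaturalFamily E M X) (lam0 : M) : LocalFamily X E where
  B := (chartAt E lam0).target
  W := F.W
  f := F.f
  φ b := F.φ ((chartAt E lam0).symm b)
  ψ b := F.ψ ((chartAt E lam0).symm b)
  isOpen_B := (chartAt E lam0).open_target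
  isOpen_W := F.isOpen_W
  mdiff_f := F.holomorphic_f
  mdiff_φ z b hb := MDifferentiableAt.comp (g := fun lam => F.φ lam z) b (F.holomorphic_φ z _)
    ((mdifferentiable_chart (I := 𝓘(ℂ, E)) lam0).mdifferentiableAt_symm hb)
  mdiff_ψ z b hb := MDifferentiableAt.comp (g := fun lam => F.ψ lam z) b (F.holomorphic_ψ z _)
    ((mdifferentiable_chart (I := 𝓘(ℂ, E)) lam0).mdifferentiableAt_symm hb)
  mdiff_map b _ := F.holomorphic_map _

theorem isNormalOn_of_chart [CompactSpace X] [T2Space X] {ι : Type*} {g : ι → M → X}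
    {κ : OpenPartialHomeomorph M E} {S : Set E} (h : IsNormalOn (fun i b => g i (κ.symm b)) S) :
    IsNormalOn g (κ.source ∩ κ ⁻¹' S) := by
  let : UniformSpace X := uniformSpaceOfCompactR1
  intro u
  obtain ⟨s, G, hs, hG⟩ := h u
  refine ⟨s, fun lam => G (κ lam), hs, ?_⟩
  have h1 := hG.comp κ (t := κ.source ∩ κ ⁻¹' S) (fun lam hlam => hlam.2)
    (κ.continuousOn.mono inter_subset_left)
  refine h1.congr fun k lam hlam => ?_
  simp [κ.left_inv hlam.1]

end Charts

end IslandMaps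

/-! ### Proof of the theorem -/

theorem proposition2
    {X : Type*} [TopologicalSpace X] [T2Space X] [CompactSpace X] [ConnectedSpace X]
    [ChartedSpace ℂ X] [IsManifold 𝓘(ℂ) 1 X]
    {E : Type*} [NormedAddCommGroup E] [NormedSpace ℂ E] [FiniteDimensional ℂ E]
    {M : Type*} [TopologicalSpace M] [T2Space M] [ConnectedSpace M]
    [ChartedSpace E M] [IsManifold 𝓘(ℂ, E) 1 M]
    (F : IslandMaps.NaturalFamily E M X)
    (hF : ∀ lam, IslandMaps.IsAhlforsIslandMap (F.dom lam) (F.map lam))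
    (v : X) (hv : v ∈ IslandMaps.singularValues F.W F.f)
    (lam0 : M) (hactive : F.IsActiveAt v lam0)
    (p : ℕ) (hp : 3 ≤ p)
    (U : Set M) (hU : IsOpen U) (hlam0 : lam0 ∈ U)
    (x : M → X)
    (hx0 : IslandMaps.IsRepellingPeriodicPt (F.dom lam0) (F.map lam0) p (x lam0))
    (hpic : ¬ IslandMaps.IsPicardExceptional (F.dom lam0) (F.map lam0) (x lam0))
    (hx : MDifferentiableOn 𝓘(ℂ, E) 𝓘(ℂ) x U)
    (hxper : ∀ lam ∈ U, IslandMaps.IterDefined (F.dom lam) (F.map lam) p (x lam) ∧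
      (F.map lam)^[p] (x lam) = x lam) :
    ∃ (n : ℕ → ℕ) (lam : ℕ → M),
      Tendsto n atTop atTop ∧ Tendsto lam atTop (𝓝 lam0) ∧
      ∀ k, lam k ∈ U ∧
        IslandMaps.IterDefined (F.dom (lam k)) (F.map (lam k)) (n k) (F.φ (lam k) v) ∧
        (F.map (lam k))^[n k] (F.φ (lam k) v) = x (lam k) := by
  set κ := chartAt E lam0
  have hκ : κ.MDifferentiable 𝓘(ℂ, E) 𝓘(ℂ, E) := mdifferentiable_chart lam0
  have h0s : lam0 ∈ κ.source := mem_chart_source E lam0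
  have h0 : κ.symm (κ lam0) = lam0 := κ.left_inv h0s
  have hsymm : Tendsto κ.symm (𝓝 (κ lam0)) (𝓝 lam0) := by
    have := κ.continuousAt_symm (κ.map_source h0s)
    rwa [ContinuousAt, h0] at this
  set L := F.localFamily lam0
  obtain ⟨R, hR, hball⟩ := Metric.eventually_nhds_iff_ball.1
    ((hsymm.eventually (hU.mem_nhds hlam0)).and (κ.open_target.mem_nhds (κ.map_source h0s)))
  -- The local result is applied on arbitrarily small balls of the chart. Each failure of its
  -- activity hypothesis would exhibit the preimage of such a ball as a neighbourhood on which the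
  -- singular value is passive.
  have key : ∀ r > 0, ∃ b ∈ Metric.ball (κ lam0) (min r R), ∃ m,
      IslandMaps.IterDefined (L.dom b) (L.map b) m (L.φ b v) ∧ (L.map b)^[m] (L.φ b v) = x (κ.symm b) := by
    intro r hr
    have hsub : Metric.ball (κ lam0) (min r R) ⊆ Metric.ball (κ lam0) R :=
      Metric.ball_subset_ball (min_le_right _ _)
    refine IslandMaps.LocalFamily.exists_iterate_eq (F := L) (g := fun b => L.φ b v)
      (x := fun b => x (κ.symm b)) (p := p) (lt_min hr hR) (fun b hb => (hball b (hsub hb)).2)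
      (fun b _ => ?_) (fun b hb => L.mdiff_φ v b (hball b (hsub hb)).2) (fun b hb => ?_) (by omega) ?_ ?_ ?_
    · obtain ⟨N, -, hN⟩ := (hF (κ.symm b)).island
      exact ⟨N, hN⟩
    · obtain ⟨h1, h2⟩ := hball b (hsub hb)
      exact MDifferentiableAt.comp (g := x) b (hx.mdifferentiableAt (hU.mem_nhds h1))
        (hκ.mdifferentiableAt_symm h2)
    · change IslandMaps.IsRepellingPeriodicPt (F.dom (κ.symm (κ lam0))) (F.map (κ.symm (κ lam0))) p
        (x (κ.symm (κ lam0)))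
      rwa [h0]
    · change ¬ IslandMaps.IsPicardExceptional (F.dom (κ.symm (κ lam0))) (F.map (κ.symm (κ lam0)))
        (x (κ.symm (κ lam0)))
      rwa [h0]
    · intro s hs _
      have hVo : IsOpen (κ.source ∩ κ ⁻¹' Metric.ball (κ lam0) s) :=
        κ.isOpen_inter_preimage Metric.isOpen_ball
      have hV0 : lam0 ∈ κ.source ∩ κ ⁻¹' Metric.ball (κ lam0) s := ⟨h0s, Metric.mem_ball_self hs⟩
      refine ⟨fun n => ?_, fun hdef hnormal => ?_⟩
      · by_contra! hcon
        refine hactive ⟨_, hVo, hV0, Or.inl ⟨n, fun lam hlam => ?_⟩⟩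
        have h1 := hcon (κ lam) hlam.2
        have h2 : κ.symm (κ lam) = lam := κ.left_inv hlam.1
        have h3 : IslandMaps.IterDefined (F.dom (κ.symm (κ lam))) (F.map (κ.symm (κ lam))) n
            (F.φ (κ.symm (κ lam)) v) ∧ F.orbit v n (κ.symm (κ lam)) ∉ F.dom (κ.symm (κ lam)) := h1
        rwa [h2] at h3
      · refine hactive ⟨_, hVo, hV0, Or.inr ⟨fun n lam hlam => ?_, ?_⟩⟩
        · have h1 := hdef n (κ lam) hlam.2
          have h2 : κ.symm (κ lam) = lam := κ.left_inv hlam.1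
          have h3 : IslandMaps.IterDefined (F.dom (κ.symm (κ lam))) (F.map (κ.symm (κ lam))) n
            (F.φ (κ.symm (κ lam)) v) := h1
          rwa [h2] at h3
        · exact IslandMaps.isNormalOn_of_chart (g := F.orbit v) hnormal
  choose b hb m hm1 hm2 using fun k : ℕ => key (1 / ((k : ℝ) + 1)) (by positivity)
  have hbU : ∀ k, κ.symm (b k) ∈ U := fun k =>
    (hball _ (Metric.ball_subset_ball (min_le_right _ _) (hb k))).1
  have hb0 : Tendsto b atTop (𝓝 (κ lam0)) := by
    rw [tendsto_iff_dist_tendsto_zero]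
    refine squeeze_zero (fun k => dist_nonneg) (fun k => ?_) tendsto_one_div_add_atTop_nhds_zero_nat
    exact (Metric.ball_subset_ball (min_le_left _ _) (hb k)).le
  -- The numbers `m k` might be bounded. Since the orbit has reached a point of period `p`, adding
  -- `k` further turns around the cycle costs nothing and makes the iteration numbers tend to
  -- infinity.
  refine ⟨fun k => m k + k * p, fun k => κ.symm (b k), ?_, hsymm.comp hb0, fun k => ⟨hbU k, ?_⟩⟩
  · refine tendsto_atTop_mono (fun k => ?_) tendsto_id
    have : k * 1 ≤ k * p := Nat.mul_le_mul_left k (by omega)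
    simp only [id]
    omega
  · obtain ⟨h1, h2⟩ := hxper _ (hbU k)
    exact IslandMaps.IterDefined.add_mul_period (hm1 k) (hm2 k) h1 h2 k
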